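/- Let $N\ge 1$ be an integer with $h:=\pi/N\le 1$, let $\mathbb T_h=h\mathbb Z/2\pi\mathbb Z$ (a lattice of $2N$ points) and $(\mathbb T_h)^*=\{-N,\dots,N-1\}$. For $f:\mathbb T_h\to\mathbb C$ put $$\widehat f(k)=\frac{h}{\sqrt{2\pi}}\sum_{x\in\mathbb T_h}f(x)e^{-ixk},\qquad \|f\|_{L^2(\mathbb T_h)}^2=h\sum_{x\in\mathbb T_h}|f(x)|^2,\qquad \|f\|_{H^s(\mathbb T_h)}^2=\sum_{k\in(\mathbb T_h)^*}(1+k^2)^s|\widehat f(k)|^2,$$ and $\|(f,g)\|_{\mathbb H^s(\mathbb T_h)}^2=\|f\|_{H^s(\mathbb T_h)}^2+\|g\|_{H^s(\mathbb T_h)}^2$. The Fourier multiplier with symbol $m$ maps $f$ to $\frac1{\sqrt{2\pi}}\sum_{k\in(\mathbb T_h)^*}m(k)\widehat f(k)e^{ixk}$. Let $\nabla_h$ and $\partial_h$ be the Fourier multipliers with symbols $\frac{2i}{h}\sin(\frac{hk}{2})$ and $ik$ (for $-N\le k<N$), and let $S_h^\pm(t)=e^{\mp\frac{t}{h^2}(\nabla_h-\partial_h)}$.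 The coupled FPU system with initial data $(u_{h,0}^+,u_{h,0}^-)$ is $$u_h^\pm(t)=S_h^\pm(t)u_{h,0}^\pm\mp\frac14\int_0^tS_h^\pm(t-t')\nabla_h\Big(u_h^\pm(t')+e^{\pm\frac{2t'}{h^2}\partial_h}u_h^\mp(t')\Big)^2dt',$$ and the decoupled FPU system with the same initial data is $$v_h^\pm(t)=S_h^\pm(t)u_{h,0}^\pm\mp\frac14\int_0^tS_h^\pm(t-t')\nabla_h\big(v_h^\pm(t')\big)^2dt'.$$ A solution on $[-T,T]$ is a pair of continuous functions of $t\in[-T,T]$, with values in the (finite-dimensional) space of functions $\mathbb T_h\to\mathbb C$, that satisfies the system for all $t\in[-T,T]$. **Proposition.** For every $R>0$ there are $C=C(R)>0$ and $T=T(R)>0$ such that the following holds for all $0<s\le1$, all integers $N\ge1$ with $h=\pi/N\le1$, and all $u_{h,0}^\pm:\mathbb T_h\to\mathbb R$ with $$\sum_{x\in\mathbb T_h}u_{h,0}^{+}(x)=\sum_{x\in\mathbb T_h}u_{h,0}^{-}(x)=0,\qquad \|(u_{h,0}^+,u_{h,0}^-)\|_{\mathbb H^s(\mathbb T_h)}\le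 R.$$ The coupled and the decoupled FPU systems with initial data $(u_{h,0}^+,u_{h,0}^-)$ both have a solution on $[-T,T]$, and if $(u_h^+,u_h^-)$ is any solution of the coupled system and $(v_h^+,v_h^-)$ any solution of the decoupled system on $[-T,T]$ with these initial data, then, for both signs, $$\sup_{t\in[-T,T]}\|u_h^\pm(t)-v_h^\pm(t)\|_{L^2(\mathbb T_h)}\le C\,h^s.$$ -/

import Mathlib

open scoped Real

noncomputable section

namespace FPU

/-- The mesh size `h = π / N` of the periodic lattice `𝕋_h = hℤ / 2πℤ`, which has `2N` points. -/
def mesh (N : ℕ) : ℝ := π / N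

/-- The point `x = h n` of `𝕋_h` with index `n : ZMod (2 * N)`, given by its representative in
`[0, 2π)`. Complex functions on `𝕋_h` are functions `ZMod (2 * N) → ℂ`. -/
def point (N : ℕ) (n : ZMod (2 * N)) : ℝ := mesh N * (n.val : ℝ)

/-- The frequencies `-N, …, N - 1`, representing the dual group `(𝕋_h)^* = ℤ / 2Nℤ`. -/
def freq (N : ℕ) : Finset ℤ := Finset.Ico (-(N : ℤ)) (N : ℤ)

/-- The discrete Fourier coefficient `(h / √(2π)) ∑_{x ∈ 𝕋_h} f(x) e^{-ixk}`. -/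
def latticeFourier (N : ℕ) [NeZero N] (f : ZMod (2 * N) → ℂ) (k : ℤ) : ℂ :=
  ((mesh N / √(2 * π) : ℝ) : ℂ) *
    ∑ n : ZMod (2 * N), f n * Complex.exp (-(Complex.I * (point N n : ℂ) * (k : ℂ)))

/-- The discrete Fourier series `(1 / √(2π)) ∑_{-N ≤ k < N} g(k) e^{ixk}`. -/
def latticeFourierInv (N : ℕ) (g : ℤ → ℂ) (n : ZMod (2 * N)) : ℂ :=
  ((1 / √(2 * π) : ℝ) : ℂ) *
    ∑ k ∈ freq N, g k * Complex.exp (Complex.I * (point N n : ℂ) * (k : ℂ))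

/-- The Fourier multiplier on `𝕋_h` with symbol `m(k)`, `-N ≤ k < N`. -/
def multiplier (N : ℕ) [NeZero N] (m : ℤ → ℂ) (f : ZMod (2 * N) → ℂ) : ZMod (2 * N) → ℂ :=
  latticeFourierInv N (fun k => m k * latticeFourier N f k)

/-- The symbol `(2i/h) sin(hk/2)` of `∇_h`. -/
def nablaSymbol (N : ℕ) (k : ℤ) : ℂ :=
  Complex.I * ((2 / mesh N * Real.sin (mesh N * (k : ℝ) / 2) : ℝ) : ℂ)

/-- The symbol `ik` of `∂_h`. -/
def partialSymbol (k : ℤ) : ℂ := Complex.I * (k : ℂ)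

/-- The discrete differential `∇_h`. -/
def nabla (N : ℕ) [NeZero N] (f : ZMod (2 * N) → ℂ) : ZMod (2 * N) → ℂ :=
  multiplier N (nablaSymbol N) f

/-- The phase translation `e^{a ∂_h}`. -/
def translation (N : ℕ) [NeZero N] (a : ℝ) (f : ZMod (2 * N) → ℂ) : ZMod (2 * N) → ℂ :=
  multiplier N (fun k => Complex.exp ((a : ℂ) * partialSymbol k)) f

/-- The linear FPU propagator `S_h^±(t) = e^{∓ (t / h²) (∇_h - ∂_h)}`; the sign `±` is given by
`σ = 1` or `σ = -1`. -/
def propagator (N : ℕ) [NeZero N] (σ t : ℝ) (f : ZMod (2 * N) → ℂ) : ZMod (2 * N) → ℂ :=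
  multiplier N
    (fun k => Complex.exp (((-σ * (t / mesh N ^ 2) : ℝ) : ℂ) *
      (nablaSymbol N k - partialSymbol k))) f

/-- The norm of `L²(𝕋_h)`: the square root of `h ∑_x |f(x)|²`. -/
def l2Norm (N : ℕ) [NeZero N] (f : ZMod (2 * N) → ℂ) : ℝ :=
  √(mesh N * ∑ n : ZMod (2 * N), ‖f n‖ ^ 2)

/-- The norm of `H^s(𝕋_h)`: the square root of `∑_k ⟨k⟩^{2s} |f̂(k)|²`, where `⟨k⟩² = 1 + k²`. -/
def sobolevNorm (N : ℕ) [NeZero N] (s : ℝ) (f : ZMod (2 * N) → ℂ) : ℝ :=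
  √(∑ k ∈ freq N, (1 + (k : ℝ) ^ 2) ^ s * ‖latticeFourier N f k‖ ^ 2)

/-- The norm of `ℍ^s(𝕋_h)` of a pair of functions. -/
def pairSobolevNorm (N : ℕ) [NeZero N] (s : ℝ) (f g : ZMod (2 * N) → ℂ) : ℝ :=
  √(sobolevNorm N s f ^ 2 + sobolevNorm N s g ^ 2)

/-- The right-hand side `S_h^±(t) f ∓ (1/4) ∫₀ᵗ S_h^±(t - t') ∇_h F(t') dt'` of a Duhamel formula,
with `σ = ±1` for the sign. -/
def duhamel (N : ℕ) [NeZero N] (σ : ℝ) (f : ZMod (2 * N) → ℂ) (F : ℝ → ZMod (2 * N) → ℂ)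
    (t : ℝ) : ZMod (2 * N) → ℂ :=
  propagator N σ t f - (σ / 4) • ∫ t' in (0 : ℝ)..t, propagator N σ (t - t') (nabla N (F t'))

/-- `(up, um)` is a solution on `[-T, T]` of the coupled FPU system with initial data `(fp, fm)`.
The space of functions on `𝕋_h` is finite-dimensional, so that continuity in time for its usual
topology is continuity for the norm of every `H^s(𝕋_h)`. Squares are pointwise. -/
structure IsCoupledSolution (N : ℕ) [NeZero N] (T : ℝ) (fp fm : ZMod (2 * N) → ℂ)
    (up um : ℝ → ZMod (2 * N) → ℂ) : Prop where
  continuousOn_plus : ContinuousOn up (Set.Icc (-T) T)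
  continuousOn_minus : ContinuousOn um (Set.Icc (-T) T)
  eq_plus : ∀ t ∈ Set.Icc (-T) T,
    up t = duhamel N 1 fp
      (fun t' => (up t' + translation N (2 * t' / mesh N ^ 2) (um t')) ^ 2) t
  eq_minus : ∀ t ∈ Set.Icc (-T) T,
    um t = duhamel N (-1) fm
      (fun t' => (um t' + translation N (-(2 * t' / mesh N ^ 2)) (up t')) ^ 2) t

/-- `(vp, vm)` is a solution on `[-T, T]` of the decoupled FPU system with initial data
`(fp, fm)`. -/
structure IsDecoupledSolution (N : ℕ) [NeZero N] (T : ℝ) (fp fm : ZMod (2 * N) → ℂ)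
    (vp vm : ℝ → ZMod (2 * N) → ℂ) : Prop where
  continuousOn_plus : ContinuousOn vp (Set.Icc (-T) T)
  continuousOn_minus : ContinuousOn vm (Set.Icc (-T) T)
  eq_plus : ∀ t ∈ Set.Icc (-T) T, vp t = duhamel N 1 fp (fun t' => vp t' ^ 2) t
  eq_minus : ∀ t ∈ Set.Icc (-T) T, vm t = duhamel N (-1) fm (fun t' => vm t' ^ 2) t

end FPU

end

noncomputable section

namespace FPU

set_option linter.unusedSectionVars false

/-! ### Representatives of the dual group -/

/-! Undo the linear flow and pass to Fourier coefficients, writing h for the mesh size and |k| for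
`ab k`. The resulting profiles satisfy an equation whose right-hand side is, up to a constant, the
sum over k₁ of q(k) e^{iψt} a(k₁) a(k - k₁), where q is `qSym` and ψ is `psi` (`eq_duhamel_iff`).
Each factor travels with the wave or against it. The coupled system sums over all four combinations,
the decoupled one keeps only the pair of waves in the same direction, and the weights `ccC`, `ccD`
let one argument serve both.

Sum-to-product formulas control ψ. For waves in the same direction |ψ| is at least a constant times
|k||k₁||k - k₁|, as for KdV. If one factor travels in the opposite direction, |ψ| is at least h⁻²
times the frequency of that factor; if both do, h⁻² times the output frequency. Interactions
wrapping around modulo 2N have |ψ| of order h⁻³. Hence the loss of one derivative in q is always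
repaid (`abs_qSym_mul_le`), and the cross terms gain powers of h in addition.

Data are only slightly better than L², so the repayment is organised as follows. Functions are
measured in `XB`: bounded in ℓ¹ plus bounded variation in ℓ². On such functions the undifferentiated
quadratic interaction is bounded in L² of time and frequency (`XB.integral_norm_bil_sq_le`): expand
the square; two interactions with the same output have well separated phases unless they coincide up
to symmetry or are harmless (`abs_psi_sub_psi_pos_and_inv_le`), and integration by parts in time
gives a summable weight. Conversely a normal form at frequencies above M shows that solutions lie in
`XB` (`XB_of_quad`): its boundary term is small in ℓ¹, and when the time derivative falls on a
profile, the derivative in that equation is absorbed by the multiplier, leaving a quantity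
controlled by the L² bound. Taking M large and then T small closes the estimates (`exists_a_priori`,
`exists_linear_estimate`).

Regularity enters through the translation by one lattice site, with symbol `chi`. It commutes with
the equation, so a solution minus its translate solves a linear equation and stays as small as
initially (`exists_shift_estimate`). Since |chi(k) - 1| is comparable with h|k| and at most 2, the
initial size is O(h^s), with a constant independent of s (`norm_diag_chi_hat_le`).

For the comparison (`exists_cross_estimate`) a normal form removes all cross terms of the coupled
equation. Its multiplier carries a factor h that can be exchanged for the operator chi - 1, so the
boundary term and, after a trilinear estimate (`integral_norm_bil_bil_le`), all sources are O(h^s).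
The corrected difference then satisfies the linear estimate.

Existence comes from a truncated vector field: the a priori bound shows that the truncation is never
felt (`exists_profile`). Negative times reduce to positive ones, because reversing time exchanges
the two directions. -/

lemma mesh_pos (N : ℕ) [NeZero N] : 0 < mesh N :=
  div_pos Real.pi_pos (Nat.cast_pos.2 (Nat.pos_of_ne_zero (NeZero.ne N)))

lemma mesh_mul (N : ℕ) [NeZero N] : mesh N * N = π :=
  div_mul_cancel₀ _ (Nat.cast_ne_zero.2 (NeZero.ne N))

/-- The representative in `[-N, N)` of a frequency modulo `2N`. -/
def rep {N : ℕ} (k : ZMod (2 * N)) : ℤ := ((k + (N : ZMod (2 * N))).val : ℤ) - N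

section rep
variable {N : ℕ} [NeZero N]

lemma neg_le_rep (k : ZMod (2 * N)) : -(N : ℤ) ≤ rep k := by
  unfold rep; omega

lemma rep_lt (k : ZMod (2 * N)) : rep k < N := by
  have := ZMod.val_lt (k + (N : ZMod (2 * N)))
  unfold rep; omega

lemma rep_cast (k : ZMod (2 * N)) : ((rep k : ℤ) : ZMod (2 * N)) = k := by
  simp [rep]

lemma two_mul_dvd_iff (z w : ℤ) :
    ((z : ZMod (2 * N)) = w) ↔ (2 * (N : ℤ)) ∣ z - w := by
  rw [← sub_eq_zero, ← Int.cast_sub, ZMod.intCast_zmod_eq_zero_iff_dvd]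
  push_cast; rfl

lemma exists_rep_eq (z : ℤ) : ∃ j : ℤ, z = rep (z : ZMod (2 * N)) + 2 * N * j := by
  have h := (two_mul_dvd_iff (N := N) z (rep (z : ZMod (2 * N)))).1 (rep_cast _).symm
  obtain ⟨j, hj⟩ := h
  exact ⟨j, by linarith⟩

lemma rep_eq {z : ℤ} (h1 : -(N : ℤ) ≤ z) (h2 : z < N) : rep (z : ZMod (2 * N)) = z := by
  obtain ⟨j, hj⟩ := exists_rep_eq (N := N) z
  have h3 := neg_le_rep (z : ZMod (2 * N))
  have h4 := rep_lt (z : ZMod (2 * N))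
  have h5 : j = 0 := by
    have hN : (0 : ℤ) < N := by have := NeZero.pos N; exact_mod_cast this
    by_contra hne
    rcases lt_or_gt_of_ne hne with h | h
    · have : 2 * (N : ℤ) * j ≤ 2 * N * (-1) := mul_le_mul_of_nonneg_left (by omega) (by omega)
      omega
    · have : 2 * (N : ℤ) * 1 ≤ 2 * N * j := mul_le_mul_of_nonneg_left (by omega) (by omega)
      omega
  rw [h5] at hj; omega

lemma rep_zero : rep (0 : ZMod (2 * N)) = 0 := by
  have hN : (0 : ℤ) < N := by have := NeZero.pos N; exact_mod_cast this
  have := rep_eq (N := N) (z := 0) (by omega) hN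
  simpa using this

lemma rep_injective : Function.Injective (rep : ZMod (2 * N) → ℤ) := fun a b h => by
  rw [← rep_cast a, h, rep_cast]

lemma rep_eq_zero {k : ZMod (2 * N)} : rep k = 0 ↔ k = 0 := by
  rw [← rep_zero (N := N)]; exact rep_injective.eq_iff

/-- A shift by a nonzero multiple of 2N leads out of the open interval (-N, N), while the
representative has modulus at most N. This minimality makes `ab` subadditive. -/
lemma abs_rep_le_abs (z : ℤ) : |rep (z : ZMod (2 * N))| ≤ |z| := by
  obtain ⟨j, hj⟩ := exists_rep_eq (N := N) z
  have h3 := neg_le_rep (z : ZMod (2 * N))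
  have h4 := rep_lt (z : ZMod (2 * N))
  have hN : (0 : ℤ) < N := by have := NeZero.pos N; exact_mod_cast this
  rcases lt_trichotomy j 0 with h | h | h
  · have : 2 * (N : ℤ) * j ≤ 2 * N * (-1) := mul_le_mul_of_nonneg_left (by omega) (by omega)
    have h5 : |rep (z : ZMod (2 * N))| ≤ N := abs_le.2 ⟨by omega, by omega⟩
    have h6 : -z ≤ |z| := neg_le_abs z
    omega
  · subst h; simp at hj; rw [← hj]
  · have : 2 * (N : ℤ) * 1 ≤ 2 * N * j := mul_le_mul_of_nonneg_left (by omega) (by omega)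
    have h5 : |rep (z : ZMod (2 * N))| ≤ N := abs_le.2 ⟨by omega, by omega⟩
    have h6 : z ≤ |z| := le_abs_self z
    omega

/-- Both representatives lie in [-N, N), so their sum wraps at most once. The two shifted
alternatives are the aliased interactions. -/
lemma rep_add_rep (k l : ZMod (2 * N)) :
    rep k + rep l = rep (k + l) ∨ rep k + rep l = rep (k + l) + 2 * N ∨
      rep k + rep l = rep (k + l) - 2 * N := by
  obtain ⟨j, hj⟩ := exists_rep_eq (N := N) (rep k + rep l)
  rw [Int.cast_add, rep_cast, rep_cast] at hj
  have h1 := neg_le_rep k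
  have h2 := rep_lt k
  have h3 := neg_le_rep l
  have h4 := rep_lt l
  have h5 := neg_le_rep (k + l)
  have h6 := rep_lt (k + l)
  have hN : (0 : ℤ) < N := by have := NeZero.pos N; exact_mod_cast this
  have hj1 : j < 2 := by
    by_contra h
    have : 2 * (N : ℤ) * 2 ≤ 2 * N * j := mul_le_mul_of_nonneg_left (by omega) (by omega)
    omega
  have hj2 : -2 < j := by
    by_contra h
    have : 2 * (N : ℤ) * j ≤ 2 * N * (-2) := mul_le_mul_of_nonneg_left (by omega) (by omega)
    omega
  have : j = -1 ∨ j = 0 ∨ j = 1 := by omega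
  rcases this with rfl | rfl | rfl <;> omega

/-- The absolute value of the representative in `[-N, N)`. -/
def ab {N : ℕ} (k : ZMod (2 * N)) : ℝ := |(rep k : ℝ)|

lemma ab_nonneg (k : ZMod (2 * N)) : 0 ≤ ab k := abs_nonneg _

lemma ab_eq_zero {k : ZMod (2 * N)} : ab k = 0 ↔ k = 0 := by
  simp [ab, rep_eq_zero]

lemma one_le_ab {k : ZMod (2 * N)} (hk : k ≠ 0) : 1 ≤ ab k := by
  have h : rep k ≠ 0 := fun h => hk (rep_eq_zero.1 h)
  have := Int.one_le_abs h
  unfold ab; exact_mod_cast this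

lemma ab_pos {k : ZMod (2 * N)} (hk : k ≠ 0) : 0 < ab k :=
  lt_of_lt_of_le one_pos (one_le_ab hk)

lemma ab_le (k : ZMod (2 * N)) : ab k ≤ N := by
  have h1 := neg_le_rep k
  have h2 := rep_lt k
  have : |rep k| ≤ N := abs_le.2 ⟨by omega, by omega⟩
  unfold ab; exact_mod_cast this

lemma mesh_mul_ab_le (k : ZMod (2 * N)) : mesh N * ab k ≤ π := by
  rw [← mesh_mul N]; exact mul_le_mul_of_nonneg_left (ab_le k) (mesh_pos N).le

lemma ab_intCast_le (z : ℤ) : ab (z : ZMod (2 * N)) ≤ |(z : ℝ)| := by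
  have := abs_rep_le_abs (N := N) z
  unfold ab; exact_mod_cast this

lemma ab_add_le (k l : ZMod (2 * N)) : ab (k + l) ≤ ab k + ab l := by
  have h := ab_intCast_le (N := N) (rep k + rep l)
  rw [Int.cast_add, rep_cast, rep_cast] at h
  refine h.trans ?_
  push_cast
  exact abs_add_le _ _

lemma ab_sub_le_abs (k l : ZMod (2 * N)) : ab (k - l) ≤ |(rep k : ℝ) - rep l| := by
  have h := ab_intCast_le (N := N) (rep k - rep l)
  rw [Int.cast_sub, rep_cast, rep_cast] at h
  exact_mod_cast h

end rep

/-! ### Phases -/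

/-- The real sign attached to a boolean. -/
def sg (b : Bool) : ℝ := if b then 1 else -1

@[simp] lemma sg_true : sg true = 1 := rfl
@[simp] lemma sg_false : sg false = -1 := rfl
lemma abs_sg (b : Bool) : |sg b| = 1 := by cases b <;> simp
lemma sg_not (b : Bool) : sg (!b) = -sg b := by cases b <;> simp

section phases
variable {N : ℕ} [NeZero N]

/-- The real symbol of `-i ∇_h`. -/
def qSym {N : ℕ} (k : ZMod (2 * N)) : ℝ := 2 / mesh N * Real.sin (mesh N * (rep k : ℝ) / 2)

/-- The dispersion relations `k / h² ∓ (2 / h³) sin (h k / 2)`. -/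
def th {N : ℕ} (τ : Bool) (k : ZMod (2 * N)) : ℝ :=
  (rep k : ℝ) / mesh N ^ 2 - sg τ * (2 / mesh N ^ 3 * Real.sin (mesh N * (rep k : ℝ) / 2))

/-- The phase of the quadratic interaction of two waves in directions `τ₁`, `τ₂`. -/
def psi {N : ℕ} (σ τ₁ τ₂ : Bool) (k k₁ : ZMod (2 * N)) : ℝ :=
  sg σ * (th τ₁ k₁ + th τ₂ (k - k₁) - th true k)

lemma abs_qSym_le (k : ZMod (2 * N)) : |qSym k| ≤ ab k := by
  have hh := mesh_pos N
  unfold qSym ab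
  rw [abs_mul, abs_of_pos (by positivity : 0 < 2 / mesh N)]
  have h1 : |Real.sin (mesh N * (rep k : ℝ) / 2)| ≤ |mesh N * (rep k : ℝ) / 2| :=
    Real.abs_sin_le_abs
  rw [abs_div, abs_mul, abs_of_pos hh, abs_two] at h1
  calc 2 / mesh N * |Real.sin (mesh N * (rep k : ℝ) / 2)|
      ≤ 2 / mesh N * (mesh N * |(rep k : ℝ)| / 2) := by gcongr
    _ = |(rep k : ℝ)| := by field_simp

lemma qSym_zero : qSym (0 : ZMod (2 * N)) = 0 := by simp [qSym, rep_zero]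

/-- Jordan's inequality at x / 4. The range 2π is what h times a sum or difference of two
frequencies can reach. -/
lemma abs_div_le_abs_sin_quarter {x : ℝ} (hx : |x| ≤ 2 * π) :
    |x| / (2 * π) ≤ |Real.sin (x / 4)| := by
  have h4 : |(4 : ℝ)| = 4 := abs_of_pos (by norm_num)
  have h := Real.mul_abs_le_abs_sin (x := x / 4) (by rw [abs_div, h4]; linarith)
  rw [abs_div, h4] at h
  calc |x| / (2 * π) = 2 / π * (|x| / 4) := by field_simp; norm_num
    _ ≤ _ := h

/-- The cosine lies above its chord on [0, π/2]. -/
lemma sub_div_le_abs_cos_quarter {x : ℝ} (hx : |x| ≤ 2 * π) :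
    (2 * π - |x|) / (2 * π) ≤ |Real.cos (x / 4)| := by
  have h4 : |(4 : ℝ)| = 4 := abs_of_pos (by norm_num)
  have h := Real.one_sub_mul_le_cos (x := |x / 4|) (abs_nonneg _)
    (by rw [abs_div, h4]; linarith)
  rw [Real.cos_abs, abs_div, h4] at h
  refine le_trans (le_of_eq ?_) (h.trans (le_abs_self _))
  field_simp; ring

/-- Three factors h|k|/(2π) together with the prefactor 4 · 2/h³ give exactly π⁻³; hence the
constant 32 in the phase estimates. -/
lemma pi_pow_three_lt : π ^ 3 < 32 := by
  have h1 := Real.pi_lt_d2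
  have h2 := Real.pi_pos
  calc π ^ 3 ≤ 3.15 ^ 3 := by gcongr
    _ < 32 := by norm_num

/-- One sine for each of the three frequencies: the discrete form of the KdV resonance function. -/
lemma sin_add_sub_sin_sub_sin (u v : ℝ) :
    Real.sin (2 * u) + Real.sin (2 * v) - Real.sin (2 * u + 2 * v) =
      4 * Real.sin u * Real.sin v * Real.sin (u + v) := by
  rw [Real.sin_add (2 * u), Real.sin_add u, Real.sin_two_mul, Real.sin_two_mul,
    Real.cos_two_mul', Real.cos_two_mul']
  linear_combination (2 * Real.sin u * Real.cos u) * (Real.sin_sq_add_cos_sq v).symm +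
    (2 * Real.sin v * Real.cos v) * (Real.sin_sq_add_cos_sq u).symm

/-- Only the frequency v of the opposite wave appears in a sine; the cosines stay away from zero at
quarter angles. -/
lemma sin_sub_sin_sub_sin_add (u v : ℝ) :
    Real.sin (2 * u) - Real.sin (2 * v) - Real.sin (2 * u + 2 * v) =
      -4 * Real.sin v * (Real.cos (u + v) * Real.cos u) := by
  rw [Real.sin_add (2 * u), Real.cos_add u, Real.sin_two_mul, Real.sin_two_mul,
    Real.cos_two_mul', Real.cos_two_mul']
  linear_combination (2 * Real.sin u * Real.cos u) * (Real.sin_sq_add_cos_sq v).symm +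
    (2 * Real.sin v * Real.cos v) * (Real.sin_sq_add_cos_sq u)

/-- For two opposite waves the sine contains only the output frequency. -/
lemma sin_add_sin_add_sin_add (u v : ℝ) :
    Real.sin (2 * u) + Real.sin (2 * v) + Real.sin (2 * u + 2 * v) =
      4 * Real.sin (u + v) * (Real.cos u * Real.cos v) := by
  rw [Real.sin_add (2 * u), Real.sin_add u, Real.sin_two_mul, Real.sin_two_mul,
    Real.cos_two_mul', Real.cos_two_mul']
  linear_combination (2 * Real.sin u * Real.cos u) * (Real.sin_sq_add_cos_sq v).symm +
    (2 * Real.sin v * Real.cos v) * (Real.sin_sq_add_cos_sq u).symm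

lemma half_le_cos_mul_cos {x y : ℝ} (hx : |x| ≤ π / 4) (hy : |y| ≤ π / 4) :
    1 / 2 ≤ Real.cos x * Real.cos y := by
  have key : ∀ z : ℝ, |z| ≤ π / 4 → √2 / 2 ≤ Real.cos z := fun z hz => by
    rw [← Real.cos_pi_div_four, ← Real.cos_abs z]
    exact Real.cos_le_cos_of_nonneg_of_le_pi (abs_nonneg _) (by linarith [Real.pi_pos]) hz
  have h2 : (0 : ℝ) ≤ √2 / 2 := by positivity
  calc (1 : ℝ) / 2 = √2 / 2 * (√2 / 2) := by
        have := Real.mul_self_sqrt (show (0 : ℝ) ≤ 2 by norm_num)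
        linarith
    _ ≤ _ := mul_le_mul (key x hx) (key y hy) h2 (h2.trans (key x hx))

lemma psi_eq (σ τ₁ τ₂ : Bool) (k k₁ : ZMod (2 * N)) :
    psi σ τ₁ τ₂ k k₁ = sg σ * (((rep k₁ + rep (k - k₁) - rep k : ℤ) : ℝ) / mesh N ^ 2 -
      2 / mesh N ^ 3 * (sg τ₁ * Real.sin (mesh N * rep k₁ / 2) +
        sg τ₂ * Real.sin (mesh N * rep (k - k₁) / 2) - Real.sin (mesh N * rep k / 2))) := by
  simp only [psi, th, sg_true]; push_cast; ring

lemma abs_psi (σ τ₁ τ₂ : Bool) (k k₁ : ZMod (2 * N)) :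
    |psi σ τ₁ τ₂ k k₁| = |((rep k₁ + rep (k - k₁) - rep k : ℤ) : ℝ) / mesh N ^ 2 -
      2 / mesh N ^ 3 * (sg τ₁ * Real.sin (mesh N * rep k₁ / 2) +
        sg τ₂ * Real.sin (mesh N * rep (k - k₁) / 2) - Real.sin (mesh N * rep k / 2))| := by
  rw [psi_eq, abs_mul, abs_sg, one_mul]

/-- Aliased interactions are never resonant. -/
lemma le_abs_psi_of_alias (σ τ₁ τ₂ : Bool) (k k₁ : ZMod (2 * N))
    (h : rep k₁ + rep (k - k₁) = rep k + 2 * N ∨ rep k₁ + rep (k - k₁) = rep k - 2 * N) :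
    0.28 / mesh N ^ 3 ≤ |psi σ τ₁ τ₂ k k₁| := by
  have hh := mesh_pos N
  have hm := mesh_mul N
  -- The wrap ±2N contributes ±2π/h³ to the phase and the three sines at most 6/h³; the constant is
  -- 2 · 3.14 - 6 = 0.28.
  have hs : |sg τ₁ * Real.sin (mesh N * rep k₁ / 2) +
        sg τ₂ * Real.sin (mesh N * rep (k - k₁) / 2) - Real.sin (mesh N * rep k / 2)| ≤ 3 := by
    have key : ∀ (τ : Bool) (x : ℝ), |sg τ * Real.sin x| ≤ 1 := fun τ x => by
      rw [abs_mul, abs_sg, one_mul]; exact Real.abs_sin_le_one x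
    have h1 := abs_le.1 (key τ₁ (mesh N * rep k₁ / 2))
    have h2 := abs_le.1 (key τ₂ (mesh N * rep (k - k₁) / 2))
    have h3 := abs_le.1 (Real.abs_sin_le_one (mesh N * rep k / 2))
    rw [abs_le]; constructor <;> linarith
  rw [abs_psi]
  generalize hS : sg τ₁ * Real.sin (mesh N * rep k₁ / 2) +
        sg τ₂ * Real.sin (mesh N * rep (k - k₁) / 2) - Real.sin (mesh N * rep k / 2) = S at hs
  have hS' := abs_le.1 hs
  have hpi : 3.14 < π := Real.pi_gt_d2
  have e : ∀ x : ℝ, x / mesh N ^ 2 - 2 / mesh N ^ 3 * S = (x * mesh N - 2 * S) / mesh N ^ 3 := by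
    intro x; field_simp
  rw [e, abs_div, abs_of_pos (by positivity : 0 < mesh N ^ 3)]
  gcongr
  rcases h with h | h
  · have : rep k₁ + rep (k - k₁) - rep k = 2 * N := by omega
    rw [this]; push_cast
    refine le_trans ?_ (le_abs_self _); linarith
  · have : rep k₁ + rep (k - k₁) - rep k = -(2 * N) := by omega
    rw [this]; push_cast
    refine le_trans ?_ (neg_le_abs _); linarith

/-- Every frequency is at most π/h, so a phase of size h⁻³ satisfies all the lower bounds of the
regular case. -/
lemma ab_le_of_alias {x : ℝ} (k : ZMod (2 * N)) (h : 0.28 / mesh N ^ 3 ≤ |x|) :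
    ab k ≤ 120 * (mesh N ^ 2 * |x|) := by
  have hh := mesh_pos N
  have h1 := mesh_mul_ab_le k
  have h2 : 0.28 / mesh N ≤ mesh N ^ 2 * |x| := by
    calc 0.28 / mesh N = mesh N ^ 2 * (0.28 / mesh N ^ 3) := by field_simp
      _ ≤ _ := by gcongr
  have h3 : ab k ≤ π / mesh N := by rw [le_div_iff₀ hh]; linarith
  have h4 : π / mesh N ≤ 120 * (0.28 / mesh N) := by
    rw [← mul_div_assoc]; gcongr; linarith [Real.pi_lt_d2]
  linarith

/-- This fixes the constant 120, which has to exceed 3.15³ / 0.28. -/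
lemma ab_mul_le_of_alias {x : ℝ} (k l m : ZMod (2 * N)) (h : 0.28 / mesh N ^ 3 ≤ |x|) :
    ab k * ab l * ab m ≤ 120 * |x| := by
  have hh := mesh_pos N
  have h3 : ∀ k : ZMod (2 * N), ab k ≤ 3.15 / mesh N := fun k => by
    have h1 := mesh_mul_ab_le k
    rw [le_div_iff₀ hh]; linarith [Real.pi_lt_d2]
  have h5 : ab k * ab l * ab m ≤ 3.15 / mesh N * (3.15 / mesh N) * (3.15 / mesh N) := by
    have := h3 k; have := h3 l; have := h3 m
    have := ab_nonneg k; have := ab_nonneg l; have := ab_nonneg m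
    gcongr
  have h6 : 3.15 / mesh N * (3.15 / mesh N) * (3.15 / mesh N) ≤ 120 * (0.28 / mesh N ^ 3) := by
    rw [div_mul_div_comm, div_mul_div_comm, ← mul_div_assoc,
      show mesh N * mesh N * mesh N = mesh N ^ 3 by ring]
    exact div_le_div_of_nonneg_right (by norm_num) (by positivity)
  linarith

lemma abs_mesh_mul_rep (k : ZMod (2 * N)) : |mesh N * (rep k : ℝ)| = mesh N * ab k := by
  rw [abs_mul, abs_of_pos (mesh_pos N), ab]

lemma abs_psi_of_add_eq (σ τ₁ τ₂ : Bool) {k k₁ : ZMod (2 * N)}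
    (h : rep k₁ + rep (k - k₁) = rep k) :
    |psi σ τ₁ τ₂ k k₁| = 2 / mesh N ^ 3 * |sg τ₁ * Real.sin (mesh N * rep k₁ / 2) +
        sg τ₂ * Real.sin (mesh N * rep (k - k₁) / 2) -
        Real.sin (mesh N * rep k₁ / 2 + mesh N * rep (k - k₁) / 2)| := by
  have hh := mesh_pos N
  rw [abs_psi, h, sub_self, ← add_div, ← mul_add]
  have h' : (rep k₁ : ℝ) + rep (k - k₁) = rep k := by exact_mod_cast h
  rw [h', Int.cast_zero, zero_div, zero_sub, abs_neg, abs_mul,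
    abs_of_pos (by positivity : 0 < 2 / mesh N ^ 3)]

lemma ab_div_le_abs_sin (k : ZMod (2 * N)) :
    mesh N * ab k / (2 * π) ≤ |Real.sin (mesh N * rep k / 4)| := by
  rw [← abs_mesh_mul_rep]
  refine abs_div_le_abs_sin_quarter ?_
  rw [abs_mesh_mul_rep]
  linarith [mesh_mul_ab_le k, Real.pi_pos]

lemma abs_quarter_le (k : ZMod (2 * N)) : |mesh N * (rep k : ℝ) / 4| ≤ π / 4 := by
  rw [abs_div, abs_mesh_mul_rep, abs_of_pos (by norm_num : (0 : ℝ) < 4)]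
  linarith [mesh_mul_ab_le k]

/-- Without wrapping, the linear terms cancel and `sin_add_sub_sin_sub_sin` gives three sines, each
bounded below by Jordan's inequality. -/
lemma ab_mul_le_psi_same (σ : Bool) (k k₁ : ZMod (2 * N)) :
    ab k * ab k₁ * ab (k - k₁) ≤ 120 * |psi σ true true k k₁| := by
  have hh := mesh_pos N
  have hr := rep_add_rep k₁ (k - k₁)
  rw [add_sub_cancel] at hr
  rcases hr with hr | hr
  · have hx := ab_div_le_abs_sin k₁
    have hy := ab_div_le_abs_sin (k - k₁)
    have hz := ab_div_le_abs_sin k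
    have e : (rep k₁ : ℝ) + rep (k - k₁) = rep k := by exact_mod_cast hr
    rw [abs_psi_of_add_eq _ _ _ hr, sg_true, one_mul, one_mul]
    have h1 : mesh N * (rep k₁ : ℝ) / 2 = 2 * (mesh N * (rep k₁ : ℝ) / 4) := by ring
    have h2 : mesh N * (rep (k - k₁) : ℝ) / 2 = 2 * (mesh N * (rep (k - k₁) : ℝ) / 4) := by ring
    rw [h1, h2, sin_add_sub_sin_sub_sin, ← add_div, ← mul_add, e, abs_mul, abs_mul, abs_mul,
      abs_of_pos (by norm_num : (0 : ℝ) < 4)]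
    have h0 := ab_nonneg k; have h0' := ab_nonneg k₁; have h0'' := ab_nonneg (k - k₁)
    have hpi := Real.pi_pos
    calc ab k * ab k₁ * ab (k - k₁) ≤ 120 / π ^ 3 * (ab k * ab k₁ * ab (k - k₁)) := by
          refine le_mul_of_one_le_left (by positivity) ?_
          rw [one_le_div (by positivity)]; linarith [pi_pow_three_lt]
      _ = 120 * (2 / mesh N ^ 3 * (4 * (mesh N * ab k₁ / (2 * π)) *
            (mesh N * ab (k - k₁) / (2 * π)) * (mesh N * ab k / (2 * π)))) := by
          field_simp; norm_num
      _ ≤ _ := by gcongr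
  · exact ab_mul_le_of_alias k k₁ (k - k₁) (le_abs_psi_of_alias σ true true k k₁ hr)

/-- Opposite waves separate at speed of order h⁻². In `sin_sub_sin_sub_sin_add` the two cosines, of
k and k₁, have product at least 1/2, and a single sine is left against h⁻³. -/
lemma ab_le_psi_mixed (σ : Bool) (k k₁ : ZMod (2 * N)) :
    ab (k - k₁) ≤ 120 * (mesh N ^ 2 * |psi σ true false k k₁|) := by
  have hh := mesh_pos N
  have hr := rep_add_rep k₁ (k - k₁)
  rw [add_sub_cancel] at hr
  rcases hr with hr | hr
  · have hy := ab_div_le_abs_sin (k - k₁)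
    have hc := half_le_cos_mul_cos (abs_quarter_le k) (abs_quarter_le k₁)
    have e : (rep k₁ : ℝ) + rep (k - k₁) = rep k := by exact_mod_cast hr
    rw [abs_psi_of_add_eq _ _ _ hr, sg_true, sg_false, one_mul, neg_one_mul, ← sub_eq_add_neg]
    have h1 : mesh N * (rep k₁ : ℝ) / 2 = 2 * (mesh N * (rep k₁ : ℝ) / 4) := by ring
    have h2 : mesh N * (rep (k - k₁) : ℝ) / 2 = 2 * (mesh N * (rep (k - k₁) : ℝ) / 4) := by ring
    rw [h1, h2, sin_sub_sin_sub_sin_add, ← add_div, ← mul_add, e, abs_mul, abs_mul, abs_neg,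
      abs_of_pos (by norm_num : (0 : ℝ) < 4)]
    have hc' := hc.trans (le_abs_self _)
    have h0'' := ab_nonneg (k - k₁)
    have hpi := Real.pi_pos
    calc ab (k - k₁) ≤ 240 / π * ab (k - k₁) := by
          refine le_mul_of_one_le_left (by positivity) ?_
          rw [one_le_div (by positivity)]; linarith [Real.pi_lt_d2]
      _ = 120 * (mesh N ^ 2 * (2 / mesh N ^ 3 * (4 * 
            (mesh N * ab (k - k₁) / (2 * π)) * (1 / 2)))) := by
          field_simp; ring
      _ ≤ _ := by gcongr
  · exact ab_le_of_alias _ (le_abs_psi_of_alias σ true false k k₁ hr)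

/-- The same mechanism through `sin_add_sin_add_sin_add`: the sine carries k, the cosines k₁ and k -
k₁. -/
lemma ab_le_psi_opposite (σ : Bool) (k k₁ : ZMod (2 * N)) :
    ab k ≤ 120 * (mesh N ^ 2 * |psi σ false false k k₁|) := by
  have hh := mesh_pos N
  have hr := rep_add_rep k₁ (k - k₁)
  rw [add_sub_cancel] at hr
  rcases hr with hr | hr
  · have hy := ab_div_le_abs_sin k
    have hc := half_le_cos_mul_cos (abs_quarter_le k₁) (abs_quarter_le (k - k₁))
    have e : (rep k₁ : ℝ) + rep (k - k₁) = rep k := by exact_mod_cast hr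
    rw [abs_psi_of_add_eq _ _ _ hr, sg_false]
    have h1 : mesh N * (rep k₁ : ℝ) / 2 = 2 * (mesh N * (rep k₁ : ℝ) / 4) := by ring
    have h2 : mesh N * (rep (k - k₁) : ℝ) / 2 = 2 * (mesh N * (rep (k - k₁) : ℝ) / 4) := by ring
    have h3 : ∀ x y z : ℝ, |-1 * x + -1 * y - z| = |x + y + z| := fun x y z => by
      rw [← abs_neg]; ring_nf
    rw [h3, h1, h2, sin_add_sin_add_sin_add, ← add_div, ← mul_add, e, abs_mul, abs_mul,
      abs_of_pos (by norm_num : (0 : ℝ) < 4)]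
    have hc' := hc.trans (le_abs_self _)
    have h0'' := ab_nonneg k
    have hpi := Real.pi_pos
    calc ab k ≤ 240 / π * ab k := by
          refine le_mul_of_one_le_left (by positivity) ?_
          rw [one_le_div (by positivity)]; linarith [Real.pi_lt_d2]
      _ = 120 * (mesh N ^ 2 * (2 / mesh N ^ 3 * (4 *
            (mesh N * ab k / (2 * π)) * (1 / 2)))) := by
          field_simp; ring
      _ ≤ _ := by gcongr
  · exact ab_le_of_alias _ (le_abs_psi_of_alias σ false false k k₁ hr)

/-! ### Separation of phases with equal total frequency -/

/-- The weight `1 / k²`, vanishing at `k = 0`. -/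
def wt {N : ℕ} (k : ZMod (2 * N)) : ℝ := (ab k ^ 2)⁻¹

lemma wt_nonneg (k : ZMod (2 * N)) : 0 ≤ wt k := by unfold wt; positivity

lemma inv_sq_le_wt {k l : ZMod (2 * N)} (h : k ≠ l) :
    (|(rep k : ℝ) - rep l| ^ 2)⁻¹ ≤ wt (k - l) := by
  have h1 := ab_pos (sub_ne_zero.2 h)
  unfold wt
  gcongr
  exact ab_sub_le_abs k l

/-- Equal integer sums, not merely equal residues, make the linear terms cancel. For this reason
interactions are later grouped by their integer sum. -/
lemma abs_psi_sub_psi (σ τ₁ τ₂ : Bool) {k k₁ l₁ : ZMod (2 * N)}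
    (h : rep k₁ + rep (k - k₁) = rep l₁ + rep (k - l₁)) :
    |psi σ τ₁ τ₂ k k₁ - psi σ τ₁ τ₂ k l₁| = 2 / mesh N ^ 3 *
      |sg τ₁ * (Real.sin (2 * (mesh N * rep k₁ / 4)) - Real.sin (2 * (mesh N * rep l₁ / 4))) +
        sg τ₂ * (Real.sin (2 * (mesh N * rep (k - k₁) / 4)) -
          Real.sin (2 * (mesh N * rep (k - l₁) / 4)))| := by
  have hh := mesh_pos N
  have h1 : ∀ k : ZMod (2 * N), mesh N * (rep k : ℝ) / 2 = 2 * (mesh N * (rep k : ℝ) / 4) :=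
    fun k => by ring
  rw [psi_eq, psi_eq, h, ← abs_of_pos (by positivity : 0 < 2 / mesh N ^ 3), ← abs_mul,
    ← mul_sub, abs_mul, abs_sg, one_mul, ← abs_neg]
  simp only [h1, abs_of_pos (by positivity : 0 < 2 / mesh N ^ 3)]
  congr 1; ring

/-- The zeros u = u', u = v' and u + v = 0 are the three alternatives in `near`. -/
lemma sin_sum_same {u v u' v' : ℝ} (h : u + v = u' + v') :
    (Real.sin (2 * u) - Real.sin (2 * u')) + (Real.sin (2 * v) - Real.sin (2 * v')) =
      -4 * Real.sin (u + v) * Real.sin (u - v') * Real.sin (u - u') := by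
  have key : ∀ a b : ℝ, Real.sin (a + b) + Real.sin (a - b) =
      2 * Real.sin a * Real.cos b := fun a b => by rw [Real.sin_add, Real.sin_sub]; ring
  have e1 : Real.sin (2 * u) + Real.sin (2 * v) =
      2 * Real.sin (u + v) * Real.cos (u - v) := by
    rw [← key]; congr 2 <;> ring
  have e2 : Real.sin (2 * u') + Real.sin (2 * v') =
      2 * Real.sin (u + v) * Real.cos (u' - v') := by
    rw [← key, h]; congr 2 <;> ring
  have e3 : Real.cos (u - v) - Real.cos (u' - v') =
      -2 * Real.sin (u - v') * Real.sin (u - u') := by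
    rw [Real.cos_sub_cos]
    have h1 : (u - v + (u' - v')) / 2 = u - v' := by linarith
    have h2 : (u - v - (u' - v')) / 2 = u - u' := by linarith
    rw [h1, h2]
  linear_combination e1 - e2 + 2 * Real.sin (u + v) * e3

lemma sin_sum_mixed {u v u' v' : ℝ} (h : u + v = u' + v') :
    (Real.sin (2 * u) - Real.sin (2 * u')) - (Real.sin (2 * v) - Real.sin (2 * v')) =
      4 * Real.cos (u + v) * Real.cos (u - v') * Real.sin (u - u') := by
  have key : ∀ a b : ℝ, Real.sin (a + b) - Real.sin (a - b) =
      2 * Real.cos a * Real.sin b := fun a b => by rw [Real.sin_add, Real.sin_sub]; ring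
  have e1 : Real.sin (2 * u) - Real.sin (2 * v) =
      2 * Real.cos (u + v) * Real.sin (u - v) := by
    rw [← key]; congr 2 <;> ring
  have e2 : Real.sin (2 * u') - Real.sin (2 * v') =
      2 * Real.cos (u + v) * Real.sin (u' - v') := by
    rw [← key, h]; congr 2 <;> ring
  have e3 : Real.sin (u - v) - Real.sin (u' - v') =
      2 * Real.sin (u - u') * Real.cos (u - v') := by
    rw [Real.sin_sub_sin]
    have h1 : (u - v + (u' - v')) / 2 = u - v' := by linarith
    have h2 : (u - v - (u' - v')) / 2 = u - u' := by linarith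
    rw [h1, h2]
  linear_combination e1 - e2 + 2 * Real.cos (u + v) * e3

lemma le_abs_psi_sub_psi_same (σ τ : Bool) {k k₁ l₁ : ZMod (2 * N)}
    (h : rep k₁ + rep (k - k₁) = rep l₁ + rep (k - l₁)) :
    |(rep k₁ : ℝ) + rep (k - k₁)| * |(rep k₁ : ℝ) - rep (k - l₁)| * |(rep k₁ : ℝ) - rep l₁| ≤
      32 * |psi σ τ τ k k₁ - psi σ τ τ k l₁| := by
  have hh := mesh_pos N
  have hm := mesh_mul N
  have hpi := Real.pi_pos
  have h' : (rep k₁ : ℝ) + rep (k - k₁) = rep l₁ + rep (k - l₁) := by exact_mod_cast h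
  rw [abs_psi_sub_psi σ τ τ h, ← mul_add, sin_sum_same (by linear_combination mesh N / 4 * h'),
    abs_mul, abs_sg, one_mul, abs_mul, abs_mul, abs_mul, abs_neg,
    abs_of_pos (by norm_num : (0 : ℝ) < 4)]
  have key : ∀ x : ℝ, |x| ≤ 2 * N → mesh N * |x| / (2 * π) ≤ |Real.sin (mesh N * x / 4)| := by
    intro x hx
    have e : |mesh N * x| = mesh N * |x| := by rw [abs_mul, abs_of_pos hh]
    rw [← e]
    refine abs_div_le_abs_sin_quarter ?_
    rw [e, ← hm]; nlinarith
  have b : ∀ k : ZMod (2 * N), -(N : ℝ) ≤ rep k ∧ (rep k : ℝ) ≤ N := fun k =>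
    ⟨by exact_mod_cast neg_le_rep k, by exact_mod_cast (rep_lt k).le⟩
  have a1 := key ((rep k₁ : ℝ) + rep (k - k₁)) (by
    rw [abs_le]; constructor <;> linarith [b k₁, b (k - k₁)])
  have a2 := key ((rep k₁ : ℝ) - rep (k - l₁)) (by
    rw [abs_le]; constructor <;> linarith [b k₁, b (k - l₁)])
  have a3 := key ((rep k₁ : ℝ) - rep l₁) (by
    rw [abs_le]; constructor <;> linarith [b k₁, b l₁])
  rw [← add_div, ← mul_add, ← sub_div, ← mul_sub, ← sub_div, ← mul_sub]
  generalize hx : |(rep k₁ : ℝ) + rep (k - k₁)| = x at *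
  generalize hy : |(rep k₁ : ℝ) - rep (k - l₁)| = y at *
  generalize hz : |(rep k₁ : ℝ) - rep l₁| = z at *
  have hx0 : 0 ≤ x := hx ▸ abs_nonneg _
  have hy0 : 0 ≤ y := hy ▸ abs_nonneg _
  have hz0 : 0 ≤ z := hz ▸ abs_nonneg _
  calc x * y * z ≤ 32 / π ^ 3 * (x * y * z) := by
        refine le_mul_of_one_le_left (by positivity) ?_
        rw [one_le_div (by positivity)]; linarith [pi_pow_three_lt]
    _ = 32 * (2 / mesh N ^ 3 * (4 * (mesh N * x / (2 * π)) *
            (mesh N * y / (2 * π)) * (mesh N * z / (2 * π)))) := by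
          field_simp; norm_num
    _ ≤ _ := by gcongr

/-- The two cosines in `sin_sum_mixed` may degenerate at the edge of the band. But equality of the
two integer sums forces |x| + |k₁ - l₁| ≤ 2N for both of their arguments x, so each cosine is at
least h|k₁ - l₁|/(2π), the same bound as for the sine. -/
lemma le_abs_psi_sub_psi_mixed (σ τ : Bool) {k k₁ l₁ : ZMod (2 * N)}
    (h : rep k₁ + rep (k - k₁) = rep l₁ + rep (k - l₁)) :
    |(rep k₁ : ℝ) - rep l₁| ^ 3 ≤
      32 * |psi σ τ (!τ) k k₁ - psi σ τ (!τ) k l₁| := by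
  have hh := mesh_pos N
  have hm := mesh_mul N
  have hpi := Real.pi_pos
  have h' : (rep k₁ : ℝ) + rep (k - k₁) = rep l₁ + rep (k - l₁) := by exact_mod_cast h
  have e : ∀ x y : ℝ, sg τ * x + sg (!τ) * y = sg τ * (x - y) := fun x y => by
    rw [sg_not]; ring
  rw [abs_psi_sub_psi σ τ (!τ) h, e, sin_sum_mixed (by linear_combination mesh N / 4 * h'),
    abs_mul, abs_sg, one_mul, abs_mul, abs_mul, abs_mul,
    abs_of_pos (by norm_num : (0 : ℝ) < 4)]
  have b : ∀ k : ZMod (2 * N), -(N : ℝ) ≤ rep k ∧ (rep k : ℝ) ≤ N := fun k =>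
    ⟨by exact_mod_cast neg_le_rep k, by exact_mod_cast (rep_lt k).le⟩
  set z := |(rep k₁ : ℝ) - rep l₁| with hz
  have keys : mesh N * z / (2 * π) ≤ |Real.sin (mesh N * ((rep k₁ : ℝ) - rep l₁) / 4)| := by
    have e : |mesh N * ((rep k₁ : ℝ) - rep l₁)| = mesh N * z := by rw [abs_mul, abs_of_pos hh]
    rw [← e]
    refine abs_div_le_abs_sin_quarter ?_
    rw [e, ← hm]
    have : z ≤ 2 * N := by rw [hz, abs_le]; constructor <;> linarith [b k₁, b l₁]
    nlinarith
  have key : ∀ x : ℝ, |x| + z ≤ 2 * N → mesh N * z / (2 * π) ≤ |Real.cos (mesh N * x / 4)| := by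
    intro x hx
    have e : |mesh N * x| = mesh N * |x| := by rw [abs_mul, abs_of_pos hh]
    have hz0 : 0 ≤ z := abs_nonneg _
    refine le_trans ?_ (sub_div_le_abs_cos_quarter ?_)
    · rw [e, ← hm]; gcongr; nlinarith
    · rw [e, ← hm]; nlinarith
  have b1 := b k₁; have b2 := b l₁; have b3 := b (k - k₁); have b4 := b (k - l₁)
  have a1 := key ((rep k₁ : ℝ) + rep (k - k₁)) (by
    rw [hz]
    rcases abs_cases ((rep k₁ : ℝ) + rep (k - k₁)) with ⟨h1, _⟩ | ⟨h1, _⟩ <;>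
    rcases abs_cases ((rep k₁ : ℝ) - rep l₁) with ⟨h2, _⟩ | ⟨h2, _⟩ <;> rw [h1, h2] <;> linarith)
  have a2 := key ((rep k₁ : ℝ) - rep (k - l₁)) (by
    rw [hz]
    rcases abs_cases ((rep k₁ : ℝ) - rep (k - l₁)) with ⟨h1, _⟩ | ⟨h1, _⟩ <;>
    rcases abs_cases ((rep k₁ : ℝ) - rep l₁) with ⟨h2, _⟩ | ⟨h2, _⟩ <;> rw [h1, h2] <;> linarith)
  rw [← add_div, ← mul_add, ← sub_div, ← mul_sub, ← sub_div, ← mul_sub]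
  have hz0 : 0 ≤ z := abs_nonneg _
  calc z ^ 3 ≤ 32 / π ^ 3 * z ^ 3 := by
        refine le_mul_of_one_le_left (by positivity) ?_
        rw [one_le_div (by positivity)]; linarith [pi_pow_three_lt]
    _ = 32 * (2 / mesh N ^ 3 * (4 * (mesh N * z / (2 * π)) *
            (mesh N * z / (2 * π)) * (mesh N * z / (2 * π)))) := by
          field_simp; norm_num
    _ ≤ _ := by gcongr

/-- The pairs of frequencies whose phases may coincide. -/
def near {N : ℕ} (k k₁ l₁ : ZMod (2 * N)) : Prop :=
  l₁ = k₁ ∨ l₁ = k - k₁ ∨ rep k₁ + rep (k - k₁) = 0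

/-- For pairs that are not `near`, all integer differences are at least 1. For equal directions drop
the factor |k₁ + k₂| and use 1/(yz) ≤ y⁻² + z⁻²; for different directions z⁻³ ≤ z⁻². The resulting
weights are summable. -/
lemma abs_psi_sub_psi_pos_and_inv_le (σ τ₁ τ₂ : Bool) {k k₁ l₁ : ZMod (2 * N)}
    (h : rep k₁ + rep (k - k₁) = rep l₁ + rep (k - l₁)) (hf : ¬ near k k₁ l₁) :
    0 < |psi σ τ₁ τ₂ k k₁ - psi σ τ₁ τ₂ k l₁| ∧
    |psi σ τ₁ τ₂ k k₁ - psi σ τ₁ τ₂ k l₁|⁻¹ ≤ 32 * (wt (k₁ - l₁) + wt (k₁ - (k - l₁))) := by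
  simp only [near, not_or] at hf
  obtain ⟨f1, f2, f3⟩ := hf
  have g1 : k₁ ≠ l₁ := fun h => f1 h.symm
  have g2 : k₁ ≠ k - l₁ := fun h => f2 (by rw [h]; ring)
  have pos : ∀ {a b : ZMod (2 * N)}, a ≠ b → 1 ≤ |(rep a : ℝ) - rep b| := fun {a b} hab => by
    have : rep a - rep b ≠ 0 := fun h => hab (rep_injective (by omega))
    exact_mod_cast Int.one_le_abs this
  have p1 := pos g1
  have p2 := pos g2
  have p3 : 1 ≤ |(rep k₁ : ℝ) + rep (k - k₁)| := by exact_mod_cast Int.one_le_abs f3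
  have w1 := inv_sq_le_wt g1
  have w2 := inv_sq_le_wt g2
  suffices hs : ∃ D, 0 < D ∧ D ≤ 32 * |psi σ τ₁ τ₂ k k₁ - psi σ τ₁ τ₂ k l₁| ∧
      D⁻¹ ≤ wt (k₁ - l₁) + wt (k₁ - (k - l₁)) by
    obtain ⟨D, hD, h1, h2⟩ := hs
    have h3 : 0 < |psi σ τ₁ τ₂ k k₁ - psi σ τ₁ τ₂ k l₁| := by linarith
    refine ⟨h3, ?_⟩
    calc |psi σ τ₁ τ₂ k k₁ - psi σ τ₁ τ₂ k l₁|⁻¹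
        = 32 * (32 * |psi σ τ₁ τ₂ k k₁ - psi σ τ₁ τ₂ k l₁|)⁻¹ := by field_simp
      _ ≤ 32 * D⁻¹ := by gcongr
      _ ≤ _ := by gcongr
  have hτ : τ₂ = τ₁ ∨ τ₂ = !τ₁ := by cases τ₁ <;> cases τ₂ <;> simp
  rcases hτ with rfl | rfl
  · refine ⟨_, ?_, le_abs_psi_sub_psi_same σ τ₂ h, ?_⟩
    · positivity
    · refine le_trans ?_ (add_le_add w1 w2)
      generalize |(rep k₁ : ℝ) + rep (k - k₁)| = x at *
      generalize |(rep k₁ : ℝ) - rep (k - l₁)| = y at *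
      generalize |(rep k₁ : ℝ) - rep l₁| = z at *
      have h1 : (x * y * z)⁻¹ ≤ (y * z)⁻¹ := by
        gcongr; nlinarith
      refine h1.trans ?_
      rw [mul_inv, ← inv_pow, ← inv_pow]
      nlinarith [sq_nonneg (y⁻¹ - z⁻¹), sq_nonneg (y⁻¹), sq_nonneg (z⁻¹)]
  · refine ⟨_, ?_, le_abs_psi_sub_psi_mixed σ τ₁ h, ?_⟩
    · positivity
    · have : (|(rep k₁ : ℝ) - rep l₁| ^ 3)⁻¹ ≤ (|(rep k₁ : ℝ) - rep l₁| ^ 2)⁻¹ := by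
        gcongr <;> norm_num
      linarith [wt_nonneg (k₁ - (k - l₁))]

end phases

/-! ### Sums over frequencies -/

section sums
variable {N : ℕ} [NeZero N]

lemma rep_mem_freq (k : ZMod (2 * N)) : rep k ∈ freq N :=
  Finset.mem_Ico.2 ⟨neg_le_rep k, rep_lt k⟩

lemma sum_freq {M : Type*} [AddCommMonoid M] (f : ℤ → M) :
    ∑ z ∈ freq N, f z = ∑ k : ZMod (2 * N), f (rep k) := by
  symm
  refine Finset.sum_bij (fun k _ => rep k) (fun k _ => rep_mem_freq k)
    (fun a _ b _ h => rep_injective h) (fun z hz => ?_) (fun _ _ => rfl)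
  obtain ⟨h1, h2⟩ := Finset.mem_Ico.1 hz
  exact ⟨(z : ZMod (2 * N)), Finset.mem_univ _, rep_eq h1 h2⟩

lemma sum_freq_natAbs (f : ℕ → ℝ) (n : ℕ) :
    ∑ z ∈ freq n, f z.natAbs =
      ∑ j ∈ Finset.range n, f j + ∑ j ∈ Finset.range n, f (j + 1) := by
  induction n with
  | zero => simp [freq]
  | succ n ih =>
    have e : freq (n + 1) = insert (-((n : ℤ) + 1)) (insert (n : ℤ) (freq n)) := by
      ext z; simp only [freq, Finset.mem_Ico, Finset.mem_insert]; push_cast; omega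
    rw [e, Finset.sum_insert, Finset.sum_insert, Finset.sum_range_succ, Finset.sum_range_succ, ih]
    · have h1 : (-((n : ℤ) + 1)).natAbs = n + 1 := by omega
      have h2 : (n : ℤ).natAbs = n := by omega
      rw [h1, h2]; ring
    · simp [freq]
    · simp only [freq, Finset.mem_Ico, Finset.mem_insert]; omega

lemma sum_range_inv_sq_le (M n : ℕ) :
    ∑ j ∈ Finset.range n, (if M < j then ((j : ℝ) ^ 2)⁻¹ else 0) ≤ 2 / ((M : ℝ) + 1) := by
  -- The induction carries the unspent remainder 2/n, which telescopes because 1/n² + 2/(n + 1) ≤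
  -- 2/n.
  suffices h : ∑ j ∈ Finset.range n, (if M < j then ((j : ℝ) ^ 2)⁻¹ else 0) +
      (if M < n then 2 / (n : ℝ) else 2 / ((M : ℝ) + 1)) ≤ 2 / ((M : ℝ) + 1) by
    have : (0 : ℝ) ≤ if M < n then 2 / (n : ℝ) else 2 / ((M : ℝ) + 1) := by
      split_ifs <;> positivity
    linarith
  induction n with
  | zero => simp
  | succ n ih =>
    rw [Finset.sum_range_succ]
    rcases lt_trichotomy M n with h | h | h
    · rw [if_pos h] at ih ⊢
      rw [if_pos (by omega)]
      have hn : (0 : ℝ) < n := by exact_mod_cast (by omega : 0 < n)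
      have hn1 : (1 : ℝ) ≤ n := by exact_mod_cast (by omega : 1 ≤ n)
      have key : ((n : ℝ) ^ 2)⁻¹ + 2 / ((n : ℝ) + 1) ≤ 2 / n := by
        rw [inv_eq_one_div, div_add_div _ _ (by positivity) (by positivity),
          div_le_div_iff₀ (by positivity) hn]
        nlinarith [mul_pos hn hn]
      push_cast
      linarith
    · subst h
      rw [if_neg (lt_irrefl _)] at ih ⊢
      rw [if_pos (Nat.lt_succ_self _)]
      push_cast; linarith
    · rw [if_neg (by omega)] at ih ⊢
      rw [if_neg (by omega)]
      linarith

lemma sum_wt_tail_le (M : ℕ) :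
    ∑ k : ZMod (2 * N), (if (M : ℝ) < ab k then wt k else 0) ≤ 4 / ((M : ℝ) + 1) := by
  have h := sum_freq_natAbs (fun j => if M < j then ((j : ℝ) ^ 2)⁻¹ else 0) N
  rw [sum_freq] at h
  have e : ∀ k : ZMod (2 * N), (((rep k).natAbs : ℕ) : ℝ) = ab k := fun k => by
    rw [ab, Nat.cast_natAbs, Int.cast_abs]
  have e2 : ∑ k : ZMod (2 * N), (if (M : ℝ) < ab k then wt k else 0) =
      ∑ k : ZMod (2 * N), (if M < (rep k).natAbs then (((rep k).natAbs : ℝ) ^ 2)⁻¹ else 0) := by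
    refine Finset.sum_congr rfl fun k _ => ?_
    simp only [wt, ← e, Nat.cast_lt]
  rw [e2, h]
  have h1 := sum_range_inv_sq_le M N
  have h2 := sum_range_inv_sq_le M (N + 1)
  rw [Finset.sum_range_succ'] at h2
  have h3 : (4 : ℝ) / ((M : ℝ) + 1) = 2 / ((M : ℝ) + 1) + 2 / ((M : ℝ) + 1) := by ring
  rw [h3]
  have h4 : (0 : ℝ) ≤ if M < 0 then (((0 : ℕ) : ℝ) ^ 2)⁻¹ else 0 := by simp
  exact add_le_add h1 (by linarith)

lemma wt_zero : wt (0 : ZMod (2 * N)) = 0 := by simp [wt, ab_eq_zero.2 rfl]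

lemma sum_wt_le : ∑ k : ZMod (2 * N), wt k ≤ 4 := by
  have h := sum_wt_tail_le (N := N) 0
  norm_num at h
  refine le_trans (le_of_eq ?_) h
  refine Finset.sum_congr rfl fun k _ => ?_
  by_cases hk : k = 0
  · subst hk; simp [wt_zero]
  · rw [if_pos (ab_pos hk)]

/-! ### Norms and convolutions -/

/-- The Hilbert space of Fourier coefficients. -/
abbrev Coef (N : ℕ) : Type := EuclideanSpace ℂ (ZMod (2 * N))

/-- The norm of `ℓ¹`. -/
def l1 (x : Coef N) : ℝ := ∑ k, ‖x k‖

lemma l1_nonneg (x : Coef N) : 0 ≤ l1 x := Finset.sum_nonneg fun _ _ => norm_nonneg _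

lemma norm_sq_eq_sum (x : Coef N) : ‖x‖ ^ 2 = ∑ k, ‖x k‖ ^ 2 := EuclideanSpace.norm_sq_eq x

lemma norm_le_l1 (x : Coef N) : ‖x‖ ≤ l1 x := by
  refine abs_le_of_sq_le_sq' ?_ (l1_nonneg x) |>.2
  rw [norm_sq_eq_sum, l1]
  exact Finset.sum_sq_le_sq_sum_of_nonneg fun _ _ => norm_nonneg _

lemma l1_add_le (x y : Coef N) : l1 (x + y) ≤ l1 x + l1 y := by
  unfold l1
  rw [← Finset.sum_add_distrib]
  exact Finset.sum_le_sum fun k _ => norm_add_le _ _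

lemma l1_smul (c : ℂ) (x : Coef N) : l1 (c • x) = ‖c‖ * l1 x := by
  unfold l1
  rw [Finset.mul_sum]
  exact Finset.sum_congr rfl fun k _ => by simp

lemma norm_le_of_sum_sq_le {x : Coef N} {b : ℝ} (hb : 0 ≤ b) (h : ∑ k, ‖x k‖ ^ 2 ≤ b ^ 2) :
    ‖x‖ ≤ b := by
  rw [← norm_sq_eq_sum] at h
  exact (abs_le_of_sq_le_sq' h hb).2

lemma norm_le_norm_of_le {x y : Coef N} (h : ∀ k, ‖x k‖ ≤ ‖y k‖) : ‖x‖ ≤ ‖y‖ := by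
  refine norm_le_of_sum_sq_le (norm_nonneg _) ?_
  rw [norm_sq_eq_sum]
  exact Finset.sum_le_sum fun k _ => by gcongr; exact h k

lemma sum_mul_le_of_sq_le {ι : Type*} (s : Finset ι) {f g : ι → ℝ} {a b : ℝ} (ha : 0 ≤ a)
    (hb : 0 ≤ b) (hf : ∑ i ∈ s, f i ^ 2 ≤ a ^ 2) (hg : ∑ i ∈ s, g i ^ 2 ≤ b ^ 2) :
    ∑ i ∈ s, f i * g i ≤ a * b := by
  have h := Finset.sum_mul_sq_le_sq_mul_sq s f g
  refine (abs_le_of_sq_le_sq' (h.trans ?_) (mul_nonneg ha hb)).2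
  rw [mul_pow]
  have : 0 ≤ ∑ i ∈ s, g i ^ 2 := Finset.sum_nonneg fun _ _ => sq_nonneg _
  gcongr

/-- The `ℓ¹` norm of high frequencies after one integration. -/
lemma sum_tail_le (M : ℕ) (x : Coef N) :
    ∑ k, (if (M : ℝ) < ab k then ‖x k‖ * (ab k)⁻¹ else 0) ≤ 2 / √((M : ℝ) + 1) * ‖x‖ := by
  have h0 : (0 : ℝ) < (M : ℝ) + 1 := by positivity
  calc ∑ k, (if (M : ℝ) < ab k then ‖x k‖ * (ab k)⁻¹ else 0)
      = ∑ k, (if (M : ℝ) < ab k then (ab k)⁻¹ else 0) * ‖x k‖ :=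
        Finset.sum_congr rfl fun k _ => by split_ifs <;> ring
    _ ≤ _ := by
        refine sum_mul_le_of_sq_le _ (by positivity) (norm_nonneg _) ?_ (norm_sq_eq_sum x).ge
        rw [div_pow, Real.sq_sqrt h0.le]
        refine le_trans (le_of_eq ?_) ((sum_wt_tail_le (N := N) M).trans (by norm_num))
        refine Finset.sum_congr rfl fun k _ => ?_
        split_ifs
        · rw [wt, inv_pow]
        · simp

lemma sum_norm_mul_inv_le (x : Coef N) : ∑ k, ‖x k‖ * (ab k)⁻¹ ≤ 2 * ‖x‖ := by
  have h := sum_tail_le 0 x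
  norm_num at h
  refine le_trans (Finset.sum_le_sum fun k _ => ?_) h
  by_cases hk : k = 0
  · subst hk; simp [ab_eq_zero.2]
  · rw [if_pos (ab_pos hk)]

/-- Convolution of real sequences. -/
def conv (X Y : ZMod (2 * N) → ℝ) (k : ZMod (2 * N)) : ℝ := ∑ l, X l * Y (k - l)

lemma sum_sub_right {M : Type*} [AddCommMonoid M] (l : ZMod (2 * N)) (f : ZMod (2 * N) → M) :
    ∑ k, f (k - l) = ∑ k, f k := (Equiv.subRight l).sum_comp f

lemma sum_sub_left {M : Type*} [AddCommMonoid M] (l : ZMod (2 * N)) (f : ZMod (2 * N) → M) :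
    ∑ k, f (l - k) = ∑ k, f k := (Equiv.subLeft l).sum_comp f

lemma conv_comm (X Y : ZMod (2 * N) → ℝ) (k : ZMod (2 * N)) : conv X Y k = conv Y X k := by
  unfold conv
  rw [← sum_sub_left k]
  exact Finset.sum_congr rfl fun l _ => by rw [sub_sub_cancel, mul_comm]

lemma sum_conv (X Y : ZMod (2 * N) → ℝ) : ∑ k, conv X Y k = (∑ k, X k) * ∑ k, Y k := by
  unfold conv
  rw [Finset.sum_comm, Finset.sum_mul]
  refine Finset.sum_congr rfl fun l _ => ?_
  rw [← Finset.mul_sum, sum_sub_right l Y]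

/-- Young's inequality ℓ¹ * ℓ² → ℓ²: Cauchy–Schwarz with respect to the weights X, then summation
over k. -/
lemma sum_conv_sq_le {X Y : ZMod (2 * N) → ℝ} (hX : ∀ k, 0 ≤ X k) :
    ∑ k, conv X Y k ^ 2 ≤ (∑ k, X k) ^ 2 * ∑ k, Y k ^ 2 := by
  have h : ∀ k, conv X Y k ^ 2 ≤ (∑ l, X l) * ∑ l, X l * Y (k - l) ^ 2 := fun k => by
    have h := Finset.sum_mul_sq_le_sq_mul_sq Finset.univ (fun l => √(X l))
      (fun l => √(X l) * Y (k - l))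
    simp only [mul_pow, Real.sq_sqrt (hX _), ← mul_assoc, Real.mul_self_sqrt (hX _)] at h
    exact h
  refine (Finset.sum_le_sum fun k _ => h k).trans (le_of_eq ?_)
  rw [← Finset.mul_sum]
  have := sum_conv X (fun k => Y k ^ 2)
  unfold conv at this
  rw [this]; ring

lemma norm_le_of_le_conv {z : Coef N} {X Y : ZMod (2 * N) → ℝ} {a b : ℝ} (hX : ∀ k, 0 ≤ X k)
    (h : ∀ k, ‖z k‖ ≤ conv X Y k) (hb : 0 ≤ b) (ha : ∑ k, X k ≤ a)
    (hY : ∑ k, Y k ^ 2 ≤ b ^ 2) : ‖z‖ ≤ a * b := by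
  have hX' : 0 ≤ ∑ k, X k := Finset.sum_nonneg fun k _ => hX k
  refine norm_le_of_sum_sq_le (mul_nonneg (hX'.trans ha) hb) ?_
  refine (Finset.sum_le_sum fun k _ => pow_le_pow_left₀ (norm_nonneg _) (h k) 2).trans ?_
  refine (sum_conv_sq_le hX).trans ?_
  rw [mul_pow]
  gcongr

/-- The same as `norm_le_of_le_conv`, with the roles of the factors exchanged. -/
lemma norm_le_of_le_conv' {z : Coef N} {X Y : ZMod (2 * N) → ℝ} {a b : ℝ} (hY : ∀ k, 0 ≤ Y k)
    (h : ∀ k, ‖z k‖ ≤ conv X Y k) (ha : 0 ≤ a) (hX : ∑ k, X k ^ 2 ≤ a ^ 2)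
    (hb : ∑ k, Y k ≤ b) : ‖z‖ ≤ a * b := by
  rw [mul_comm a b]
  exact norm_le_of_le_conv hY (fun k => by rw [conv_comm]; exact h k) ha hb hX

/-! ### A quadrilinear sum -/

/-- The kernel depends only on k - l and has total mass at most 4, so Schur's test applies. -/
lemma sum_wt_mul_le (x z : Coef N) :
    ∑ k, ∑ l, wt (k - l) * (‖x k‖ * ‖z l‖) ≤ 4 * (‖x‖ * ‖z‖) := by
  rw [Finset.sum_comm]
  have e : ∀ l, ∑ k, wt (k - l) * (‖x k‖ * ‖z l‖) = ∑ n, wt n * (‖x (n + l)‖ * ‖z l‖) := by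
    intro l
    rw [← sum_sub_right l (fun n => wt n * (‖x (n + l)‖ * ‖z l‖))]
    simp
  simp only [e]
  rw [Finset.sum_comm]
  simp only [← Finset.mul_sum]
  have h : ∀ n, ∑ l, ‖x (n + l)‖ * ‖z l‖ ≤ ‖x‖ * ‖z‖ := fun n => by
    refine sum_mul_le_of_sq_le _ (norm_nonneg _) (norm_nonneg _) (le_of_eq ?_)
      (norm_sq_eq_sum z).ge
    rw [norm_sq_eq_sum]
    exact Equiv.sum_comp (Equiv.addLeft n) fun k => ‖x k‖ ^ 2
  refine (Finset.sum_le_sum fun n _ => mul_le_mul_of_nonneg_left (h n) (wt_nonneg n)).trans ?_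
  rw [← Finset.sum_mul]
  gcongr
  exact sum_wt_le

/-- The weight does not involve k: sum over k first by Cauchy–Schwarz in y and w, then apply
`sum_wt_mul_le` to x and z. -/
lemma sum_wt_quad_le (x y z w : Coef N) :
    ∑ k, ∑ k₁, ∑ l₁, wt (k₁ - l₁) * (‖x k₁‖ * ‖y (k - k₁)‖ * (‖z l₁‖ * ‖w (k - l₁)‖)) ≤
      4 * (‖x‖ * ‖y‖ * (‖z‖ * ‖w‖)) := by
  rw [Finset.sum_comm]
  have e : ∀ k₁, ∑ k, ∑ l₁, wt (k₁ - l₁) *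
      (‖x k₁‖ * ‖y (k - k₁)‖ * (‖z l₁‖ * ‖w (k - l₁)‖)) =
      ∑ l₁, wt (k₁ - l₁) * (‖x k₁‖ * ‖z l₁‖) * ∑ k, ‖y (k - k₁)‖ * ‖w (k - l₁)‖ := by
    intro k₁
    rw [Finset.sum_comm]
    refine Finset.sum_congr rfl fun l₁ _ => ?_
    rw [Finset.mul_sum]
    exact Finset.sum_congr rfl fun k _ => by ring
  simp only [e]
  have h : ∀ k₁ l₁ : ZMod (2 * N), ∑ k, ‖y (k - k₁)‖ * ‖w (k - l₁)‖ ≤ ‖y‖ * ‖w‖ :=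
    fun k₁ l₁ => by
    refine sum_mul_le_of_sq_le _ (norm_nonneg _) (norm_nonneg _) (le_of_eq ?_) (le_of_eq ?_)
    · rw [norm_sq_eq_sum]; exact sum_sub_right k₁ fun k => ‖y k‖ ^ 2
    · rw [norm_sq_eq_sum]; exact sum_sub_right l₁ fun k => ‖w k‖ ^ 2
  calc _ ≤ ∑ k₁, ∑ l₁, wt (k₁ - l₁) * (‖x k₁‖ * ‖z l₁‖) * (‖y‖ * ‖w‖) := by
        refine Finset.sum_le_sum fun k₁ _ => Finset.sum_le_sum fun l₁ _ => ?_
        exact mul_le_mul_of_nonneg_left (h k₁ l₁)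
          (mul_nonneg (wt_nonneg _) (by positivity))
    _ ≤ 4 * (‖x‖ * ‖z‖) * (‖y‖ * ‖w‖) := by
        simp only [← Finset.sum_mul]
        gcongr
        exact sum_wt_mul_le x z
    _ = _ := by ring

lemma sum_wt_quad_le' (x y z w : Coef N) :
    ∑ k, ∑ k₁, ∑ l₁, wt (k₁ - (k - l₁)) *
      (‖x k₁‖ * ‖y (k - k₁)‖ * (‖z l₁‖ * ‖w (k - l₁)‖)) ≤
      4 * (‖x‖ * ‖y‖ * (‖z‖ * ‖w‖)) := by
  have h := sum_wt_quad_le x y w z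
  refine le_trans (le_of_eq ?_) (h.trans (le_of_eq (by ring)))
  refine Finset.sum_congr rfl fun k _ => Finset.sum_congr rfl fun k₁ _ => ?_
  rw [← sum_sub_left k]
  refine Finset.sum_congr rfl fun l₁ _ => ?_
  rw [sub_sub_cancel]; ring

end sums

/-! ### Bilinear operators with time-dependent phases -/

section bil
variable {N : ℕ} [NeZero N]

/-- The bilinear operator with multiplier `m` and phase `ψ`. -/
def bil (m : ZMod (2 * N) → ZMod (2 * N) → ℂ) (ψ : ZMod (2 * N) → ZMod (2 * N) → ℝ) (t : ℝ)
    (x y : Coef N) : Coef N :=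
  WithLp.toLp 2 fun k => ∑ l, m k l * Complex.exp ((ψ k l * t : ℝ) * Complex.I) *
    (x l * y (k - l))

variable {m : ZMod (2 * N) → ZMod (2 * N) → ℂ} {ψ : ZMod (2 * N) → ZMod (2 * N) → ℝ}

lemma bil_apply (m : ZMod (2 * N) → ZMod (2 * N) → ℂ) (ψ : ZMod (2 * N) → ZMod (2 * N) → ℝ)
    (t : ℝ) (x y : Coef N) (k : ZMod (2 * N)) :
    bil m ψ t x y k = ∑ l, m k l * Complex.exp ((ψ k l * t : ℝ) * Complex.I) *
      (x l * y (k - l)) := rfl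

lemma norm_bil_apply_le_sum (t : ℝ) (x y : Coef N) (k : ZMod (2 * N)) :
    ‖bil m ψ t x y k‖ ≤ ∑ l, ‖m k l‖ * (‖x l‖ * ‖y (k - l)‖) := by
  rw [bil_apply]
  refine (norm_sum_le _ _).trans (Finset.sum_le_sum fun l _ => le_of_eq ?_)
  rw [norm_mul, norm_mul, Complex.norm_exp_ofReal_mul_I, mul_one, norm_mul]

lemma bil_add_left (t : ℝ) (x x' y : Coef N) :
    bil m ψ t (x + x') y = bil m ψ t x y + bil m ψ t x' y := by
  ext k
  simp only [bil_apply, PiLp.add_apply, ← Finset.sum_add_distrib]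
  exact Finset.sum_congr rfl fun l _ => by ring

lemma bil_add_right (t : ℝ) (x y y' : Coef N) :
    bil m ψ t x (y + y') = bil m ψ t x y + bil m ψ t x y' := by
  ext k
  simp only [bil_apply, PiLp.add_apply, ← Finset.sum_add_distrib]
  exact Finset.sum_congr rfl fun l _ => by ring

lemma bil_sub_left (t : ℝ) (x x' y : Coef N) :
    bil m ψ t (x - x') y = bil m ψ t x y - bil m ψ t x' y := by
  ext k
  simp only [bil_apply, PiLp.sub_apply, ← Finset.sum_sub_distrib]
  exact Finset.sum_congr rfl fun l _ => by ring

lemma bil_sub_right (t : ℝ) (x y y' : Coef N) :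
    bil m ψ t x (y - y') = bil m ψ t x y - bil m ψ t x y' := by
  ext k
  simp only [bil_apply, PiLp.sub_apply, ← Finset.sum_sub_distrib]
  exact Finset.sum_congr rfl fun l _ => by ring

lemma norm_bil_le_l1_left (hm : ∀ k l, ‖m k l‖ ≤ 1) (t : ℝ) (x y : Coef N) :
    ‖bil m ψ t x y‖ ≤ l1 x * ‖y‖ := by
  refine norm_le_of_le_conv (X := fun k => ‖x k‖) (Y := fun k => ‖y k‖)
    (fun _ => norm_nonneg _) (fun k => ?_) (norm_nonneg _) le_rfl (norm_sq_eq_sum y).ge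
  refine (norm_bil_apply_le_sum t x y k).trans (Finset.sum_le_sum fun l _ => ?_)
  exact mul_le_of_le_one_left (by positivity) (hm k l)

lemma norm_bil_le_l1_right (hm : ∀ k l, ‖m k l‖ ≤ 1) (t : ℝ) (x y : Coef N) :
    ‖bil m ψ t x y‖ ≤ ‖x‖ * l1 y := by
  refine norm_le_of_le_conv' (X := fun k => ‖x k‖) (Y := fun k => ‖y k‖)
    (fun _ => norm_nonneg _) (fun k => ?_) (norm_nonneg _) (norm_sq_eq_sum x).ge le_rfl
  refine (norm_bil_apply_le_sum t x y k).trans (Finset.sum_le_sum fun l _ => ?_)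
  exact mul_le_of_le_one_left (by positivity) (hm k l)

lemma hasDerivAt_coef {f : ℝ → Coef N} {f' : Coef N} {t : ℝ} :
    HasDerivAt f f' t ↔ ∀ k, HasDerivAt (fun s => f s k) (f' k) t := by
  have h : HasDerivAt f f' t ↔
      HasDerivAt (fun s => (PiLp.continuousLinearEquiv 2 ℝ (fun _ : ZMod (2 * N) => ℂ)) (f s))
        ((PiLp.continuousLinearEquiv 2 ℝ (fun _ : ZMod (2 * N) => ℂ)) f') t := by
    constructor
    · intro h
      exact ((PiLp.continuousLinearEquiv 2 ℝ (fun _ : ZMod (2 * N) => ℂ)).hasFDerivAt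
        (x := f t)).comp_hasDerivAt t h
    · intro h
      have := ((PiLp.continuousLinearEquiv 2 ℝ (fun _ : ZMod (2 * N) => ℂ)).symm.hasFDerivAt
        (x := (PiLp.continuousLinearEquiv 2 ℝ (fun _ : ZMod (2 * N) => ℂ)) (f t))).comp_hasDerivAt
          t h
      simpa [Function.comp_def] using this
  rw [h, hasDerivAt_pi]
  rfl

lemma continuous_coef {X : Type*} [TopologicalSpace X] {f : X → Coef N} :
    Continuous f ↔ ∀ k, Continuous fun s => f s k := by
  constructor
  · intro h k
    exact (continuous_apply k).comp
      ((PiLp.continuousLinearEquiv 2 ℝ (fun _ : ZMod (2 * N) => ℂ)).continuous.comp h)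
  · intro h
    have := (PiLp.continuousLinearEquiv 2 ℝ (fun _ : ZMod (2 * N) => ℂ)).symm.continuous.comp
      (continuous_pi h)
    exact this

lemma continuous_bil {f g : ℝ → Coef N} (hf : Continuous f) (hg : Continuous g) :
    Continuous fun t => bil m ψ t (f t) (g t) := by
  rw [continuous_coef] at hf hg ⊢
  intro k
  simp only [bil_apply]
  refine continuous_finsetSum _ fun l _ => ?_
  have h1 : Continuous fun t : ℝ => Complex.exp ((ψ k l * t : ℝ) * Complex.I) := by fun_prop
  exact (continuous_const.mul h1).mul ((hf l).mul (hg (k - l)))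

/-- Differentiating the phase multiplies the symbol by iψ. The normal form consists in choosing m so
that this term reproduces a given interaction. -/
lemma hasDerivAt_bil {f g : ℝ → Coef N} {f' g' : Coef N} {t : ℝ} (hf : HasDerivAt f f' t)
    (hg : HasDerivAt g g' t) :
    HasDerivAt (fun t => bil m ψ t (f t) (g t))
      (bil (fun k l => m k l * (Complex.I * ψ k l)) ψ t (f t) (g t) + bil m ψ t f' (g t) +
        bil m ψ t (f t) g') t := by
  rw [hasDerivAt_coef] at hf hg ⊢
  intro k
  simp only [bil_apply, PiLp.add_apply, ← Finset.sum_add_distrib]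
  refine HasDerivAt.fun_sum fun l _ => ?_
  have h1 : HasDerivAt (fun t : ℝ => Complex.exp ((ψ k l * t : ℝ) * Complex.I))
      (Complex.exp ((ψ k l * t : ℝ) * Complex.I) * (ψ k l * Complex.I)) t := by
    have h2 : HasDerivAt (fun t : ℝ => ((ψ k l * t : ℝ) : ℂ)) (ψ k l : ℂ) t := by
      have := ((hasDerivAt_id t).const_mul (ψ k l)).ofReal_comp
      simpa using this
    exact (h2.mul_const Complex.I).cexp
  refine ((h1.const_mul (m k l)).fun_mul ((hf l).fun_mul (hg (k - l)))).congr_deriv ?_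
  ring

end bil

/-! ### Oscillatory integrals in time -/

/-- Integrate the oscillating factor by parts: the endpoints and the variation of f each gain 1/|D|.
-/
lemma norm_integral_osc_le {f f' : ℝ → ℂ} (hf : ∀ t, HasDerivAt f (f' t) t) (hf' : Continuous f')
    {T : ℝ} (hT : 0 ≤ T) {D : ℝ} (hD : D ≠ 0) :
    ‖∫ t in (0 : ℝ)..T, f t * Complex.exp ((D * t : ℝ) * Complex.I)‖ ≤
      |D|⁻¹ * (‖f 0‖ + ‖f T‖ + ∫ t in (0 : ℝ)..T, ‖f' t‖) := by
  have hfc : Continuous f := continuous_iff_continuousAt.2 fun t => (hf t).continuousAt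
  have hDI : (D : ℂ) * Complex.I ≠ 0 := by
    simp [hD]
  set e : ℝ → ℂ := fun t => Complex.exp ((D * t : ℝ) * Complex.I) with he
  have hec : Continuous e := by rw [he]; fun_prop
  have hne : ∀ t, ‖e t‖ = 1 := fun t => Complex.norm_exp_ofReal_mul_I _
  have hed : ∀ t, HasDerivAt e (e t * (D * Complex.I)) t := fun t => by
    have h2 : HasDerivAt (fun t : ℝ => ((D * t : ℝ) : ℂ)) (D : ℂ) t := by
      have := ((hasDerivAt_id t).const_mul D).ofReal_comp
      simpa using this
    exact (h2.mul_const Complex.I).cexp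
  have key : ∫ t in (0 : ℝ)..T, (f' t * (e t / (D * Complex.I)) + f t * e t) =
      f T * (e T / (D * Complex.I)) - f 0 * (e 0 / (D * Complex.I)) := by
    refine intervalIntegral.integral_eq_sub_of_hasDerivAt
      (f := fun t => f t * (e t / (D * Complex.I))) (fun t _ => ?_) ?_
    · refine ((hf t).mul ((hed t).div_const (D * Complex.I))).congr_deriv ?_
      rw [mul_div_assoc, div_self hDI, mul_one]
    · exact Continuous.intervalIntegrable (by fun_prop) _ _
  rw [intervalIntegral.integral_add (Continuous.intervalIntegrable (by fun_prop) _ _)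
    (Continuous.intervalIntegrable (by fun_prop) _ _)] at key
  have key2 : ∫ t in (0 : ℝ)..T, f t * e t = f T * (e T / (D * Complex.I)) -
      f 0 * (e 0 / (D * Complex.I)) - ∫ t in (0 : ℝ)..T, f' t * (e t / (D * Complex.I)) := by
    rw [← key]; ring
  have hn : ∀ z t, ‖z * (e t / (D * Complex.I))‖ = |D|⁻¹ * ‖z‖ := fun z t => by
    rw [norm_mul, norm_div, hne, norm_mul, Complex.norm_I, mul_one, Complex.norm_real,
      Real.norm_eq_abs, one_div, mul_comm]
  rw [key2]
  refine (norm_sub_le _ _).trans ?_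
  have h1 := norm_sub_le (f T * (e T / (D * Complex.I))) (f 0 * (e 0 / (D * Complex.I)))
  rw [hn, hn] at h1
  have h2 := intervalIntegral.norm_integral_le_integral_norm (μ := MeasureTheory.volume)
    (f := fun t => f' t * (e t / (D * Complex.I))) hT
  simp only [hn] at h2
  rw [intervalIntegral.integral_const_mul] at h2
  rw [mul_add, mul_add]
  linarith

/-- Cauchy–Schwarz over the classes discards all correlations between different classes, for which
no separation of phases is available. -/
lemma norm_sum_sq_le_of_classes {ι : Type*} [Fintype ι] (f : ι → ℂ) (s : ι → ℤ) (J : Finset ℤ)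
    (hJ : ∀ i, s i ∈ J) :
    ‖∑ i, f i‖ ^ 2 ≤ J.card *
      ∑ i, ∑ j, if s i = s j then (f i * (starRingEnd ℂ) (f j)).re else 0 := by
  classical
  have h1 : ∑ i, f i = ∑ a ∈ J, ∑ i with s i = a, f i :=
    (Finset.sum_fiberwise_of_maps_to (fun i _ => hJ i) f).symm
  have h2 : ∀ a, ‖∑ i with s i = a, f i‖ ^ 2 =
      ∑ i, ∑ j, if s i = a ∧ s j = a then (f i * (starRingEnd ℂ) (f j)).re else 0 := by
    intro a
    have h : ((‖∑ i with s i = a, f i‖ ^ 2 : ℝ) : ℂ) =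
        (∑ i with s i = a, f i) * (starRingEnd ℂ) (∑ i with s i = a, f i) := by
      rw [Complex.mul_conj, Complex.normSq_eq_norm_sq]
    have h' := congrArg Complex.re h
    rw [Complex.ofReal_re] at h'
    rw [h', map_sum, Finset.sum_mul_sum, Complex.re_sum, Finset.sum_filter]
    refine Finset.sum_congr rfl fun i _ => ?_
    by_cases hi : s i = a
    · simp only [hi, if_true, true_and, Complex.re_sum, Finset.sum_filter]
      exact Finset.sum_congr rfl fun j _ => by split_ifs <;> rfl
    · simp [hi]
  rw [h1]
  calc ‖∑ a ∈ J, ∑ i with s i = a, f i‖ ^ 2 ≤ (∑ a ∈ J, ‖∑ i with s i = a, f i‖) ^ 2 := by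
        gcongr; exact norm_sum_le _ _
    _ ≤ J.card * ∑ a ∈ J, ‖∑ i with s i = a, f i‖ ^ 2 := sq_sum_le_card_mul_sum_sq
    _ = _ := by
        congr 1
        simp only [h2]
        rw [Finset.sum_comm]
        refine Finset.sum_congr rfl fun i _ => ?_
        rw [Finset.sum_comm]
        refine Finset.sum_congr rfl fun j _ => ?_
        by_cases hij : s i = s j
        · rw [if_pos hij, Finset.sum_eq_single (s i)]
          · simp [hij]
          · intro b _ hb; rw [if_neg]; exact fun h => hb h.1.symm
          · intro h; exact absurd (hJ i) h
        · rw [if_neg hij]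
          refine Finset.sum_eq_zero fun a _ => if_neg ?_
          rintro ⟨h, h'⟩; exact hij (h.trans h'.symm)

/-! ### The bilinear Strichartz estimate -/

section strichartz
variable {N : ℕ} [NeZero N]

/-- The weight of a pair of interactions. -/
def wtt {N : ℕ} (k k₁ l₁ : ZMod (2 * N)) : ℝ := wt (k₁ - l₁) + wt (k₁ - (k - l₁))

lemma wtt_nonneg (k k₁ l₁ : ZMod (2 * N)) : 0 ≤ wtt k k₁ l₁ :=
  add_nonneg (wt_nonneg _) (wt_nonneg _)

/-- A product of four coefficients. -/
def prod4 (x y z w : Coef N) (k k₁ l₁ : ZMod (2 * N)) : ℝ :=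
  ‖x k₁‖ * ‖y (k - k₁)‖ * (‖z l₁‖ * ‖w (k - l₁)‖)

lemma prod4_nonneg (x y z w : Coef N) (k k₁ l₁ : ZMod (2 * N)) : 0 ≤ prod4 x y z w k k₁ l₁ := by
  unfold prod4; positivity

lemma continuous_prod4 {x y z w : ℝ → Coef N} (hx : Continuous x) (hy : Continuous y)
    (hz : Continuous z) (hw : Continuous w) (k k₁ l₁ : ZMod (2 * N)) :
    Continuous fun t => prod4 (x t) (y t) (z t) (w t) k k₁ l₁ :=
  (((continuous_coef.1 hx _).norm).mul ((continuous_coef.1 hy _).norm)).mul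
    (((continuous_coef.1 hz _).norm).mul ((continuous_coef.1 hw _).norm))

lemma sum_wtt_le (x y z w : Coef N) :
    ∑ k, ∑ k₁, ∑ l₁, wtt k k₁ l₁ * prod4 x y z w k k₁ l₁ ≤
      8 * (‖x‖ * ‖y‖ * (‖z‖ * ‖w‖)) := by
  have h1 := sum_wt_quad_le x y z w
  have h2 := sum_wt_quad_le' x y z w
  simp only [wtt, prod4, add_mul, Finset.sum_add_distrib]
  linarith

/-- Expand the square within each of the three classes of integer sums. `near` pairs need no
oscillation: each of the three kinds costs (‖x‖‖y‖)² by Cauchy–Schwarz, and 9 is 3 kinds times 3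
classes. -/
lemma sum_near_le {m : ZMod (2 * N) → ZMod (2 * N) → ℂ}
    {ψ : ZMod (2 * N) → ZMod (2 * N) → ℝ} (hm : ∀ k l, ‖m k l‖ ≤ 1) (t : ℝ) (x y : Coef N) :
    ‖bil m ψ t x y‖ ^ 2 ≤ 9 * (‖x‖ * ‖y‖) ^ 2 + 3 * ∑ k, ∑ k₁, ∑ l₁,
      open Classical in
      if rep k₁ + rep (k - k₁) = rep l₁ + rep (k - l₁) ∧ ¬ near k k₁ l₁ then
        ((m k k₁ * Complex.exp ((ψ k k₁ * t : ℝ) * Complex.I) * (x k₁ * y (k - k₁))) *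
          (starRingEnd ℂ) (m k l₁ * Complex.exp ((ψ k l₁ * t : ℝ) * Complex.I) *
            (x l₁ * y (k - l₁)))).re else 0 := by
  classical
  set c : ZMod (2 * N) → ZMod (2 * N) → ℂ := fun k l =>
    m k l * Complex.exp ((ψ k l * t : ℝ) * Complex.I) * (x l * y (k - l)) with hc
  have hcn : ∀ k l, ‖c k l‖ ≤ ‖x l‖ * ‖y (k - l)‖ := fun k l => by
    rw [hc]
    simp only [norm_mul, Complex.norm_exp_ofReal_mul_I, mul_one]
    exact mul_le_of_le_one_left (by positivity) (hm k l)
  have h1 : ∀ k, ‖bil m ψ t x y k‖ ^ 2 ≤ 3 * ∑ k₁, ∑ l₁,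
      if rep k₁ + rep (k - k₁) = rep l₁ + rep (k - l₁) then
        (c k k₁ * (starRingEnd ℂ) (c k l₁)).re else 0 := fun k => by
    have hJ : ∀ l, rep l + rep (k - l) ∈
        ({rep k, rep k + 2 * N, rep k - 2 * N} : Finset ℤ) := fun l => by
      have h := rep_add_rep l (k - l)
      rw [add_sub_cancel] at h
      simpa using h
    have h := norm_sum_sq_le_of_classes (c k) (fun l => rep l + rep (k - l)) _ hJ
    have hcard : ((({rep k, rep k + 2 * N, rep k - 2 * N} : Finset ℤ).card : ℕ) : ℝ) ≤ 3 := by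
      exact_mod_cast Finset.card_le_three
    rw [bil_apply]
    refine h.trans ?_
    -- The double sum dominates a square and so is nonnegative; this permits replacing the
    -- cardinality by its bound 3.
    have hnn : 0 ≤ ∑ k₁, ∑ l₁, if rep k₁ + rep (k - k₁) = rep l₁ + rep (k - l₁) then
        (c k k₁ * (starRingEnd ℂ) (c k l₁)).re else 0 := by
      by_contra hneg
      push Not at hneg
      have hpos : 0 < ((({rep k, rep k + 2 * N, rep k - 2 * N} : Finset ℤ).card : ℕ) : ℝ) := by
        exact_mod_cast Finset.card_pos.2 ⟨_, Finset.mem_insert_self _ _⟩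
      nlinarith [sq_nonneg ‖∑ l, c k l‖]
    gcongr
  have h2 : ∀ k k₁ l₁, (if rep k₁ + rep (k - k₁) = rep l₁ + rep (k - l₁) then
        (c k k₁ * (starRingEnd ℂ) (c k l₁)).re else 0) ≤
      ((if l₁ = k₁ then ‖c k k₁‖ * ‖c k l₁‖ else 0) +
        (if l₁ = k - k₁ then ‖c k k₁‖ * ‖c k l₁‖ else 0) +
        (if k = 0 then ‖c k k₁‖ * ‖c k l₁‖ else 0)) +
      if rep k₁ + rep (k - k₁) = rep l₁ + rep (k - l₁) ∧ ¬ near k k₁ l₁ then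
        (c k k₁ * (starRingEnd ℂ) (c k l₁)).re else 0 := by
    intro k k₁ l₁
    have hre : (c k k₁ * (starRingEnd ℂ) (c k l₁)).re ≤ ‖c k k₁‖ * ‖c k l₁‖ := by
      refine (Complex.re_le_norm _).trans (le_of_eq ?_)
      rw [norm_mul, RCLike.norm_conj]
    have hnn : 0 ≤ ‖c k k₁‖ * ‖c k l₁‖ := by positivity
    have i1 : 0 ≤ (if l₁ = k₁ then ‖c k k₁‖ * ‖c k l₁‖ else 0) := by split_ifs <;> simp [hnn]
    have i2 : 0 ≤ (if l₁ = k - k₁ then ‖c k k₁‖ * ‖c k l₁‖ else 0) := by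
      split_ifs <;> simp [hnn]
    have i3 : 0 ≤ (if k = 0 then ‖c k k₁‖ * ‖c k l₁‖ else 0) := by split_ifs <;> simp [hnn]
    by_cases hs : rep k₁ + rep (k - k₁) = rep l₁ + rep (k - l₁)
    · by_cases hn : near k k₁ l₁
      · rw [if_pos hs, if_neg (c := rep k₁ + rep (k - k₁) = rep l₁ + rep (k - l₁) ∧ ¬ near k k₁ l₁) (fun h => h.2 hn), add_zero]
        rcases hn with h | h | h
        · rw [if_pos h] at i1 ⊢; linarith
        · rw [if_pos h] at i2 ⊢; linarith
        -- The integer sum represents k, so it can vanish only for k = 0; this alternative concerns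
        -- a single output coefficient.
        · have hk : k = 0 := by
            rcases rep_add_rep k₁ (k - k₁) with h' | h' | h' <;>
            rw [add_sub_cancel] at h'
            · exact rep_eq_zero.1 (by omega)
            · have := neg_le_rep k; have := rep_lt k; have := NeZero.pos N; omega
            · have := neg_le_rep k; have := rep_lt k; have := NeZero.pos N; omega
          rw [if_pos hk] at i3 ⊢; linarith
      · rw [if_pos hs, if_pos (c := rep k₁ + rep (k - k₁) = rep l₁ + rep (k - l₁) ∧ ¬ near k k₁ l₁) ⟨hs, hn⟩]; linarith
    · rw [if_neg hs, if_neg (c := rep k₁ + rep (k - k₁) = rep l₁ + rep (k - l₁) ∧ ¬ near k k₁ l₁) (fun h => hs h.1)]; linarith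
  have hxy : ∑ k, ∑ l, (‖x l‖ * ‖y (k - l)‖) ^ 2 = (‖x‖ * ‖y‖) ^ 2 := by
    have := sum_conv (fun k => ‖x k‖ ^ 2) (fun k => ‖y k‖ ^ 2)
    rw [mul_pow, norm_sq_eq_sum, norm_sq_eq_sum, ← this]
    exact Finset.sum_congr rfl fun k _ => Finset.sum_congr rfl fun l _ => by ring
  have n1 : ∑ k, ∑ k₁, ∑ l₁, (if l₁ = k₁ then ‖c k k₁‖ * ‖c k l₁‖ else 0) ≤
      (‖x‖ * ‖y‖) ^ 2 := by
    rw [← hxy]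
    refine Finset.sum_le_sum fun k _ => Finset.sum_le_sum fun k₁ _ => ?_
    rw [Finset.sum_ite_eq' Finset.univ k₁, if_pos (Finset.mem_univ _), ← sq]
    gcongr; exact hcn k k₁
  have n2 : ∑ k, ∑ k₁, ∑ l₁, (if l₁ = k - k₁ then ‖c k k₁‖ * ‖c k l₁‖ else 0) ≤
      (‖x‖ * ‖y‖) ^ 2 := by
    rw [← hxy]
    refine Finset.sum_le_sum fun k _ => ?_
    have : ∀ k₁, ∑ l₁, (if l₁ = k - k₁ then ‖c k k₁‖ * ‖c k l₁‖ else 0) =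
        ‖c k k₁‖ * ‖c k (k - k₁)‖ := fun k₁ => by
      rw [Finset.sum_ite_eq' Finset.univ (k - k₁), if_pos (Finset.mem_univ _)]
    simp only [this]
    have hb : (0 : ℝ) ≤ √(∑ l, ‖c k l‖ ^ 2) := Real.sqrt_nonneg _
    have hsq : √(∑ l, ‖c k l‖ ^ 2) ^ 2 = ∑ l, ‖c k l‖ ^ 2 :=
      Real.sq_sqrt (Finset.sum_nonneg fun _ _ => sq_nonneg _)
    have h := sum_mul_le_of_sq_le Finset.univ (f := fun l => ‖c k l‖)
      (g := fun l => ‖c k (k - l)‖) hb hb hsq.ge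
      (by rw [hsq]; exact (sum_sub_left k fun l => ‖c k l‖ ^ 2).le)
    rw [← sq, hsq] at h
    refine h.trans (Finset.sum_le_sum fun l _ => ?_)
    gcongr; exact hcn k l
  have n3 : ∑ k, ∑ k₁, ∑ l₁, (if k = 0 then ‖c k k₁‖ * ‖c k l₁‖ else 0) ≤
      (‖x‖ * ‖y‖) ^ 2 := by
    rw [Finset.sum_eq_single 0 (fun k _ hk => by simp [hk]) (by simp)]
    simp only [if_true]
    rw [← Finset.sum_mul_sum, ← sq]
    have : ∑ l, ‖c 0 l‖ ≤ ‖x‖ * ‖y‖ := by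
      refine (Finset.sum_le_sum fun l _ => hcn 0 l).trans ?_
      refine sum_mul_le_of_sq_le _ (norm_nonneg _) (norm_nonneg _) (norm_sq_eq_sum x).ge ?_
      rw [norm_sq_eq_sum]
      exact (sum_sub_left 0 fun l => ‖y l‖ ^ 2).le
    have h0 : 0 ≤ ∑ l, ‖c 0 l‖ := Finset.sum_nonneg fun _ _ => norm_nonneg _
    gcongr
  have h3 : ∑ k, 3 * ∑ k₁, ∑ l₁, (if rep k₁ + rep (k - k₁) = rep l₁ + rep (k - l₁) then
        (c k k₁ * (starRingEnd ℂ) (c k l₁)).re else 0) ≤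
      3 * (((‖x‖ * ‖y‖) ^ 2 + (‖x‖ * ‖y‖) ^ 2 + (‖x‖ * ‖y‖) ^ 2) + ∑ k, ∑ k₁, ∑ l₁,
        if rep k₁ + rep (k - k₁) = rep l₁ + rep (k - l₁) ∧ ¬ near k k₁ l₁ then
        (c k k₁ * (starRingEnd ℂ) (c k l₁)).re else 0) := by
    rw [← Finset.mul_sum]
    gcongr
    refine (Finset.sum_le_sum fun k _ => Finset.sum_le_sum fun k₁ _ =>
      Finset.sum_le_sum fun l₁ _ => h2 k k₁ l₁).trans ?_
    simp only [Finset.sum_add_distrib]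
    gcongr
  rw [norm_sq_eq_sum]
  refine (Finset.sum_le_sum fun k _ => h1 k).trans (h3.trans (le_of_eq ?_))
  ring

/-- The correlation of two interactions oscillates with the difference D of their phases. Apply
`norm_integral_osc_le`; the four terms in the integral come from the product rule. -/
lemma far_term_le {m : ZMod (2 * N) → ZMod (2 * N) → ℂ} (hm : ∀ k l, ‖m k l‖ ≤ 1)
    (σ τ₁ τ₂ : Bool) {Z W gZ gW : ℝ → Coef N} (hZ : ∀ t, HasDerivAt Z (gZ t) t)
    (hW : ∀ t, HasDerivAt W (gW t) t) (hgZ : Continuous gZ) (hgW : Continuous gW) {T : ℝ}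
    (hT : 0 ≤ T) {k k₁ l₁ : ZMod (2 * N)}
    (h : rep k₁ + rep (k - k₁) = rep l₁ + rep (k - l₁)) (hf : ¬ near k k₁ l₁) :
    ∫ t in (0 : ℝ)..T,
      ((m k k₁ * Complex.exp ((psi σ τ₁ τ₂ k k₁ * t : ℝ) * Complex.I) *
          (Z t k₁ * W t (k - k₁))) *
        (starRingEnd ℂ) (m k l₁ * Complex.exp ((psi σ τ₁ τ₂ k l₁ * t : ℝ) * Complex.I) *
          (Z t l₁ * W t (k - l₁)))).re ≤
    32 * wtt k k₁ l₁ * (prod4 (Z 0) (W 0) (Z 0) (W 0) k k₁ l₁ +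
      prod4 (Z T) (W T) (Z T) (W T) k k₁ l₁ + ∫ t in (0 : ℝ)..T,
        (prod4 (gZ t) (W t) (Z t) (W t) k k₁ l₁ + prod4 (Z t) (gW t) (Z t) (W t) k k₁ l₁ +
        (prod4 (Z t) (W t) (gZ t) (W t) k k₁ l₁ + prod4 (Z t) (W t) (Z t) (gW t) k k₁ l₁))) := by
  obtain ⟨hD, hw⟩ := abs_psi_sub_psi_pos_and_inv_le σ τ₁ τ₂ h hf
  set D := psi σ τ₁ τ₂ k k₁ - psi σ τ₁ τ₂ k l₁ with hDdef
  have hD0 : D ≠ 0 := abs_pos.1 hD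
  have dZ := fun t => hasDerivAt_coef.1 (hZ t)
  have dW := fun t => hasDerivAt_coef.1 (hW t)
  have cZ : ∀ l, Continuous fun t => Z t l := fun l =>
    continuous_iff_continuousAt.2 fun t => (dZ t l).continuousAt
  have cW : ∀ l, Continuous fun t => W t l := fun l =>
    continuous_iff_continuousAt.2 fun t => (dW t l).continuousAt
  have cgZ := continuous_coef.1 hgZ
  have cgW := continuous_coef.1 hgW
  set f : ℝ → ℂ := fun t => (m k k₁ * (starRingEnd ℂ) (m k l₁)) *
    ((Z t k₁ * W t (k - k₁)) * (starRingEnd ℂ) (Z t l₁ * W t (k - l₁))) with hfdef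
  set f' : ℝ → ℂ := fun t => (m k k₁ * (starRingEnd ℂ) (m k l₁)) *
    ((gZ t k₁ * W t (k - k₁) + Z t k₁ * gW t (k - k₁)) *
      (starRingEnd ℂ) (Z t l₁ * W t (k - l₁)) +
    (Z t k₁ * W t (k - k₁)) *
      (starRingEnd ℂ) (gZ t l₁ * W t (k - l₁) + Z t l₁ * gW t (k - l₁))) with hf'def
  have hcont : Continuous f' := by
    have e1 := cZ k₁; have e2 := cZ l₁; have e3 := cW (k - k₁); have e4 := cW (k - l₁)
    have e5 := cgZ k₁; have e6 := cgZ l₁; have e7 := cgW (k - k₁); have e8 := cgW (k - l₁)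
    have hconj := Complex.continuous_conj
    exact continuous_const.mul ((((e5.mul e3).add (e1.mul e7)).mul (hconj.comp (e2.mul e4))).add
      ((e1.mul e3).mul (hconj.comp ((e6.mul e4).add (e2.mul e8)))))
  have hder : ∀ t, HasDerivAt f (f' t) t := fun t =>
    ((((dZ t k₁).fun_mul (dW t (k - k₁))).fun_mul
      ((dZ t l₁).fun_mul (dW t (k - l₁))).star).const_mul _)
  have hmm : ‖m k k₁ * (starRingEnd ℂ) (m k l₁)‖ ≤ 1 := by
    rw [norm_mul, RCLike.norm_conj]
    exact mul_le_one₀ (hm _ _) (norm_nonneg _) (hm _ _)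
  have hfn : ∀ t, ‖f t‖ ≤ prod4 (Z t) (W t) (Z t) (W t) k k₁ l₁ := fun t => by
    rw [hfdef]
    refine (norm_mul_le _ _).trans ((mul_le_of_le_one_left (norm_nonneg _) hmm).trans
      (le_of_eq ?_))
    rw [norm_mul, RCLike.norm_conj, norm_mul, norm_mul, prod4]
  have hf'n : ∀ t, ‖f' t‖ ≤ prod4 (gZ t) (W t) (Z t) (W t) k k₁ l₁ +
        prod4 (Z t) (gW t) (Z t) (W t) k k₁ l₁ +
        (prod4 (Z t) (W t) (gZ t) (W t) k k₁ l₁ +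
          prod4 (Z t) (W t) (Z t) (gW t) k k₁ l₁) := fun t => by
    rw [hf'def]
    refine (norm_mul_le _ _).trans ((mul_le_of_le_one_left (norm_nonneg _) hmm).trans ?_)
    refine (norm_add_le _ _).trans (add_le_add ?_ ?_)
    · rw [norm_mul, RCLike.norm_conj]
      refine (mul_le_mul_of_nonneg_right (norm_add_le _ _) (norm_nonneg _)).trans (le_of_eq ?_)
      simp only [norm_mul, prod4]; ring
    · rw [norm_mul, RCLike.norm_conj]
      refine (mul_le_mul_of_nonneg_left (norm_add_le _ _) (norm_nonneg _)).trans (le_of_eq ?_)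
      simp only [norm_mul, prod4]; ring
  have hint : ∀ t, ((m k k₁ * Complex.exp ((psi σ τ₁ τ₂ k k₁ * t : ℝ) * Complex.I) *
          (Z t k₁ * W t (k - k₁))) *
        (starRingEnd ℂ) (m k l₁ * Complex.exp ((psi σ τ₁ τ₂ k l₁ * t : ℝ) * Complex.I) *
          (Z t l₁ * W t (k - l₁)))).re = (f t * Complex.exp ((D * t : ℝ) * Complex.I)).re :=
      fun t => by
    congr 1
    have he : Complex.exp ((D * t : ℝ) * Complex.I) =
        Complex.exp ((psi σ τ₁ τ₂ k k₁ * t : ℝ) * Complex.I) *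
        (starRingEnd ℂ) (Complex.exp ((psi σ τ₁ τ₂ k l₁ * t : ℝ) * Complex.I)) := by
      rw [← Complex.exp_conj, map_mul, Complex.conj_I, Complex.conj_ofReal, ← Complex.exp_add,
        hDdef]
      congr 1; push_cast; ring
    rw [he, hfdef]
    simp only [map_mul]
    ring
  have hfcont : Continuous f := continuous_iff_continuousAt.2 fun t => (hder t).continuousAt
  have hF : Continuous fun t => f t * Complex.exp ((D * t : ℝ) * Complex.I) := by fun_prop
  simp only [hint]
  have hre : ∫ t in (0 : ℝ)..T, (f t * Complex.exp ((D * t : ℝ) * Complex.I)).re =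
      (∫ t in (0 : ℝ)..T, f t * Complex.exp ((D * t : ℝ) * Complex.I)).re :=
    Complex.reCLM.intervalIntegral_comp_comm (hF.intervalIntegrable _ _)
  rw [hre]
  refine (Complex.re_le_norm _).trans ((norm_integral_osc_le hder hcont hT hD0).trans ?_)
  have hI0 : 0 ≤ ∫ t in (0 : ℝ)..T, ‖f' t‖ :=
    intervalIntegral.integral_nonneg hT fun _ _ => norm_nonneg _
  have hI : ∫ t in (0 : ℝ)..T, ‖f' t‖ ≤ ∫ t in (0 : ℝ)..T,
        (prod4 (gZ t) (W t) (Z t) (W t) k k₁ l₁ + prod4 (Z t) (gW t) (Z t) (W t) k k₁ l₁ +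
        (prod4 (Z t) (W t) (gZ t) (W t) k k₁ l₁ +
          prod4 (Z t) (W t) (Z t) (gW t) k k₁ l₁)) := by
    refine intervalIntegral.integral_mono_on hT (hcont.norm.intervalIntegrable _ _) ?_
      fun t _ => hf'n t
    have hZc : Continuous Z := continuous_iff_continuousAt.2 fun t => (hZ t).continuousAt
    have hWc : Continuous W := continuous_iff_continuousAt.2 fun t => (hW t).continuousAt
    exact Continuous.intervalIntegrable
      (((continuous_prod4 hgZ hWc hZc hWc _ _ _).add (continuous_prod4 hZc hgW hZc hWc _ _ _)).add
      ((continuous_prod4 hZc hWc hgZ hWc _ _ _).add (continuous_prod4 hZc hWc hZc hgW _ _ _))) _ _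
  exact mul_le_mul hw (add_le_add (add_le_add (hfn 0) (hfn T)) hI)
    (add_nonneg (add_nonneg (norm_nonneg _) (norm_nonneg _)) hI0)
    (mul_nonneg (by norm_num) (wtt_nonneg _ _ _))

/-- Bilinear Strichartz estimate for interaction profiles of bounded variation. -/
lemma integral_norm_bil_sq_le_of_hasDerivAt {m : ZMod (2 * N) → ZMod (2 * N) → ℂ}
    (hm : ∀ k l, ‖m k l‖ ≤ 1) (σ τ₁ τ₂ : Bool) {Z W gZ gW : ℝ → Coef N}
    (hZ : ∀ t, HasDerivAt Z (gZ t) t) (hW : ∀ t, HasDerivAt W (gW t) t) (hgZ : Continuous gZ)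
    (hgW : Continuous gW) {T A B : ℝ} (hT : 0 ≤ T) (hT1 : T ≤ 1)
    (hA : ∀ t ∈ Set.Icc 0 T, ‖Z t‖ ≤ A) (hB : ∀ t ∈ Set.Icc 0 T, ‖W t‖ ≤ B)
    (hA' : ∫ t in (0 : ℝ)..T, ‖gZ t‖ ≤ A) (hB' : ∫ t in (0 : ℝ)..T, ‖gW t‖ ≤ B) :
    ∫ t in (0 : ℝ)..T, ‖bil m (psi σ τ₁ τ₂) t (Z t) (W t)‖ ^ 2 ≤ 5000 * (A * B) ^ 2 := by
  classical
  have hZc : Continuous Z := continuous_iff_continuousAt.2 fun t => (hZ t).continuousAt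
  have hWc : Continuous W := continuous_iff_continuousAt.2 fun t => (hW t).continuousAt
  have hA0 : 0 ≤ A := (norm_nonneg _).trans (hA 0 ⟨le_rfl, hT⟩)
  have hB0 : 0 ≤ B := (norm_nonneg _).trans (hB 0 ⟨le_rfl, hT⟩)
  set c : ZMod (2 * N) → ZMod (2 * N) → ℝ → ℂ := fun k l t =>
    m k l * Complex.exp ((psi σ τ₁ τ₂ k l * t : ℝ) * Complex.I) * (Z t l * W t (k - l)) with hc
  have hcc : ∀ k l, Continuous (c k l) := fun k l =>
    (continuous_const.mul (by fun_prop)).mul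
      ((continuous_coef.1 hZc l).mul (continuous_coef.1 hWc (k - l)))
  set P : ZMod (2 * N) → ZMod (2 * N) → ZMod (2 * N) → ℝ → ℝ := fun k k₁ l₁ t =>
    prod4 (gZ t) (W t) (Z t) (W t) k k₁ l₁ + prod4 (Z t) (gW t) (Z t) (W t) k k₁ l₁ +
        (prod4 (Z t) (W t) (gZ t) (W t) k k₁ l₁ + prod4 (Z t) (W t) (Z t) (gW t) k k₁ l₁) with hP
  have hPc : ∀ k k₁ l₁, Continuous (P k k₁ l₁) := fun k k₁ l₁ =>
    ((continuous_prod4 hgZ hWc hZc hWc _ _ _).add (continuous_prod4 hZc hgW hZc hWc _ _ _)).add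
      ((continuous_prod4 hZc hWc hgZ hWc _ _ _).add (continuous_prod4 hZc hWc hZc hgW _ _ _))
  have hPn : ∀ k k₁ l₁ t, 0 ≤ P k k₁ l₁ t := fun k k₁ l₁ t =>
    add_nonneg (add_nonneg (prod4_nonneg _ _ _ _ _ _ _) (prod4_nonneg _ _ _ _ _ _ _))
      (add_nonneg (prod4_nonneg _ _ _ _ _ _ _) (prod4_nonneg _ _ _ _ _ _ _))
  set G : ZMod (2 * N) → ZMod (2 * N) → ZMod (2 * N) → ℝ → ℝ := fun k k₁ l₁ t =>
    if rep k₁ + rep (k - k₁) = rep l₁ + rep (k - l₁) ∧ ¬ near k k₁ l₁ then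
      (c k k₁ t * (starRingEnd ℂ) (c k l₁ t)).re else 0 with hG
  have hGc : ∀ k k₁ l₁, Continuous (G k k₁ l₁) := fun k k₁ l₁ => by
    rw [hG]
    by_cases h : rep k₁ + rep (k - k₁) = rep l₁ + rep (k - l₁) ∧ ¬ near k k₁ l₁
    · simp only [if_pos h]
      exact Complex.continuous_re.comp
        ((hcc k k₁).mul (Complex.continuous_conj.comp (hcc k l₁)))
    · simp only [if_neg h]; exact continuous_const
  have hGi : ∀ k k₁ l₁, ∫ t in (0 : ℝ)..T, G k k₁ l₁ t ≤
      32 * wtt k k₁ l₁ * (prod4 (Z 0) (W 0) (Z 0) (W 0) k k₁ l₁ +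
        prod4 (Z T) (W T) (Z T) (W T) k k₁ l₁ + ∫ t in (0 : ℝ)..T, P k k₁ l₁ t) := by
    intro k k₁ l₁
    rw [hG]
    by_cases h : rep k₁ + rep (k - k₁) = rep l₁ + rep (k - l₁) ∧ ¬ near k k₁ l₁
    · simp only [if_pos h]
      exact far_term_le hm σ τ₁ τ₂ hZ hW hgZ hgW hT h.1 h.2
    · simp only [if_neg h]
      rw [intervalIntegral.integral_zero]
      exact mul_nonneg (mul_nonneg (by norm_num) (wtt_nonneg _ _ _))
        (add_nonneg (add_nonneg (prod4_nonneg _ _ _ _ _ _ _) (prod4_nonneg _ _ _ _ _ _ _))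
          (intervalIntegral.integral_nonneg hT fun t _ => hPn _ _ _ _))
  have hpt : ∀ t ∈ Set.Icc (0 : ℝ) T, ‖bil m (psi σ τ₁ τ₂) t (Z t) (W t)‖ ^ 2 ≤
      9 * (A * B) ^ 2 + 3 * ∑ k, ∑ k₁, ∑ l₁, G k k₁ l₁ t := fun t ht => by
    refine (sum_near_le hm t (Z t) (W t)).trans ?_
    have h1 := hA t ht
    have h2 := hB t ht
    refine add_le_add ?_ (le_of_eq ?_)
    · gcongr
    · rfl
  have hsumc : Continuous fun t => ∑ k, ∑ k₁, ∑ l₁, G k k₁ l₁ t :=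
    continuous_finsetSum _ fun k _ => continuous_finsetSum _ fun k₁ _ =>
      continuous_finsetSum _ fun l₁ _ => hGc k k₁ l₁
  have hbc := continuous_bil (m := m) (ψ := psi σ τ₁ τ₂) hZc hWc
  have h1 : ∫ t in (0 : ℝ)..T, ‖bil m (psi σ τ₁ τ₂) t (Z t) (W t)‖ ^ 2 ≤
      ∫ t in (0 : ℝ)..T, (9 * (A * B) ^ 2 + 3 * ∑ k, ∑ k₁, ∑ l₁, G k k₁ l₁ t) :=
    intervalIntegral.integral_mono_on hT ((hbc.norm.pow 2).intervalIntegrable _ _)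
      ((continuous_const.add (continuous_const.mul hsumc)).intervalIntegrable _ _) hpt
  have hsumc3 : Continuous fun t => 3 * ∑ k, ∑ k₁, ∑ l₁, G k k₁ l₁ t :=
    continuous_const.mul hsumc
  rw [intervalIntegral.integral_add (continuous_const.intervalIntegrable _ _)
    (hsumc3.intervalIntegrable _ _),
    intervalIntegral.integral_const, intervalIntegral.integral_const_mul, sub_zero,
    smul_eq_mul] at h1
  have h2 : ∫ t in (0 : ℝ)..T, ∑ k, ∑ k₁, ∑ l₁, G k k₁ l₁ t =
      ∑ k, ∑ k₁, ∑ l₁, ∫ t in (0 : ℝ)..T, G k k₁ l₁ t := by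
    rw [intervalIntegral.integral_finsetSum fun k _ => (continuous_finsetSum _ fun k₁ _ =>
      continuous_finsetSum _ fun l₁ _ => hGc k k₁ l₁).intervalIntegrable _ _]
    refine Finset.sum_congr rfl fun k _ => ?_
    rw [intervalIntegral.integral_finsetSum fun k₁ _ => (
      continuous_finsetSum _ fun l₁ _ => hGc k k₁ l₁).intervalIntegrable _ _]
    refine Finset.sum_congr rfl fun k₁ _ => ?_
    rw [intervalIntegral.integral_finsetSum fun l₁ _ => (hGc k k₁ l₁).intervalIntegrable _ _]
  have h3 : ∑ k, ∑ k₁, ∑ l₁, wtt k k₁ l₁ * ∫ t in (0 : ℝ)..T, P k k₁ l₁ t =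
      ∫ t in (0 : ℝ)..T, ∑ k, ∑ k₁, ∑ l₁, wtt k k₁ l₁ * P k k₁ l₁ t := by
    have hc' : ∀ k k₁ l₁, Continuous fun t => wtt k k₁ l₁ * P k k₁ l₁ t := fun k k₁ l₁ =>
      continuous_const.mul (hPc k k₁ l₁)
    rw [intervalIntegral.integral_finsetSum fun k _ => (continuous_finsetSum _ fun k₁ _ =>
      continuous_finsetSum _ fun l₁ _ => hc' k k₁ l₁).intervalIntegrable _ _]
    refine Finset.sum_congr rfl fun k _ => ?_
    rw [intervalIntegral.integral_finsetSum fun k₁ _ => (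
      continuous_finsetSum _ fun l₁ _ => hc' k k₁ l₁).intervalIntegrable _ _]
    refine Finset.sum_congr rfl fun k₁ _ => ?_
    rw [intervalIntegral.integral_finsetSum fun l₁ _ => (hc' k k₁ l₁).intervalIntegrable _ _]
    exact Finset.sum_congr rfl fun l₁ _ => (intervalIntegral.integral_const_mul _ _).symm
  have h4 : ∀ t ∈ Set.Icc (0 : ℝ) T, ∑ k, ∑ k₁, ∑ l₁, wtt k k₁ l₁ * P k k₁ l₁ t ≤
      16 * (A * B ^ 2) * ‖gZ t‖ + 16 * (A ^ 2 * B) * ‖gW t‖ := fun t ht => by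
    have e1 := sum_wtt_le (gZ t) (W t) (Z t) (W t)
    have e2 := sum_wtt_le (Z t) (gW t) (Z t) (W t)
    have e3 := sum_wtt_le (Z t) (W t) (gZ t) (W t)
    have e4 := sum_wtt_le (Z t) (W t) (Z t) (gW t)
    have e5 : ∑ k, ∑ k₁, ∑ l₁, wtt k k₁ l₁ * P k k₁ l₁ t ≤
        16 * (‖Z t‖ * ‖W t‖ ^ 2) * ‖gZ t‖ + 16 * (‖Z t‖ ^ 2 * ‖W t‖) * ‖gW t‖ := by
      simp only [hP, mul_add, Finset.sum_add_distrib]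
      nlinarith
    refine e5.trans ?_
    have := hA t ht
    have := hB t ht
    gcongr
  have h5 : ∫ t in (0 : ℝ)..T, ∑ k, ∑ k₁, ∑ l₁, wtt k k₁ l₁ * P k k₁ l₁ t ≤
      32 * (A * B) ^ 2 := by
    have hc' : Continuous fun t => ∑ k, ∑ k₁, ∑ l₁, wtt k k₁ l₁ * P k k₁ l₁ t :=
      continuous_finsetSum _ fun k _ => continuous_finsetSum _ fun k₁ _ =>
        continuous_finsetSum _ fun l₁ _ => continuous_const.mul (hPc k k₁ l₁)
    have c1 : Continuous fun t => 16 * (A * B ^ 2) * ‖gZ t‖ := continuous_const.mul hgZ.norm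
    have c2 : Continuous fun t => 16 * (A ^ 2 * B) * ‖gW t‖ := continuous_const.mul hgW.norm
    have c3 : Continuous fun t => 16 * (A * B ^ 2) * ‖gZ t‖ + 16 * (A ^ 2 * B) * ‖gW t‖ :=
      c1.add c2
    refine (intervalIntegral.integral_mono_on hT (hc'.intervalIntegrable _ _)
      (c3.intervalIntegrable _ _) h4).trans ?_
    rw [intervalIntegral.integral_add (c1.intervalIntegrable _ _) (c2.intervalIntegrable _ _),
      intervalIntegral.integral_const_mul, intervalIntegral.integral_const_mul]
    have i1 : 16 * (A * B ^ 2) * ∫ t in (0 : ℝ)..T, ‖gZ t‖ ≤ 16 * (A * B ^ 2) * A := by gcongr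
    have i2 : 16 * (A ^ 2 * B) * ∫ t in (0 : ℝ)..T, ‖gW t‖ ≤ 16 * (A ^ 2 * B) * B := by gcongr
    nlinarith
  -- Here 1536 = 32 · (8 + 8 + 32), from the two endpoints and the variation; in total 9 + 3 · 1536
  -- ≤ 5000.
  have h6 : ∑ k, ∑ k₁, ∑ l₁, ∫ t in (0 : ℝ)..T, G k k₁ l₁ t ≤ 1536 * (A * B) ^ 2 := by
    refine (Finset.sum_le_sum fun k _ => Finset.sum_le_sum fun k₁ _ =>
      Finset.sum_le_sum fun l₁ _ => hGi k k₁ l₁).trans ?_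
    have b : ∀ t ∈ Set.Icc (0 : ℝ) T, ∑ k, ∑ k₁, ∑ l₁, wtt k k₁ l₁ *
        prod4 (Z t) (W t) (Z t) (W t) k k₁ l₁ ≤ 8 * (A * B) ^ 2 := fun t ht => by
      refine (sum_wtt_le _ _ _ _).trans ?_
      rw [sq]
      have := hA t ht
      have := hB t ht
      gcongr
    have b0 := b 0 ⟨le_rfl, hT⟩
    have b1 := b T ⟨hT, le_rfl⟩
    rw [← h3] at h5
    simp only [mul_add, mul_assoc, Finset.sum_add_distrib, ← Finset.mul_sum] at *
    nlinarith
  rw [h2] at h1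
  have h7 : T * (9 * (A * B) ^ 2) ≤ 9 * (A * B) ^ 2 :=
    mul_le_of_le_one_left (by positivity) hT1
  nlinarith [sq_nonneg (A * B)]

end strichartz

/-! ### Bounded variation up to an ℓ¹ error -/

lemma continuous_of_hasDerivAt {F : Type*} [NormedAddCommGroup F] [NormedSpace ℝ F]
    {f g : ℝ → F} (h : ∀ t, HasDerivAt f (g t) t) : Continuous f :=
  continuous_iff_continuousAt.2 fun t => (h t).continuousAt

/-- Cauchy–Schwarz in time, obtained from the nonnegative variance of ‖f‖ about its mean I / T. -/
lemma integral_norm_le_sqrt {F : Type*} [NormedAddCommGroup F] {f : ℝ → F} (hf : Continuous f)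
    {T b : ℝ} (hT : 0 ≤ T) (hb : 0 ≤ b) (h : ∫ t in (0 : ℝ)..T, ‖f t‖ ^ 2 ≤ b ^ 2) :
    ∫ t in (0 : ℝ)..T, ‖f t‖ ≤ √T * b := by
  rcases hT.eq_or_lt with rfl | hT'
  · simp
  have hn : Continuous fun t => ‖f t‖ := hf.norm
  have hn2 : Continuous fun t => ‖f t‖ ^ 2 := hn.pow 2
  set I := ∫ t in (0 : ℝ)..T, ‖f t‖ with hI
  have key : 0 ≤ ∫ t in (0 : ℝ)..T, (‖f t‖ - I / T) ^ 2 :=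
    intervalIntegral.integral_nonneg hT fun t _ => sq_nonneg _
  have e : ∀ t, (‖f t‖ - I / T) ^ 2 = ‖f t‖ ^ 2 - 2 * (I / T) * ‖f t‖ + (I / T) ^ 2 :=
    fun t => by ring
  have c1 : Continuous fun t => 2 * (I / T) * ‖f t‖ := continuous_const.mul hn
  have c2 : Continuous fun t => ‖f t‖ ^ 2 - 2 * (I / T) * ‖f t‖ := hn2.sub c1
  simp only [e] at key
  rw [intervalIntegral.integral_add (c2.intervalIntegrable _ _)
    (continuous_const.intervalIntegrable _ _), intervalIntegral.integral_sub
    (hn2.intervalIntegrable _ _) (c1.intervalIntegrable _ _),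
    intervalIntegral.integral_const_mul, intervalIntegral.integral_const, sub_zero,
    smul_eq_mul, ← hI] at key
  have h2 : I ^ 2 ≤ T * b ^ 2 := by
    have e2 : T * (I / T) ^ 2 = I ^ 2 / T := by field_simp
    have e3 : 2 * (I / T) * I = 2 * (I ^ 2 / T) := by ring
    rw [e2, e3] at key
    have : I ^ 2 / T ≤ b ^ 2 := by linarith
    rw [div_le_iff₀ hT'] at this
    linarith
  refine (abs_le_of_sq_le_sq' ?_ (by positivity)).2
  rw [mul_pow, Real.sq_sqrt hT]
  exact h2

section XB
variable {N : ℕ} [NeZero N]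

/-- A function on `[0, T]` is of size `ξ` if it is the sum of a function that is bounded in `ℓ¹`
and of a function of bounded variation in `ℓ²`, both of size `ξ`. -/
def XB (T : ℝ) (d : ℝ → Coef N) (ξ : ℝ) : Prop :=
  ∃ Z g : ℝ → Coef N, (∀ t, HasDerivAt Z (g t) t) ∧ Continuous g ∧
    (∀ t ∈ Set.Icc 0 T, l1 (d t - Z t) ≤ ξ) ∧ ‖Z 0‖ ≤ ξ ∧ ∫ t in (0 : ℝ)..T, ‖g t‖ ≤ ξ

lemma norm_le_of_integral_le {Z g : ℝ → Coef N} (hZ : ∀ t, HasDerivAt Z (g t) t)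
    (hg : Continuous g) {T a b : ℝ} (h0 : ‖Z 0‖ ≤ a) (hi : ∫ t in (0 : ℝ)..T, ‖g t‖ ≤ b)
    {t : ℝ} (ht : t ∈ Set.Icc 0 T) : ‖Z t‖ ≤ a + b := by
  have h1 : ∫ s in (0 : ℝ)..t, g s = Z t - Z 0 :=
    intervalIntegral.integral_eq_sub_of_hasDerivAt (fun s _ => hZ s) (hg.intervalIntegrable _ _)
  have h2 := intervalIntegral.norm_integral_le_integral_norm (μ := MeasureTheory.volume)
    (f := g) ht.1
  have h3 : ∫ s in (0 : ℝ)..t, ‖g s‖ ≤ ∫ s in (0 : ℝ)..T, ‖g s‖ :=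
    intervalIntegral.integral_mono_interval le_rfl ht.1 ht.2
      (Filter.Eventually.of_forall fun s => norm_nonneg _) (hg.norm.intervalIntegrable _ _)
  have h4 : Z t = Z 0 + ∫ s in (0 : ℝ)..t, g s := by rw [h1]; abel
  rw [h4]
  exact (norm_add_le _ _).trans (by linarith)

lemma XB.nonneg {T ξ : ℝ} {d : ℝ → Coef N} (h : XB T d ξ) : 0 ≤ ξ := by
  obtain ⟨Z, g, _, _, _, h, _⟩ := h
  exact (norm_nonneg _).trans h

lemma XB.mono {T ξ η : ℝ} {d : ℝ → Coef N} (h : XB T d ξ) (hξ : ξ ≤ η) : XB T d η := by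
  obtain ⟨Z, g, h1, h2, h3, h4, h5⟩ := h
  exact ⟨Z, g, h1, h2, fun t ht => (h3 t ht).trans hξ, h4.trans hξ, h5.trans hξ⟩

lemma XB.norm_le {T ξ : ℝ} {d : ℝ → Coef N} (h : XB T d ξ) {t : ℝ} (ht : t ∈ Set.Icc 0 T) :
    ‖d t‖ ≤ 3 * ξ := by
  obtain ⟨Z, g, h1, h2, h3, h4, h5⟩ := h
  have a := norm_le_of_integral_le h1 h2 h4 h5 ht
  have b := (norm_le_l1 _).trans (h3 t ht)
  have : d t = (d t - Z t) + Z t := by abel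
  rw [this]
  exact (norm_add_le _ _).trans (by linarith)

lemma XB.add {T ξ η : ℝ} {a b : ℝ → Coef N} (hT : 0 ≤ T) (ha : XB T a ξ) (hb : XB T b η) :
    XB T (fun t => a t + b t) (ξ + η) := by
  obtain ⟨Z, g, h1, h2, h3, h4, h5⟩ := ha
  obtain ⟨W, k, h1', h2', h3', h4', h5'⟩ := hb
  refine ⟨fun t => Z t + W t, fun t => g t + k t, fun t => (h1 t).add (h1' t), h2.add h2',
    fun t ht => ?_, (norm_add_le _ _).trans (add_le_add h4 h4'), ?_⟩
  · have : a t + b t - (Z t + W t) = (a t - Z t) + (b t - W t) := by abel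
    rw [this]
    exact (l1_add_le _ _).trans (add_le_add (h3 t ht) (h3' t ht))
  · refine le_trans ?_ (add_le_add h5 h5')
    rw [← intervalIntegral.integral_add (h2.norm.intervalIntegrable _ _)
      (h2'.norm.intervalIntegrable _ _)]
    exact intervalIntegral.integral_mono_on hT ((h2.add h2').norm.intervalIntegrable _ _)
      ((h2.norm.add h2'.norm).intervalIntegrable _ _) fun t _ => norm_add_le _ _

/-- Bilinear Strichartz estimate. -/
lemma XB.integral_norm_bil_sq_le {m : ZMod (2 * N) → ZMod (2 * N) → ℂ}
    (hm : ∀ k l, ‖m k l‖ ≤ 1) (σ τ₁ τ₂ : Bool) {T ξ η : ℝ} {a b : ℝ → Coef N} (hT : 0 ≤ T)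
    (hT1 : T ≤ 1) (ha : XB T a ξ) (hb : XB T b η) (hac : Continuous a) (hbc : Continuous b) :
    ∫ t in (0 : ℝ)..T, ‖bil m (psi σ τ₁ τ₂) t (a t) (b t)‖ ^ 2 ≤ (500 * (ξ * η)) ^ 2 := by
  have hbn := fun t (ht : t ∈ Set.Icc 0 T) => hb.norm_le ht
  have hξ := ha.nonneg
  have hη := hb.nonneg
  obtain ⟨Z, g, h1, h2, h3, h4, h5⟩ := ha
  obtain ⟨W, k, h1', h2', h3', h4', h5'⟩ := hb
  have hZ := fun t (ht : t ∈ Set.Icc 0 T) => norm_le_of_integral_le h1 h2 h4 h5 ht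
  have hW := fun t (ht : t ∈ Set.Icc 0 T) => norm_le_of_integral_le h1' h2' h4' h5' ht
  have hS := integral_norm_bil_sq_le_of_hasDerivAt hm σ τ₁ τ₂ h1 h1' h2 h2' hT hT1 hZ hW
    (by linarith) (by linarith)
  have hZc := continuous_of_hasDerivAt h1
  have hWc := continuous_of_hasDerivAt h1'
  have hpt : ∀ t ∈ Set.Icc 0 T, ‖bil m (psi σ τ₁ τ₂) t (a t) (b t)‖ ^ 2 ≤
      3 * ‖bil m (psi σ τ₁ τ₂) t (Z t) (W t)‖ ^ 2 + 39 * (ξ * η) ^ 2 := fun t ht => by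
    have e : bil m (psi σ τ₁ τ₂) t (a t) (b t) = bil m (psi σ τ₁ τ₂) t (Z t) (W t) +
        bil m (psi σ τ₁ τ₂) t (a t - Z t) (b t) + bil m (psi σ τ₁ τ₂) t (Z t) (b t - W t) := by
      rw [bil_sub_left, bil_sub_right]; abel
    have b1 : ‖bil m (psi σ τ₁ τ₂) t (a t - Z t) (b t)‖ ≤ 3 * (ξ * η) := by
      refine (norm_bil_le_l1_left hm t _ _).trans ?_
      calc _ ≤ ξ * (3 * η) := mul_le_mul (h3 t ht) (hbn t ht) (norm_nonneg _) hξ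
        _ = _ := by ring
    have b2 : ‖bil m (psi σ τ₁ τ₂) t (Z t) (b t - W t)‖ ≤ 2 * (ξ * η) := by
      refine (norm_bil_le_l1_right hm t _ _).trans ?_
      calc _ ≤ (ξ + ξ) * η := mul_le_mul (hZ t ht) (h3' t ht) (l1_nonneg _) (by linarith)
        _ = _ := by ring
    have b3 := norm_add₃_le (a := bil m (psi σ τ₁ τ₂) t (Z t) (W t))
      (b := bil m (psi σ τ₁ τ₂) t (a t - Z t) (b t))
      (c := bil m (psi σ τ₁ τ₂) t (Z t) (b t - W t))
    rw [← e] at b3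
    have n0 := norm_nonneg (bil m (psi σ τ₁ τ₂) t (Z t) (W t))
    have n1 := norm_nonneg (bil m (psi σ τ₁ τ₂) t (a t - Z t) (b t))
    have n2 := norm_nonneg (bil m (psi σ τ₁ τ₂) t (Z t) (b t - W t))
    generalize ‖bil m (psi σ τ₁ τ₂) t (Z t) (W t)‖ = x at *
    generalize ‖bil m (psi σ τ₁ τ₂) t (a t - Z t) (b t)‖ = y at *
    generalize ‖bil m (psi σ τ₁ τ₂) t (Z t) (b t - W t)‖ = z at *
    calc ‖bil m (psi σ τ₁ τ₂) t (a t) (b t)‖ ^ 2 ≤ (x + y + z) ^ 2 := by gcongr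
      _ ≤ 3 * x ^ 2 + 3 * y ^ 2 + 3 * z ^ 2 := by
        nlinarith [sq_nonneg (x - y), sq_nonneg (y - z), sq_nonneg (x - z)]
      _ ≤ 3 * x ^ 2 + 3 * (3 * (ξ * η)) ^ 2 + 3 * (2 * (ξ * η)) ^ 2 := by gcongr
      _ = _ := by ring
  have c1 : Continuous fun t => ‖bil m (psi σ τ₁ τ₂) t (a t) (b t)‖ ^ 2 :=
    (continuous_bil hac hbc).norm.pow 2
  have c2 : Continuous fun t => 3 * ‖bil m (psi σ τ₁ τ₂) t (Z t) (W t)‖ ^ 2 :=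
    continuous_const.mul ((continuous_bil hZc hWc).norm.pow 2)
  have c3 : Continuous fun t => 3 * ‖bil m (psi σ τ₁ τ₂) t (Z t) (W t)‖ ^ 2 +
      39 * (ξ * η) ^ 2 := c2.add continuous_const
  refine (intervalIntegral.integral_mono_on hT (c1.intervalIntegrable _ _)
    (c3.intervalIntegrable _ _) hpt).trans ?_
  rw [intervalIntegral.integral_add (c2.intervalIntegrable _ _)
    (continuous_const.intervalIntegrable _ _), intervalIntegral.integral_const,
    intervalIntegral.integral_const_mul, sub_zero, smul_eq_mul]
  have : T * (39 * (ξ * η) ^ 2) ≤ 39 * (ξ * η) ^ 2 := mul_le_of_le_one_left (by positivity) hT1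
  nlinarith [sq_nonneg (ξ * η)]

end XB

/-! ### Normal form -/

section normalForm
variable {N : ℕ} [NeZero N]

lemma psi_swap (σ τ₁ τ₂ : Bool) (k l : ZMod (2 * N)) :
    psi σ τ₁ τ₂ k (k - l) = psi σ τ₂ τ₁ k l := by
  unfold psi; rw [sub_sub_cancel]; ring

/-- The quadratic interactions lose no derivative after one normal form. -/
lemma abs_qSym_mul_le (σ τ₁ τ₂ : Bool) (k l : ZMod (2 * N)) :
    |qSym k| * (ab l * ab (k - l)) ≤ 1200 * |psi σ τ₁ τ₂ k l| := by
  have hh := mesh_pos N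
  have hq := abs_qSym_le k
  have h0 := ab_nonneg k
  have h1 := ab_nonneg l
  have h2 := ab_nonneg (k - l)
  -- If an opposite wave is involved, the phase controls only one frequency, but with a factor h⁻²,
  -- and h⁻² pays for the other two.
  have hpi : ∀ a b : ZMod (2 * N), mesh N ^ 2 * (ab a * ab b) ≤ 10 := fun a b => by
    have ha := mesh_mul_ab_le a
    have hb := mesh_mul_ab_le b
    have ha0 := mul_nonneg hh.le (ab_nonneg a)
    have hb0 := mul_nonneg hh.le (ab_nonneg b)
    calc mesh N ^ 2 * (ab a * ab b) = (mesh N * ab a) * (mesh N * ab b) := by ring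
      _ ≤ π * π := by gcongr
      _ ≤ 10 := by nlinarith [Real.pi_lt_d2, Real.pi_pos]
  have h3 : |qSym k| * (ab l * ab (k - l)) ≤ ab k * (ab l * ab (k - l)) := by gcongr
  refine h3.trans ?_
  cases τ₁ <;> cases τ₂
  · have h := ab_le_psi_opposite σ k l
    have hp := hpi l (k - l)
    have n := abs_nonneg (psi σ false false k l)
    calc ab k * (ab l * ab (k - l))
        ≤ 120 * (mesh N ^ 2 * |psi σ false false k l|) * (ab l * ab (k - l)) := by gcongr
      _ = 120 * |psi σ false false k l| * (mesh N ^ 2 * (ab l * ab (k - l))) := by ring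
      _ ≤ 120 * |psi σ false false k l| * 10 := by gcongr
      _ = _ := by ring
  · have h := ab_le_psi_mixed σ k (k - l)
    rw [psi_swap, sub_sub_cancel] at h
    have hp := hpi k (k - l)
    have n := abs_nonneg (psi σ false true k l)
    calc ab k * (ab l * ab (k - l))
        ≤ ab k * (120 * (mesh N ^ 2 * |psi σ false true k l|) * ab (k - l)) := by gcongr
      _ = 120 * |psi σ false true k l| * (mesh N ^ 2 * (ab k * ab (k - l))) := by ring
      _ ≤ 120 * |psi σ false true k l| * 10 := by gcongr
      _ = _ := by ring
  · have h := ab_le_psi_mixed σ k l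
    have hp := hpi k l
    have n := abs_nonneg (psi σ true false k l)
    calc ab k * (ab l * ab (k - l))
        ≤ ab k * (ab l * (120 * (mesh N ^ 2 * |psi σ true false k l|))) := by gcongr
      _ = 120 * |psi σ true false k l| * (mesh N ^ 2 * (ab k * ab l)) := by ring
      _ ≤ 120 * |psi σ true false k l| * 10 := by gcongr
      _ = _ := by ring
  · have h := ab_mul_le_psi_same σ k l
    have n := abs_nonneg (psi σ true true k l)
    linarith

/-- High interactions: all frequencies are nonzero and one of the incoming ones exceeds `M`. -/
def high {N : ℕ} (M : ℕ) (k l : ZMod (2 * N)) : Prop :=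
  k ≠ 0 ∧ l ≠ 0 ∧ k - l ≠ 0 ∧ ((M : ℝ) < ab l ∨ (M : ℝ) < ab (k - l))

open Classical in
/-- The multiplier of the normal form. -/
def mhi {N : ℕ} (M : ℕ) (σ τ₁ τ₂ : Bool) (k l : ZMod (2 * N)) : ℂ :=
  if high M k l then (qSym k : ℂ) / (Complex.I * psi σ τ₁ τ₂ k l) else 0

open Classical in
/-- The multiplier of the remaining low interactions. -/
def mlow {N : ℕ} (M : ℕ) (k l : ZMod (2 * N)) : ℂ :=
  if high M k l then 0 else (qSym k : ℂ)

lemma psi_ne_zero_of_high {M : ℕ} {k l : ZMod (2 * N)} (h : high M k l) (σ τ₁ τ₂ : Bool)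
    (hq : qSym k ≠ 0) : psi σ τ₁ τ₂ k l ≠ 0 := by
  intro h0
  have h1 := abs_qSym_mul_le σ τ₁ τ₂ k l
  rw [h0, abs_zero, mul_zero] at h1
  have := abs_pos.2 hq
  have := ab_pos h.2.1
  have := ab_pos h.2.2.1
  have : 0 < |qSym k| * (ab l * ab (k - l)) := by positivity
  linarith

/-- For a high interaction ψ can vanish only where `qSym` does, so division by zero in `mhi` is
harmless. -/
lemma mlow_add_mhi (M : ℕ) (σ τ₁ τ₂ : Bool) (k l : ZMod (2 * N)) :
    mlow M k l + mhi M σ τ₁ τ₂ k l * (Complex.I * psi σ τ₁ τ₂ k l) = qSym k := by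
  unfold mlow mhi
  by_cases h : high M k l
  · rw [if_pos h, if_pos h, zero_add]
    by_cases hq : qSym k = 0
    · simp [hq]
    · have := psi_ne_zero_of_high h σ τ₁ τ₂ hq
      rw [div_mul_cancel₀]
      simp [this]
  · rw [if_neg h, if_neg h]; simp

/-- The normal form gains one derivative on each input, even after the outer derivative has been
paid. -/
lemma norm_mhi_le (M : ℕ) (σ τ₁ τ₂ : Bool) {k l : ZMod (2 * N)} (h : high M k l) :
    ‖mhi M σ τ₁ τ₂ k l‖ ≤ 1200 * ((ab l)⁻¹ * (ab (k - l))⁻¹) := by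
  have h1 := ab_pos h.2.1
  have h2 := ab_pos h.2.2.1
  unfold mhi
  rw [if_pos h, norm_div, norm_mul, Complex.norm_I, one_mul, Complex.norm_real,
    Complex.norm_real, Real.norm_eq_abs, Real.norm_eq_abs]
  have h3 := abs_qSym_mul_le σ τ₁ τ₂ k l
  rcases (abs_nonneg (psi σ τ₁ τ₂ k l)).eq_or_lt with h0 | h0
  · rw [← h0, div_zero]; positivity
  · rw [div_le_iff₀ h0, ← mul_inv, mul_right_comm, ← div_eq_mul_inv, le_div_iff₀ (by positivity)]
    exact h3

lemma mhi_of_not_high {M : ℕ} {σ τ₁ τ₂ : Bool} {k l : ZMod (2 * N)} (h : ¬ high M k l) :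
    mhi M σ τ₁ τ₂ k l = 0 := if_neg h

/-- Boundary term of the normal form. -/
lemma l1_bil_mhi_le (M : ℕ) (σ τ₁ τ₂ : Bool) (t : ℝ) (x y : Coef N) :
    l1 (bil (mhi M σ τ₁ τ₂) (psi σ τ₁ τ₂) t x y) ≤
      9600 / √((M : ℝ) + 1) * (‖x‖ * ‖y‖) := by
  set X : ZMod (2 * N) → ℝ := fun k => ‖x k‖ * (ab k)⁻¹ with hX
  set Y : ZMod (2 * N) → ℝ := fun k => ‖y k‖ * (ab k)⁻¹ with hY
  set X' : ZMod (2 * N) → ℝ := fun k => if (M : ℝ) < ab k then ‖x k‖ * (ab k)⁻¹ else 0 with hX'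
  set Y' : ZMod (2 * N) → ℝ := fun k => if (M : ℝ) < ab k then ‖y k‖ * (ab k)⁻¹ else 0 with hY'
  have nX : ∀ k, 0 ≤ X k := fun k => mul_nonneg (norm_nonneg _) (inv_nonneg.2 (ab_nonneg _))
  have nY : ∀ k, 0 ≤ Y k := fun k => mul_nonneg (norm_nonneg _) (inv_nonneg.2 (ab_nonneg _))
  have nX' : ∀ k, 0 ≤ X' k := fun k => by
    rw [hX']; dsimp only; split_ifs; exacts [nX k, le_rfl]
  have nY' : ∀ k, 0 ≤ Y' k := fun k => by
    rw [hY']; dsimp only; split_ifs; exacts [nY k, le_rfl]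
  -- The inverse frequencies turn ℓ² into ℓ¹ for both inputs; the input above M supplies the small
  -- factor (M + 1)^(-1/2).
  have hpt : ∀ k, ‖bil (mhi M σ τ₁ τ₂) (psi σ τ₁ τ₂) t x y k‖ ≤
      1200 * (conv X' Y k + conv X Y' k) := fun k => by
    refine (norm_bil_apply_le_sum t x y k).trans ?_
    unfold conv
    rw [← Finset.sum_add_distrib, Finset.mul_sum]
    refine Finset.sum_le_sum fun l _ => ?_
    have n1 := mul_nonneg (nX' l) (nY (k - l))
    have n2 := mul_nonneg (nX l) (nY' (k - l))
    by_cases h : high M k l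
    · have h1 : ‖mhi M σ τ₁ τ₂ k l‖ * (‖x l‖ * ‖y (k - l)‖) ≤ 1200 * (X l * Y (k - l)) := by
        refine (mul_le_mul_of_nonneg_right (norm_mhi_le M σ τ₁ τ₂ h) (by positivity)).trans
          (le_of_eq ?_)
        rw [hX, hY]; ring
      refine h1.trans ?_
      gcongr
      rcases h.2.2.2 with h' | h'
      · have : X' l = X l := if_pos h'
        rw [this]; linarith
      · have : Y' (k - l) = Y (k - l) := if_pos h'
        rw [this]; linarith
    · rw [mhi_of_not_high h, norm_zero, zero_mul]; linarith
  refine (Finset.sum_le_sum fun k _ => hpt k).trans ?_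
  rw [← Finset.mul_sum, Finset.sum_add_distrib, sum_conv, sum_conv]
  have s1 : ∑ k, X k ≤ 2 * ‖x‖ := sum_norm_mul_inv_le x
  have s2 : ∑ k, Y k ≤ 2 * ‖y‖ := sum_norm_mul_inv_le y
  have s3 : ∑ k, X' k ≤ 2 / √((M : ℝ) + 1) * ‖x‖ := sum_tail_le M x
  have s4 : ∑ k, Y' k ≤ 2 / √((M : ℝ) + 1) * ‖y‖ := sum_tail_le M y
  have p2 : 0 ≤ ∑ k, Y k := Finset.sum_nonneg fun k _ => nY k
  have p4 : 0 ≤ ∑ k, Y' k := Finset.sum_nonneg fun k _ => nY' k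
  calc 1200 * ((∑ k, X' k) * ∑ k, Y k + (∑ k, X k) * ∑ k, Y' k)
      ≤ 1200 * (2 / √((M : ℝ) + 1) * ‖x‖ * (2 * ‖y‖) +
        2 * ‖x‖ * (2 / √((M : ℝ) + 1) * ‖y‖)) := by gcongr
    _ = _ := by ring

/-- Low interactions. -/
lemma norm_bil_mlow_le (M : ℕ) (ψ : ZMod (2 * N) → ZMod (2 * N) → ℝ) (t : ℝ) {x y : Coef N}
    (hx : x 0 = 0) (hy : y 0 = 0) :
    ‖bil (mlow M) ψ t x y‖ ≤ 4 * (M : ℝ) ^ 2 * (‖x‖ * ‖y‖) := by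
  set X : ZMod (2 * N) → ℝ := fun k => 2 * (M : ℝ) ^ 2 * (‖x k‖ * (ab k)⁻¹) with hX
  have nX : ∀ k, 0 ≤ X k := fun k => mul_nonneg (by positivity)
    (mul_nonneg (norm_nonneg _) (inv_nonneg.2 (ab_nonneg _)))
  have h := norm_le_of_le_conv (z := bil (mlow M) ψ t x y) (X := X) (Y := fun k => ‖y k‖)
    (a := 4 * (M : ℝ) ^ 2 * ‖x‖) nX (fun k => ?_) (norm_nonneg y) ?_ (norm_sq_eq_sum y).ge
  · exact h.trans (le_of_eq (by ring))
  · refine (norm_bil_apply_le_sum t x y k).trans (Finset.sum_le_sum fun l _ => ?_)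
    have n1 := mul_nonneg (nX l) (norm_nonneg (y (k - l)))
    by_cases hl : l = 0
    · subst hl; rw [hx, norm_zero, zero_mul, mul_zero]; exact n1
    by_cases hkl : k - l = 0
    · rw [hkl, hy, norm_zero, mul_zero, mul_zero]
      exact mul_nonneg (nX l) (norm_nonneg _)
    by_cases hk : k = 0
    · have : mlow M k l = 0 := by unfold mlow; rw [hk, qSym_zero]; simp
      rw [this, norm_zero, zero_mul]; exact n1
    by_cases hh : high M k l
    · have : mlow M k l = 0 := if_pos hh
      rw [this, norm_zero, zero_mul]; exact n1
    · have e : mlow M k l = qSym k := if_neg hh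
      have h1 : ¬ ((M : ℝ) < ab l ∨ (M : ℝ) < ab (k - l)) := fun h => hh ⟨hk, hl, hkl, h⟩
      push Not at h1
      have hp := ab_pos hl
      have h2 : ab k ≤ ab l + ab (k - l) := by
        have := ab_add_le l (k - l); rwa [add_sub_cancel] at this
      have h3 : ‖mlow M k l‖ ≤ 2 * M := by
        rw [e, Complex.norm_real, Real.norm_eq_abs]
        exact (abs_qSym_le k).trans (by linarith)
      -- Since |l| ≤ M, one more factor M pays for the weight 1/|l| that makes the first input
      -- summable.
      have h4 : ‖mlow M k l‖ ≤ 2 * (M : ℝ) ^ 2 * (ab l)⁻¹ := by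
        refine h3.trans ?_
        rw [← div_eq_mul_inv, le_div_iff₀ hp]
        have : (0 : ℝ) ≤ M := Nat.cast_nonneg M
        nlinarith [h1.1]
      calc ‖mlow M k l‖ * (‖x l‖ * ‖y (k - l)‖)
          ≤ 2 * (M : ℝ) ^ 2 * (ab l)⁻¹ * (‖x l‖ * ‖y (k - l)‖) := by gcongr
        _ = _ := by rw [hX]; ring
  · rw [hX, ← Finset.mul_sum]
    calc 2 * (M : ℝ) ^ 2 * ∑ k, ‖x k‖ * (ab k)⁻¹ ≤ 2 * (M : ℝ) ^ 2 * (2 * ‖x‖) := by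
          gcongr; exact sum_norm_mul_inv_le x
      _ = _ := by ring

/-- Used when the time derivative falls on the first factor, which then carries a derivative of F.
One of the two gained inverse frequencies removes it; the other puts y into ℓ¹. -/
lemma norm_bil_mhi_le_left (M : ℕ) (σ τ₁ τ₂ : Bool) (t : ℝ) {x y F : Coef N}
    (hx : ∀ k, k ≠ 0 → ‖x k‖ ≤ ab k * ‖F k‖) :
    ‖bil (mhi M σ τ₁ τ₂) (psi σ τ₁ τ₂) t x y‖ ≤ 2400 * (‖F‖ * ‖y‖) := by
  have h := norm_le_of_le_conv' (z := bil (mhi M σ τ₁ τ₂) (psi σ τ₁ τ₂) t x y)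
    (X := fun k => ‖F k‖) (Y := fun k => 1200 * (‖y k‖ * (ab k)⁻¹)) (b := 2400 * ‖y‖)
    (fun k => mul_nonneg (by norm_num)
      (mul_nonneg (norm_nonneg _) (inv_nonneg.2 (ab_nonneg _)))) (fun k => ?_)
    (norm_nonneg F) (norm_sq_eq_sum F).ge ?_
  · exact h.trans (le_of_eq (by ring))
  · refine (norm_bil_apply_le_sum t x y k).trans (Finset.sum_le_sum fun l _ => ?_)
    by_cases hh : high M k l
    · have hp := ab_pos hh.2.1
      have hp' := ab_pos hh.2.2.1
      calc ‖mhi M σ τ₁ τ₂ k l‖ * (‖x l‖ * ‖y (k - l)‖)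
          ≤ 1200 * ((ab l)⁻¹ * (ab (k - l))⁻¹) * ((ab l * ‖F l‖) * ‖y (k - l)‖) := by
            gcongr
            · exact norm_mhi_le M σ τ₁ τ₂ hh
            · exact hx l hh.2.1
        _ = _ := by field_simp
    · rw [mhi_of_not_high hh, norm_zero, zero_mul]
      have := ab_nonneg (k - l)
      positivity
  · rw [← Finset.mul_sum]
    have := sum_norm_mul_inv_le y
    linarith

lemma norm_bil_mhi_le_right (M : ℕ) (σ τ₁ τ₂ : Bool) (t : ℝ) {x y F : Coef N}
    (hy : ∀ k, k ≠ 0 → ‖y k‖ ≤ ab k * ‖F k‖) :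
    ‖bil (mhi M σ τ₁ τ₂) (psi σ τ₁ τ₂) t x y‖ ≤ 2400 * (‖x‖ * ‖F‖) := by
  have h := norm_le_of_le_conv (z := bil (mhi M σ τ₁ τ₂) (psi σ τ₁ τ₂) t x y)
    (Y := fun k => ‖F k‖) (X := fun k => 1200 * (‖x k‖ * (ab k)⁻¹)) (a := 2400 * ‖x‖)
    (fun k => mul_nonneg (by norm_num)
      (mul_nonneg (norm_nonneg _) (inv_nonneg.2 (ab_nonneg _)))) (fun k => ?_)
    (norm_nonneg F) ?_ (norm_sq_eq_sum F).ge
  · exact h.trans (le_of_eq (by ring))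
  · refine (norm_bil_apply_le_sum t x y k).trans (Finset.sum_le_sum fun l _ => ?_)
    by_cases hh : high M k l
    · have hp := ab_pos hh.2.1
      have hp' := ab_pos hh.2.2.1
      calc ‖mhi M σ τ₁ τ₂ k l‖ * (‖x l‖ * ‖y (k - l)‖)
          ≤ 1200 * ((ab l)⁻¹ * (ab (k - l))⁻¹) * (‖x l‖ * (ab (k - l) * ‖F (k - l)‖)) := by
            gcongr
            · exact norm_mhi_le M σ τ₁ τ₂ hh
            · exact hy (k - l) hh.2.2.1
        _ = _ := by field_simp
    · rw [mhi_of_not_high hh, norm_zero, zero_mul]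
      have := ab_nonneg l
      positivity
  · rw [← Finset.mul_sum]
    have := sum_norm_mul_inv_le x
    linarith

end normalForm

/-! ### The quadratic interaction over all directions, and the normal form estimate -/

section quad
variable {N : ℕ} [NeZero N]

/-- The quadratic interaction of pairs of profiles, with coupling constants `cc` for waves in the
same and in the opposite direction. -/
def quad (cc : Bool → ℝ) (m : Bool → Bool → ZMod (2 * N) → ZMod (2 * N) → ℂ) (σ : Bool) (t : ℝ)
    (x y : Bool → Coef N) : Coef N :=
  ∑ τ₁, ∑ τ₂, ((cc τ₁ * cc τ₂ : ℝ) : ℂ) •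
    bil (m τ₁ τ₂) (psi σ τ₁ τ₂) t (x (σ == τ₁)) (y (σ == τ₂))

/-- The multiplier `1`. -/
def mone (N : ℕ) (_ _ : Bool) (_ _ : ZMod (2 * N)) : ℂ := 1

/-- The multiplier of `-i ∇_h`. -/
def mq (N : ℕ) (_ _ : Bool) (k _ : ZMod (2 * N)) : ℂ := qSym k

variable {cc : Bool → ℝ} {m : Bool → Bool → ZMod (2 * N) → ZMod (2 * N) → ℂ}

lemma norm_coupling_le (hcc : ∀ τ, |cc τ| ≤ 1) (τ₁ τ₂ : Bool) :
    ‖((cc τ₁ * cc τ₂ : ℝ) : ℂ)‖ ≤ 1 := by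
  rw [Complex.norm_real, Real.norm_eq_abs, abs_mul]
  exact mul_le_one₀ (hcc _) (abs_nonneg _) (hcc _)

lemma norm_quad_le (hcc : ∀ τ, |cc τ| ≤ 1) (σ : Bool) (t : ℝ) (x y : Bool → Coef N) {b : ℝ}
    (h : ∀ τ₁ τ₂, ‖bil (m τ₁ τ₂) (psi σ τ₁ τ₂) t (x (σ == τ₁)) (y (σ == τ₂))‖ ≤ b) :
    ‖quad cc m σ t x y‖ ≤ 4 * b := by
  have h1 : ∀ τ₁ τ₂, ‖((cc τ₁ * cc τ₂ : ℝ) : ℂ) •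
      bil (m τ₁ τ₂) (psi σ τ₁ τ₂) t (x (σ == τ₁)) (y (σ == τ₂))‖ ≤ b := fun τ₁ τ₂ => by
    rw [norm_smul]
    exact (mul_le_of_le_one_left (norm_nonneg _) (norm_coupling_le hcc _ _)).trans (h _ _)
  calc ‖quad cc m σ t x y‖ ≤ ∑ _τ₁ : Bool, ∑ _τ₂ : Bool, b :=
        (norm_sum_le _ _).trans (Finset.sum_le_sum fun τ₁ _ =>
          (norm_sum_le _ _).trans (Finset.sum_le_sum fun τ₂ _ => h1 τ₁ τ₂))
    _ = 4 * b := by simp; ring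

lemma l1_quad_le (hcc : ∀ τ, |cc τ| ≤ 1) (σ : Bool) (t : ℝ) (x y : Bool → Coef N) {b : ℝ}
    (h : ∀ τ₁ τ₂, l1 (bil (m τ₁ τ₂) (psi σ τ₁ τ₂) t (x (σ == τ₁)) (y (σ == τ₂))) ≤ b) :
    l1 (quad cc m σ t x y) ≤ 4 * b := by
  have h1 : ∀ τ₁ τ₂, l1 (((cc τ₁ * cc τ₂ : ℝ) : ℂ) •
      bil (m τ₁ τ₂) (psi σ τ₁ τ₂) t (x (σ == τ₁)) (y (σ == τ₂))) ≤ b := fun τ₁ τ₂ => by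
    rw [l1_smul]
    exact (mul_le_of_le_one_left (l1_nonneg _) (norm_coupling_le hcc _ _)).trans (h _ _)
  unfold quad
  simp only [Fintype.sum_bool]
  refine (l1_add_le _ _).trans ?_
  have e1 := l1_add_le (((cc true * cc true : ℝ) : ℂ) •
      bil (m true true) (psi σ true true) t (x (σ == true)) (y (σ == true)))
      (((cc true * cc false : ℝ) : ℂ) •
      bil (m true false) (psi σ true false) t (x (σ == true)) (y (σ == false)))
  have e2 := l1_add_le (((cc false * cc true : ℝ) : ℂ) •
      bil (m false true) (psi σ false true) t (x (σ == false)) (y (σ == true)))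
      (((cc false * cc false : ℝ) : ℂ) •
      bil (m false false) (psi σ false false) t (x (σ == false)) (y (σ == false)))
  linarith [h1 true true, h1 true false, h1 false true, h1 false false]

lemma quad_sub_left (σ : Bool) (t : ℝ) (x x' y : Bool → Coef N) :
    quad cc m σ t (fun τ => x τ - x' τ) y = quad cc m σ t x y - quad cc m σ t x' y := by
  simp only [quad, bil_sub_left, smul_sub, Finset.sum_sub_distrib]

lemma quad_add_right (σ : Bool) (t : ℝ) (x y y' : Bool → Coef N) :
    quad cc m σ t x (fun τ => y τ + y' τ) = quad cc m σ t x y + quad cc m σ t x y' := by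
  simp only [quad, bil_add_right, smul_add, Finset.sum_add_distrib]

lemma bil_swap (ψ ψ' : ZMod (2 * N) → ZMod (2 * N) → ℝ) (n : ZMod (2 * N) → ℂ)
    (h : ∀ k l, ψ k (k - l) = ψ' k l) (t : ℝ) (x y : Coef N) :
    bil (fun k _ => n k) ψ t x y = bil (fun k _ => n k) ψ' t y x := by
  ext k
  rw [bil_apply, bil_apply, ← sum_sub_left k]
  refine Finset.sum_congr rfl fun l _ => ?_
  rw [h, sub_sub_cancel]; ring

lemma quad_mone_comm (σ : Bool) (t : ℝ) (x y : Bool → Coef N) :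
    quad cc (mone N) σ t x y = quad cc (mone N) σ t y x := by
  unfold quad
  rw [Finset.sum_comm]
  refine Finset.sum_congr rfl fun τ₁ _ => Finset.sum_congr rfl fun τ₂ _ => ?_
  rw [mul_comm (cc τ₂) (cc τ₁)]
  congr 1
  exact bil_swap _ _ (fun _ => 1) (fun k l => psi_swap σ τ₂ τ₁ k l) t _ _

lemma bil_mq_apply (ψ : ZMod (2 * N) → ZMod (2 * N) → ℝ) (τ₁ τ₂ : Bool) (t : ℝ) (x y : Coef N)
    (k : ZMod (2 * N)) :
    bil (mq N τ₁ τ₂) ψ t x y k = qSym k * bil (mone N τ₁ τ₂) ψ t x y k := by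
  rw [bil_apply, bil_apply, Finset.mul_sum]
  refine Finset.sum_congr rfl fun l _ => ?_
  rw [mq, mone]; ring

lemma quad_mq_apply (σ : Bool) (t : ℝ) (x y : Bool → Coef N) (k : ZMod (2 * N)) :
    quad cc (mq N) σ t x y k = qSym k * quad cc (mone N) σ t x y k := by
  simp only [quad, Fintype.sum_bool, PiLp.add_apply, PiLp.smul_apply, bil_mq_apply, smul_eq_mul]
  ring

lemma continuous_quad {x y : Bool → ℝ → Coef N} (hx : ∀ τ, Continuous (x τ))
    (hy : ∀ τ, Continuous (y τ)) (σ : Bool) :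
    Continuous fun t => quad cc m σ t (fun τ => x τ t) (fun τ => y τ t) :=
  continuous_finsetSum _ fun τ₁ _ => continuous_finsetSum _ fun τ₂ _ =>
    (continuous_bil (hx _) (hy _)).fun_const_smul _

lemma hasDerivAt_quad {x y : Bool → ℝ → Coef N} {x' y' : Bool → Coef N} {t : ℝ}
    (hx : ∀ τ, HasDerivAt (x τ) (x' τ) t) (hy : ∀ τ, HasDerivAt (y τ) (y' τ) t) (σ : Bool) :
    HasDerivAt (fun t => quad cc m σ t (fun τ => x τ t) (fun τ => y τ t))
      (quad cc (fun τ₁ τ₂ k l => m τ₁ τ₂ k l * (Complex.I * psi σ τ₁ τ₂ k l)) σ t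
        (fun τ => x τ t) (fun τ => y τ t) + quad cc m σ t x' (fun τ => y τ t) +
        quad cc m σ t (fun τ => x τ t) y') t := by
  unfold quad
  simp only [← Finset.sum_add_distrib, ← smul_add]
  exact HasDerivAt.fun_sum fun τ₁ _ => HasDerivAt.fun_sum fun τ₂ _ =>
    (hasDerivAt_bil (hx _) (hy _)).fun_const_smul _

/-- The algebra of the normal form: differentiating the phases in the boundary term reproduces the
high part of the equation. -/
lemma quad_mlow_add (M : ℕ) (σ : Bool) (t : ℝ) (x y : Bool → Coef N) :
    quad cc (fun _ _ => mlow M) σ t x y +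
      quad cc (fun τ₁ τ₂ k l => mhi M σ τ₁ τ₂ k l * (Complex.I * psi σ τ₁ τ₂ k l)) σ t x y =
      quad cc (mq N) σ t x y := by
  unfold quad
  simp only [← Finset.sum_add_distrib, ← smul_add]
  refine Finset.sum_congr rfl fun τ₁ _ => Finset.sum_congr rfl fun τ₂ _ => ?_
  congr 1
  ext k
  simp only [PiLp.add_apply, bil_apply, ← Finset.sum_add_distrib]
  refine Finset.sum_congr rfl fun l _ => ?_
  rw [mq, ← mlow_add_mhi M σ τ₁ τ₂ k l]; ring

/-- Strichartz estimate for the quadratic interaction. -/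
lemma integral_norm_quad_sq_le (hcc : ∀ τ, |cc τ| ≤ 1) (σ : Bool) {T ξ η : ℝ}
    {x y : Bool → ℝ → Coef N} (hT : 0 ≤ T) (hT1 : T ≤ 1) (hx : ∀ τ, XB T (x τ) ξ)
    (hy : ∀ τ, XB T (y τ) η) (hxc : ∀ τ, Continuous (x τ)) (hyc : ∀ τ, Continuous (y τ)) :
    ∫ t in (0 : ℝ)..T, ‖quad cc (mone N) σ t (fun τ => x τ t) (fun τ => y τ t)‖ ^ 2 ≤
      (2000 * (ξ * η)) ^ 2 := by
  set f : Bool → Bool → ℝ → ℝ := fun τ₁ τ₂ t =>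
    ‖bil (mone N τ₁ τ₂) (psi σ τ₁ τ₂) t (x (σ == τ₁) t) (y (σ == τ₂) t)‖ ^ 2 with hf
  have hfc : ∀ τ₁ τ₂, Continuous (f τ₁ τ₂) := fun τ₁ τ₂ =>
    (continuous_bil (hxc _) (hyc _)).norm.pow 2
  have hfi : ∀ τ₁ τ₂, ∫ t in (0 : ℝ)..T, f τ₁ τ₂ t ≤ (500 * (ξ * η)) ^ 2 := fun τ₁ τ₂ =>
    XB.integral_norm_bil_sq_le (fun _ _ => by simp [mone]) σ τ₁ τ₂ hT hT1 (hx _) (hy _)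
      (hxc _) (hyc _)
  have hpt : ∀ t ∈ Set.Icc 0 T,
      ‖quad cc (mone N) σ t (fun τ => x τ t) (fun τ => y τ t)‖ ^ 2 ≤
      4 * ∑ τ₁, ∑ τ₂, f τ₁ τ₂ t := fun t _ => by
    have h1 : ‖quad cc (mone N) σ t (fun τ => x τ t) (fun τ => y τ t)‖ ≤ ∑ τ₁, ∑ τ₂,
        ‖bil (mone N τ₁ τ₂) (psi σ τ₁ τ₂) t (x (σ == τ₁) t) (y (σ == τ₂) t)‖ := by
      refine (norm_sum_le _ _).trans (Finset.sum_le_sum fun τ₁ _ =>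
          (norm_sum_le _ _).trans (Finset.sum_le_sum fun τ₂ _ => ?_))
      rw [norm_smul]
      exact mul_le_of_le_one_left (norm_nonneg _) (norm_coupling_le hcc _ _)
    have h2 := pow_le_pow_left₀ (norm_nonneg _) h1 2
    refine h2.trans ?_
    simp only [Fintype.sum_bool, hf]
    generalize ‖bil (mone N true true) (psi σ true true) t (x (σ == true) t) (y (σ == true) t)‖ = a
    generalize ‖bil (mone N true false) (psi σ true false) t (x (σ == true) t)
      (y (σ == false) t)‖ = b
    generalize ‖bil (mone N false true) (psi σ false true) t (x (σ == false) t)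
      (y (σ == true) t)‖ = c
    generalize ‖bil (mone N false false) (psi σ false false) t (x (σ == false) t)
      (y (σ == false) t)‖ = d
    nlinarith [sq_nonneg (a - b), sq_nonneg (a - c), sq_nonneg (a - d), sq_nonneg (b - c),
      sq_nonneg (b - d), sq_nonneg (c - d)]
  have c0 : Continuous fun t => 4 * ∑ τ₁, ∑ τ₂, f τ₁ τ₂ t := continuous_const.mul
    (continuous_finsetSum _ fun τ₁ _ => continuous_finsetSum _ fun τ₂ _ => hfc τ₁ τ₂)
  refine (intervalIntegral.integral_mono_on hT
    (((continuous_quad hxc hyc σ).norm.pow 2).intervalIntegrable _ _)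
    (c0.intervalIntegrable _ _) hpt).trans ?_
  rw [intervalIntegral.integral_const_mul, intervalIntegral.integral_finsetSum fun τ₁ _ =>
    (continuous_finsetSum _ fun τ₂ _ => hfc τ₁ τ₂).intervalIntegrable _ _]
  have h3 : ∑ τ₁, ∫ t in (0 : ℝ)..T, ∑ τ₂, f τ₁ τ₂ t = ∑ τ₁, ∑ τ₂, ∫ t in (0 : ℝ)..T, f τ₁ τ₂ t :=
    Finset.sum_congr rfl fun τ₁ _ => intervalIntegral.integral_finsetSum fun τ₂ _ =>
      (hfc τ₁ τ₂).intervalIntegrable _ _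
  rw [h3]
  simp only [Fintype.sum_bool]
  nlinarith [hfi true true, hfi true false, hfi false true, hfi false false]

/-- Normal form estimate for the solution of a linear equation with a quadratic interaction. -/
theorem XB_of_quad (hcc : ∀ τ, |cc τ| ≤ 1) {κ : Bool → ℂ} (hκ : ∀ σ, ‖κ σ‖ ≤ 1)
    {d s gd gs Fs H : Bool → ℝ → Coef N} (hd : ∀ σ t, HasDerivAt (d σ) (gd σ t) t)
    (hgd : ∀ σ, Continuous (gd σ)) (hs : ∀ σ t, HasDerivAt (s σ) (gs σ t) t)
    (hgs : ∀ σ, Continuous (gs σ)) (hFs : ∀ σ, Continuous (Fs σ)) (hH : ∀ σ, Continuous (H σ))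
    {T D S Φd Φs η d₀ : ℝ} (hT : 0 ≤ T)
    (hd0 : ∀ σ, ∀ t ∈ Set.Icc 0 T, d σ t 0 = 0) (hs0 : ∀ σ, ∀ t ∈ Set.Icc 0 T, s σ t 0 = 0)
    (heq : ∀ σ, ∀ t ∈ Set.Icc 0 T,
      gd σ t = κ σ • quad cc (mq N) σ t (fun τ => d τ t) (fun τ => s τ t) + H σ t)
    (hgsF : ∀ σ, ∀ t ∈ Set.Icc 0 T, ∀ k, k ≠ 0 → ‖gs σ t k‖ ≤ ab k * ‖Fs σ t k‖)
    (hD : ∀ σ, ∀ t ∈ Set.Icc 0 T, ‖d σ t‖ ≤ D) (hS : ∀ σ, ∀ t ∈ Set.Icc 0 T, ‖s σ t‖ ≤ S)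
    (hΦd0 : 0 ≤ Φd) (hΦs0 : 0 ≤ Φs)
    (hΦd : ∀ σ, ∫ t in (0 : ℝ)..T,
      ‖quad cc (mone N) σ t (fun τ => d τ t) (fun τ => s τ t)‖ ^ 2 ≤ Φd ^ 2)
    (hΦs : ∀ σ, ∫ t in (0 : ℝ)..T, ‖Fs σ t‖ ^ 2 ≤ Φs ^ 2)
    (hη : ∀ σ, ∫ t in (0 : ℝ)..T, ‖H σ t‖ ≤ η) (hinit : ∀ σ, ‖d σ 0‖ ≤ d₀) (M : ℕ) (σ : Bool) :
    XB T (d σ) (d₀ + 40000 / √((M : ℝ) + 1) * (D * S) + 16 * (M : ℝ) ^ 2 * T * (D * S) +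
      20000 * √T * (Φd * S + D * Φs) + (1 + 20000 * S) * η) := by
  have h0T : (0 : ℝ) ∈ Set.Icc 0 T := ⟨le_rfl, hT⟩
  have hD0 : 0 ≤ D := (norm_nonneg _).trans (hD true 0 h0T)
  have hS0 : 0 ≤ S := (norm_nonneg _).trans (hS true 0 h0T)
  have hd₀ : 0 ≤ d₀ := (norm_nonneg _).trans (hinit true)
  have hη0 : 0 ≤ η := (intervalIntegral.integral_nonneg hT fun _ _ => norm_nonneg _).trans (hη true)
  have hdc := fun σ => continuous_of_hasDerivAt (hd σ)
  have hsc := fun σ => continuous_of_hasDerivAt (hs σ)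
  set F : Bool → ℝ → Coef N := fun σ t =>
    quad cc (mone N) σ t (fun τ => d τ t) (fun τ => s τ t) with hF
  have hFc : ∀ σ, Continuous (F σ) := fun σ => continuous_quad hdc hsc σ
  -- The boundary term B is the ℓ¹ part of d, and d - B the part of bounded variation.
  set B : ℝ → Coef N := fun t =>
    κ σ • quad cc (mhi M σ) σ t (fun τ => d τ t) (fun τ => s τ t) with hB
  have hBl : ∀ t ∈ Set.Icc 0 T, l1 (B t) ≤ 38400 / √((M : ℝ) + 1) * (D * S) := fun t ht => by
    rw [hB, l1_smul]
    refine (mul_le_of_le_one_left (l1_nonneg _) (hκ σ)).trans ?_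
    refine (l1_quad_le hcc σ t _ _ (b := 9600 / √((M : ℝ) + 1) * (D * S)) fun τ₁ τ₂ => ?_).trans
      (le_of_eq (by ring))
    refine (l1_bil_mhi_le M σ τ₁ τ₂ t _ _).trans ?_
    have := hD (σ == τ₁) t ht
    have := hS (σ == τ₂) t ht
    gcongr
  set g : ℝ → Coef N := fun t => gd σ t - κ σ •
    (quad cc (fun τ₁ τ₂ k l => mhi M σ τ₁ τ₂ k l * (Complex.I * psi σ τ₁ τ₂ k l)) σ t
      (fun τ => d τ t) (fun τ => s τ t) + quad cc (mhi M σ) σ t (fun τ => gd τ t) (fun τ => s τ t) +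
      quad cc (mhi M σ) σ t (fun τ => d τ t) (fun τ => gs τ t)) with hg
  have hgc : Continuous g := (hgd σ).fun_sub ((((continuous_quad hdc hsc σ).fun_add
    (continuous_quad hgd hsc σ)).fun_add (continuous_quad hdc hgs σ)).fun_const_smul _)
  have hder : ∀ t, HasDerivAt (fun t => d σ t - B t) (g t) t := fun t =>
    (hd σ t).fun_sub ((hasDerivAt_quad (fun τ => hd τ t) (fun τ => hs τ t) σ).fun_const_smul _)
  have hgpt : ∀ t ∈ Set.Icc 0 T, ‖g t‖ ≤ 16 * (M : ℝ) ^ 2 * (D * S) + (‖H σ t‖ +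
      (9600 * S * ((‖F true t‖ + ‖F false t‖) + (‖H true t‖ + ‖H false t‖)) +
      9600 * D * (‖Fs true t‖ + ‖Fs false t‖))) := fun t ht => by
    -- The high interactions cancel. What remains are low interactions, the source, and the normal
    -- form with a time derivative on one of its factors.
    have e : g t = κ σ • quad cc (fun _ _ => mlow M) σ t (fun τ => d τ t) (fun τ => s τ t) +
        H σ t - (κ σ • quad cc (mhi M σ) σ t (fun τ => gd τ t) (fun τ => s τ t) +
        κ σ • quad cc (mhi M σ) σ t (fun τ => d τ t) (fun τ => gs τ t)) := by
      rw [hg]; dsimp only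
      rw [heq σ t ht, ← quad_mlow_add M, smul_add, smul_add, smul_add]
      abel
    have n1 : ‖quad cc (fun _ _ => mlow M) σ t (fun τ => d τ t) (fun τ => s τ t)‖ ≤
        4 * (4 * (M : ℝ) ^ 2 * (D * S)) := norm_quad_le hcc σ t _ _ fun τ₁ τ₂ => by
      refine (norm_bil_mlow_le M _ t (hd0 _ t ht) (hs0 _ t ht)).trans ?_
      have := hD (σ == τ₁) t ht
      have := hS (σ == τ₂) t ht
      gcongr
    have bF : ∀ τ, ‖F τ t‖ ≤ ‖F true t‖ + ‖F false t‖ := fun τ => by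
      cases τ <;> linarith [norm_nonneg (F true t), norm_nonneg (F false t)]
    have bH : ∀ τ, ‖H τ t‖ ≤ ‖H true t‖ + ‖H false t‖ := fun τ => by
      cases τ <;> linarith [norm_nonneg (H true t), norm_nonneg (H false t)]
    have bs : ∀ τ, ‖Fs τ t‖ ≤ ‖Fs true t‖ + ‖Fs false t‖ := fun τ => by
      cases τ <;> linarith [norm_nonneg (Fs true t), norm_nonneg (Fs false t)]
    -- Substitute the equation for the derivative of d: its quadratic part is a derivative of F, and
    -- H satisfies the same hypothesis because nonzero frequencies are at least 1.
    have n2 : ‖quad cc (mhi M σ) σ t (fun τ => gd τ t) (fun τ => s τ t)‖ ≤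
        4 * (2400 * (((‖F true t‖ + ‖F false t‖) + (‖H true t‖ + ‖H false t‖)) * S)) :=
      norm_quad_le hcc σ t _ _ fun τ₁ τ₂ => by
      have ht1 := heq (σ == τ₁) t ht
      rw [ht1, bil_add_left]
      refine (norm_add_le _ _).trans ?_
      have i1 := norm_bil_mhi_le_left M σ τ₁ τ₂ t (F := F (σ == τ₁) t)
        (x := κ (σ == τ₁) • quad cc (mq N) (σ == τ₁) t (fun τ => d τ t) (fun τ => s τ t))
        (y := s (σ == τ₂) t) (fun k _ => by
          rw [PiLp.smul_apply, norm_smul, quad_mq_apply, norm_mul, Complex.norm_real,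
            Real.norm_eq_abs]
          refine (mul_le_of_le_one_left (by positivity) (hκ _)).trans ?_
          gcongr
          exact abs_qSym_le k)
      have i2 := norm_bil_mhi_le_left M σ τ₁ τ₂ t (F := H (σ == τ₁) t)
        (x := H (σ == τ₁) t) (y := s (σ == τ₂) t)
        (fun k hk => le_mul_of_one_le_left (norm_nonneg _) (one_le_ab hk))
      have i3 := hS (σ == τ₂) t ht
      have i4 := bF (σ == τ₁)
      have i5 := bH (σ == τ₁)
      calc _ ≤ 2400 * (‖F (σ == τ₁) t‖ * ‖s (σ == τ₂) t‖) +
            2400 * (‖H (σ == τ₁) t‖ * ‖s (σ == τ₂) t‖) := add_le_add i1 i2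
        _ ≤ 2400 * ((‖F true t‖ + ‖F false t‖) * S) +
            2400 * ((‖H true t‖ + ‖H false t‖) * S) := by gcongr
        _ = _ := by ring
    have n3 : ‖quad cc (mhi M σ) σ t (fun τ => d τ t) (fun τ => gs τ t)‖ ≤
        4 * (2400 * (D * (‖Fs true t‖ + ‖Fs false t‖))) :=
      norm_quad_le hcc σ t _ _ fun τ₁ τ₂ => by
      refine (norm_bil_mhi_le_right M σ τ₁ τ₂ t (hgsF (σ == τ₂) t ht)).trans ?_
      have i3 := hD (σ == τ₁) t ht
      have i4 := bs (σ == τ₂)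
      gcongr
    have kk : ∀ v : Coef N, ‖κ σ • v‖ ≤ ‖v‖ := fun v => by
      rw [norm_smul]; exact mul_le_of_le_one_left (norm_nonneg _) (hκ σ)
    rw [e]
    refine (norm_sub_le _ _).trans ?_
    have m1 := norm_add_le (κ σ • quad cc (fun _ _ => mlow M) σ t (fun τ => d τ t)
      (fun τ => s τ t)) (H σ t)
    have m2 := norm_add_le (κ σ • quad cc (mhi M σ) σ t (fun τ => gd τ t) (fun τ => s τ t))
      (κ σ • quad cc (mhi M σ) σ t (fun τ => d τ t) (fun τ => gs τ t))
    have k1 := (kk _).trans n1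
    have k2 := (kk _).trans n2
    have k3 := (kk _).trans n3
    linarith
  have iF : ∀ τ, ∫ t in (0 : ℝ)..T, ‖F τ t‖ ≤ √T * Φd := fun τ =>
    integral_norm_le_sqrt (hFc τ) hT hΦd0 (hΦd τ)
  have iFs : ∀ τ, ∫ t in (0 : ℝ)..T, ‖Fs τ t‖ ≤ √T * Φs := fun τ =>
    integral_norm_le_sqrt (hFs τ) hT hΦs0 (hΦs τ)
  have hgi : ∫ t in (0 : ℝ)..T, ‖g t‖ ≤ 16 * (M : ℝ) ^ 2 * T * (D * S) +
      20000 * √T * (Φd * S + D * Φs) + (1 + 20000 * S) * η := by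
    have c1 : Continuous fun t => ‖F true t‖ + ‖F false t‖ := (hFc true).norm.add (hFc false).norm
    have c2 : Continuous fun t => ‖H true t‖ + ‖H false t‖ := (hH true).norm.add (hH false).norm
    have c3 : Continuous fun t => ‖Fs true t‖ + ‖Fs false t‖ :=
      (hFs true).norm.add (hFs false).norm
    have c4 : Continuous fun t => (‖F true t‖ + ‖F false t‖) + (‖H true t‖ + ‖H false t‖) :=
      c1.add c2
    have c5 : Continuous fun t =>
      9600 * S * ((‖F true t‖ + ‖F false t‖) + (‖H true t‖ + ‖H false t‖)) :=
      continuous_const.mul c4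
    have c6 : Continuous fun t => 9600 * D * (‖Fs true t‖ + ‖Fs false t‖) :=
      continuous_const.mul c3
    have c7 : Continuous fun t =>
      9600 * S * ((‖F true t‖ + ‖F false t‖) + (‖H true t‖ + ‖H false t‖)) +
      9600 * D * (‖Fs true t‖ + ‖Fs false t‖) := c5.add c6
    have c8 : Continuous fun t => ‖H σ t‖ +
      (9600 * S * ((‖F true t‖ + ‖F false t‖) + (‖H true t‖ + ‖H false t‖)) +
      9600 * D * (‖Fs true t‖ + ‖Fs false t‖)) := (hH σ).norm.add c7
    have c9 : Continuous fun t => 16 * (M : ℝ) ^ 2 * (D * S) + (‖H σ t‖ +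
      (9600 * S * ((‖F true t‖ + ‖F false t‖) + (‖H true t‖ + ‖H false t‖)) +
      9600 * D * (‖Fs true t‖ + ‖Fs false t‖))) := continuous_const.add c8
    refine (intervalIntegral.integral_mono_on hT (hgc.norm.intervalIntegrable _ _)
      (c9.intervalIntegrable _ _) hgpt).trans ?_
    rw [intervalIntegral.integral_add (continuous_const.intervalIntegrable _ _)
        (c8.intervalIntegrable _ _), intervalIntegral.integral_const,
      intervalIntegral.integral_add ((hH σ).norm.intervalIntegrable _ _)
        (c7.intervalIntegrable _ _),
      intervalIntegral.integral_add (c5.intervalIntegrable _ _) (c6.intervalIntegrable _ _),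
      intervalIntegral.integral_const_mul, intervalIntegral.integral_const_mul,
      intervalIntegral.integral_add (c1.intervalIntegrable _ _) (c2.intervalIntegrable _ _),
      intervalIntegral.integral_add ((hF ▸ hFc true).norm.intervalIntegrable _ _)
        ((hFc false).norm.intervalIntegrable _ _),
      intervalIntegral.integral_add ((hH true).norm.intervalIntegrable _ _)
        ((hH false).norm.intervalIntegrable _ _),
      intervalIntegral.integral_add ((hFs true).norm.intervalIntegrable _ _)
        ((hFs false).norm.intervalIntegrable _ _), sub_zero, smul_eq_mul]
    have j1 : 9600 * S * ((∫ t in (0 : ℝ)..T, ‖F true t‖) + (∫ t in (0 : ℝ)..T, ‖F false t‖) +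
        ((∫ t in (0 : ℝ)..T, ‖H true t‖) + ∫ t in (0 : ℝ)..T, ‖H false t‖)) ≤
        9600 * S * (√T * Φd + √T * Φd + (η + η)) := by
      gcongr
      exacts [iF _, iF _, hη _, hη _]
    have j2 : 9600 * D * ((∫ t in (0 : ℝ)..T, ‖Fs true t‖) + ∫ t in (0 : ℝ)..T, ‖Fs false t‖) ≤
        9600 * D * (√T * Φs + √T * Φs) := by
      gcongr
      exacts [iFs _, iFs _]
    have hT0 : 0 ≤ √T := Real.sqrt_nonneg T
    have p1 : 0 ≤ √T * (Φd * S) := by positivity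
    have p2 : 0 ≤ √T * (D * Φs) := by positivity
    have p3 : 0 ≤ S * η := by positivity
    have := hη σ
    nlinarith
  have q1 : 0 ≤ 1 / √((M : ℝ) + 1) * (D * S) := by positivity
  have q2 : 0 ≤ 16 * (M : ℝ) ^ 2 * T * (D * S) := by positivity
  have q3 : 0 ≤ 20000 * √T * (Φd * S + D * Φs) := by positivity
  have q4 : 0 ≤ (1 + 20000 * S) * η := by positivity
  have q5 : 38400 / √((M : ℝ) + 1) * (D * S) = 38400 * (1 / √((M : ℝ) + 1) * (D * S)) := by ring
  have q6 : 40000 / √((M : ℝ) + 1) * (D * S) = 40000 * (1 / √((M : ℝ) + 1) * (D * S)) := by ring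
  refine ⟨fun t => d σ t - B t, g, hder, hgc, fun t ht => ?_, ?_, ?_⟩
  · rw [sub_sub_cancel]
    refine (hBl t ht).trans ?_
    rw [q5, q6]; linarith
  · refine (norm_sub_le _ _).trans ?_
    have h1 := (norm_le_l1 _).trans (hBl 0 h0T)
    rw [q5] at h1; rw [q6]
    linarith [hinit σ]
  · rw [q6]; linarith

end quad

/-! ### Closing the estimates on a short time interval -/

lemma exists_small_time (A : ℝ) {ε : ℝ} (hε : 0 < ε) :
    ∃ (M : ℕ) (T₀ : ℝ), 0 < T₀ ∧ T₀ ≤ 1 ∧ ∀ T, 0 ≤ T → T ≤ T₀ →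
      40000 / √((M : ℝ) + 1) * A + 16 * (M : ℝ) ^ 2 * T * A + 20000 * √T * A ≤ ε := by
  have t1 : Filter.Tendsto (fun M : ℕ => 40000 / √((M : ℝ) + 1) * A) Filter.atTop (nhds 0) := by
    have h : Filter.Tendsto (fun M : ℕ => √((M : ℝ) + 1)) Filter.atTop Filter.atTop :=
      Real.tendsto_sqrt_atTop.comp
        (Filter.tendsto_atTop_add_const_right _ _ tendsto_natCast_atTop_atTop)
    simpa using (h.const_div_atTop 40000).mul_const A
  -- The boundary term does not improve with time, so M is fixed first; the terms growing with M are
  -- then made small by T.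
  obtain ⟨M, hM⟩ := (t1.eventually (gt_mem_nhds (half_pos hε))).exists
  have c : Continuous fun T : ℝ => 16 * (M : ℝ) ^ 2 * T * A + 20000 * √T * A := by fun_prop
  have t2 := (c.tendsto 0).eventually
    (gt_mem_nhds (show 16 * (M : ℝ) ^ 2 * 0 * A + 20000 * √0 * A < ε / 2 by simp [hε]))
  obtain ⟨δ, hδ, hb⟩ := Metric.eventually_nhds_iff.1 t2
  refine ⟨M, min (δ / 2) 1, by positivity, min_le_right _ _, fun T hT hT0 => ?_⟩
  have h1 : T ≤ δ / 2 := hT0.trans (min_le_left _ _)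
  have := hb (y := T) (by rw [Real.dist_eq, sub_zero, abs_of_nonneg hT]; linarith)
  linarith

/-- Continuity argument for finitely many continuous quantities. -/
lemma lt_of_bootstrap {ι : Type*} [Finite ι] {f : ι → ℝ → ℝ} {b : ι → ℝ} {T : ℝ}
    (hf : ∀ i, Continuous (f i)) (h0 : ∀ i, f i 0 < b i)
    (h : ∀ t ∈ Set.Icc 0 T, (∀ r ∈ Set.Icc 0 t, ∀ i, f i r ≤ b i) → ∀ i, f i t < b i) :
    ∀ t ∈ Set.Icc 0 T, ∀ i, f i t < b i := by
  by_contra hcon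
  push Not at hcon
  -- The bad times form a compact set. At its least element all bounds still hold in the weak sense,
  -- so the improvement contradicts badness.
  set B : Set ℝ := Set.Icc 0 T ∩ ⋃ i, {t | b i ≤ f i t} with hB
  have hBc : IsCompact B := isCompact_Icc.inter_right
    (isClosed_iUnion_of_finite fun i => isClosed_le continuous_const (hf i))
  have hBn : B.Nonempty := by
    obtain ⟨t, ht, i, hi⟩ := hcon
    exact ⟨t, ht, Set.mem_iUnion.2 ⟨i, hi⟩⟩
  obtain ⟨t₀, ht₀, hmin⟩ := hBc.exists_isLeast hBn
  have hlt : ∀ r ∈ Set.Ico 0 t₀, ∀ i, f i r < b i := fun r hr i => by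
    by_contra hc
    exact absurd (hmin ⟨⟨hr.1, hr.2.le.trans ht₀.1.2⟩, Set.mem_iUnion.2 ⟨i, not_lt.1 hc⟩⟩)
      (not_le.2 hr.2)
  have hpos : 0 < t₀ := by
    rcases ht₀.1.1.eq_or_lt with h1 | h1
    · obtain ⟨i, hi⟩ := Set.mem_iUnion.1 ht₀.2
      rw [← h1] at hi
      exact absurd (h0 i) (not_lt.2 hi)
    · exact h1
  have hle : ∀ i, f i t₀ ≤ b i := fun i => by
    refine le_of_tendsto (((hf i).tendsto t₀).mono_left (nhdsWithin_le_nhds (s := Set.Iio t₀))) ?_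
    filter_upwards [Ioo_mem_nhdsLT hpos] with r hr
    exact (hlt r ⟨hr.1.le, hr.2⟩ i).le
  obtain ⟨i, hi⟩ := Set.mem_iUnion.1 ht₀.2
  refine absurd (h t₀ ht₀.1 (fun r hr j => ?_) i) (not_lt.2 hi)
  rcases hr.2.eq_or_lt with h1 | h1
  · rw [h1]; exact hle j
  · exact (hlt r ⟨hr.1, h1⟩ j).le

section
variable {N : ℕ} [NeZero N]

/-- Applied at the zero mode: the nonlinearity is a derivative, so the mean stays zero. -/
lemma apply_eq_of_hasDerivAt {a g : ℝ → Coef N} (ha : ∀ t, HasDerivAt a (g t) t)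
    (hg : Continuous g) (k : ZMod (2 * N)) {t : ℝ} (ht : 0 ≤ t)
    (h : ∀ r ∈ Set.Icc 0 t, g r k = 0) : a t k = a 0 k := by
  have hd : ∀ r, HasDerivAt (fun r => a r k) (g r k) r := fun r => hasDerivAt_coef.1 (ha r) k
  have h1 : ∫ s in (0 : ℝ)..t, g s k = a t k - a 0 k :=
    intervalIntegral.integral_eq_sub_of_hasDerivAt (fun s _ => hd s)
      ((continuous_coef.1 hg k).intervalIntegrable _ _)
  have h2 : ∫ s in (0 : ℝ)..t, g s k = 0 := by
    rw [intervalIntegral.integral_congr (g := fun _ => (0 : ℂ)) fun s hs => ?_]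
    · simp
    · rw [Set.uIcc_of_le ht] at hs; exact h s hs
  rw [h2] at h1
  exact (sub_eq_zero.1 h1.symm)

lemma norm_smul_quad_mq_apply_le {cc : Bool → ℝ} {c : ℂ} (hc : ‖c‖ ≤ 1) (σ : Bool) (t : ℝ)
    (x y : Bool → Coef N) (k : ZMod (2 * N)) :
    ‖(c • quad cc (mq N) σ t x y) k‖ ≤ ab k * ‖quad cc (mone N) σ t x y k‖ := by
  rw [PiLp.smul_apply, norm_smul, quad_mq_apply, norm_mul, Complex.norm_real, Real.norm_eq_abs]
  refine (mul_le_of_le_one_left (by positivity) hc).trans ?_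
  gcongr
  exact abs_qSym_le k

lemma smul_quad_mq_apply_zero (cc : Bool → ℝ) (c : ℂ) (σ : Bool) (t : ℝ) (x y : Bool → Coef N) :
    (c • quad cc (mq N) σ t x y) 0 = 0 := by
  rw [PiLp.smul_apply, quad_mq_apply, qSym_zero]; simp

end

/-- A priori estimate for the nonlinear system. The equation is only assumed as long as the
solution does not exceed a certain size. -/
theorem exists_a_priori {R : ℝ} (hR : 0 < R) : ∃ T₀ : ℝ, 0 < T₀ ∧ T₀ ≤ 1 ∧
    ∀ (N : ℕ) [NeZero N] (cc : Bool → ℝ), (∀ τ, |cc τ| ≤ 1) → ∀ κ : Bool → ℂ, (∀ σ, ‖κ σ‖ ≤ 1) →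
    ∀ a g : Bool → ℝ → Coef N, (∀ σ t, HasDerivAt (a σ) (g σ t) t) → (∀ σ, Continuous (g σ)) →
    ∀ T, 0 ≤ T → T ≤ T₀ →
    (∀ t ∈ Set.Icc 0 T, (∀ σ, ‖a σ t‖ ≤ 7 * R) → ∀ σ,
      g σ t = κ σ • quad cc (mq N) σ t (fun τ => a τ t) (fun τ => a τ t)) →
    (∀ σ, a σ 0 0 = 0) → (∀ σ, ‖a σ 0‖ ≤ R) →
    (∀ σ, ∀ t ∈ Set.Icc 0 T, ‖a σ t‖ ≤ 7 * R) ∧ (∀ σ, ∀ t ∈ Set.Icc 0 T, a σ t 0 = 0) ∧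
      ∀ σ, XB T (a σ) (2 * R) := by
  -- With D = S = 7R and Φ = 9000R² in `XB_of_quad`: D · S = 49R² and Φ · S + D · Φ = 126000R³.
  obtain ⟨M, T₀, hT₀, hT₀1, hsmall⟩ := exists_small_time (49 * R ^ 2 + 126000 * R ^ 3) hR
  refine ⟨T₀, hT₀, hT₀1, ?_⟩
  intro N _ cc hcc κ hκ a g ha hg T hT hTT heq ha0 haR
  have hac := fun σ => continuous_of_hasDerivAt (ha σ)
  set F : Bool → ℝ → Coef N := fun σ t =>
    quad cc (mone N) σ t (fun τ => a τ t) (fun τ => a τ t) with hF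
  have hFc : ∀ σ, Continuous (F σ) := fun σ => continuous_quad hac hac σ
  have hIc : ∀ σ, Continuous fun t => ∫ r in (0 : ℝ)..t, ‖F σ r‖ ^ 2 := fun σ =>
    intervalIntegral.continuous_primitive
      (fun _ _ => ((hFc σ).norm.pow 2).intervalIntegrable _ _) 0
  have hzero : ∀ t ∈ Set.Icc 0 T, (∀ r ∈ Set.Icc 0 t, ∀ σ, ‖a σ r‖ ≤ 7 * R) → ∀ σ,
      a σ t 0 = 0 := fun t ht h σ => by
    rw [apply_eq_of_hasDerivAt (ha σ) (hg σ) 0 ht.1 (fun r hr => ?_), ha0]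
    rw [heq r ⟨hr.1, hr.2.trans ht.2⟩ (h r hr), smul_quad_mq_apply_zero]
  have step : ∀ t ∈ Set.Icc 0 T, (∀ r ∈ Set.Icc 0 t, ∀ σ, ‖a σ r‖ ≤ 7 * R) →
      (∀ σ, ∫ r in (0 : ℝ)..t, ‖F σ r‖ ^ 2 ≤ (9000 * R ^ 2) ^ 2) → ∀ σ, XB t (a σ) (2 * R) :=
    fun t ht h hI σ => by
    have hz : ∀ σ, ∀ r ∈ Set.Icc 0 t, a σ r 0 = 0 := fun σ r hr =>
      hzero r ⟨hr.1, hr.2.trans ht.2⟩ (fun r' hr' => h r' ⟨hr'.1, hr'.2.trans hr.2⟩) σ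
    have heq' : ∀ σ, ∀ r ∈ Set.Icc 0 t,
        g σ r = κ σ • quad cc (mq N) σ r (fun τ => a τ r) (fun τ => a τ r) + 0 := fun σ r hr => by
      rw [add_zero]; exact heq r ⟨hr.1, hr.2.trans ht.2⟩ (h r hr) σ
    have key := XB_of_quad hcc hκ (d := a) (s := a) (gd := g) (gs := g) (Fs := F)
      (H := fun _ _ => 0) ha hg ha hg hFc (fun _ => continuous_const) ht.1 hz hz heq'
      (fun σ r hr k _ => by
        rw [heq' σ r hr, add_zero]
        exact norm_smul_quad_mq_apply_le (hκ σ) _ _ _ _ _)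
      (fun σ r hr => h r hr σ) (fun σ r hr => h r hr σ) (by positivity) (by positivity) hI hI
      (η := 0) (fun σ => by simp) haR M σ
    refine key.mono ?_
    have hs := hsmall t ht.1 (ht.2.trans hTT)
    have p1 : 0 ≤ 1 / √((M : ℝ) + 1) := by positivity
    have p2 : 0 ≤ (M : ℝ) ^ 2 * t := mul_nonneg (by positivity) ht.1
    have p3 : 0 ≤ √t := Real.sqrt_nonneg t
    have e1 : 40000 / √((M : ℝ) + 1) = 40000 * (1 / √((M : ℝ) + 1)) := by ring
    rw [e1] at hs ⊢
    generalize 1 / √((M : ℝ) + 1) = x at *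
    generalize √t = y at *
    have r3 : 0 ≤ x * R ^ 3 := by positivity
    have r4 : 0 ≤ (M : ℝ) ^ 2 * t * R ^ 3 := by positivity
    have r5 : 0 ≤ y * R ^ 2 := by positivity
    nlinarith
  have hTT1 : T ≤ 1 := hTT.trans hT₀1
  -- The norms and the L² bounds on the interaction are bootstrapped together. Size 2R in `XB`
  -- improves 7R to 6R and 9000R² to 2000 · (2R)² = 8000R².
  have hboot := lt_of_bootstrap (ι := Bool × Bool) (T := T)
    (f := fun i t => if i.1 then ‖a i.2 t‖ else ∫ r in (0 : ℝ)..t, ‖F i.2 r‖ ^ 2)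
    (b := fun i => if i.1 then 7 * R else (9000 * R ^ 2) ^ 2) (fun i => by
      rcases i with ⟨_ | _, σ⟩
      · simpa using hIc σ
      · simpa using (hac σ).norm) (fun i => by
      rcases i with ⟨_ | _, σ⟩
      · simp only [intervalIntegral.integral_same]; simp; positivity
      · simp only [if_true]; linarith [haR σ]) (fun t ht h i => by
      have h1 : ∀ r ∈ Set.Icc 0 t, ∀ σ, ‖a σ r‖ ≤ 7 * R := fun r hr σ => by
        simpa using h r hr (true, σ)
      have h2 : ∀ σ, ∫ r in (0 : ℝ)..t, ‖F σ r‖ ^ 2 ≤ (9000 * R ^ 2) ^ 2 := fun σ => by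
        simpa using h t ⟨ht.1, le_rfl⟩ (false, σ)
      have hX := step t ht h1 h2
      rcases i with ⟨_ | _, σ⟩
      · have := integral_norm_quad_sq_le hcc σ ht.1 (ht.2.trans hTT1) hX hX hac hac
        simp only [Bool.false_eq_true, if_false]
        refine this.trans_lt ?_
        have : 0 < (R ^ 2) ^ 2 := by positivity
        nlinarith
      · simp only [if_true]
        linarith [(hX σ).norm_le ⟨ht.1, le_rfl⟩])
  have h1 : ∀ r ∈ Set.Icc 0 T, ∀ σ, ‖a σ r‖ ≤ 7 * R := fun r hr σ => by
    simpa using (hboot r hr (true, σ)).le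
  refine ⟨fun σ t ht => h1 t ht σ, fun σ t ht =>
    hzero t ht (fun r hr => h1 r ⟨hr.1, hr.2.trans ht.2⟩) σ, ?_⟩
  exact step T ⟨hT, le_rfl⟩ h1 fun σ => by simpa using (hboot T ⟨hT, le_rfl⟩ (false, σ)).le

/-- Estimate for the linear equation. -/
theorem exists_linear_estimate {Λ : ℝ} (hΛ : 0 < Λ) : ∃ T₀ : ℝ, 0 < T₀ ∧ T₀ ≤ 1 ∧
    ∀ (N : ℕ) [NeZero N] (cc : Bool → ℝ), (∀ τ, |cc τ| ≤ 1) → ∀ κ : Bool → ℂ, (∀ σ, ‖κ σ‖ ≤ 1) →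
    ∀ d s gd gs Fs H : Bool → ℝ → Coef N, (∀ σ t, HasDerivAt (d σ) (gd σ t) t) →
    (∀ σ, Continuous (gd σ)) → (∀ σ t, HasDerivAt (s σ) (gs σ t) t) →
    (∀ σ, Continuous (gs σ)) → (∀ σ, Continuous (Fs σ)) → (∀ σ, Continuous (H σ)) →
    ∀ T η d₀ : ℝ, 0 ≤ T → T ≤ T₀ →
    (∀ σ, ∀ t ∈ Set.Icc 0 T, d σ t 0 = 0) → (∀ σ, ∀ t ∈ Set.Icc 0 T, s σ t 0 = 0) →
    (∀ σ, ∀ t ∈ Set.Icc 0 T,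
      gd σ t = κ σ • quad cc (mq N) σ t (fun τ => d τ t) (fun τ => s τ t) + H σ t) →
    (∀ σ, ∀ t ∈ Set.Icc 0 T, ∀ k, k ≠ 0 → ‖gs σ t k‖ ≤ ab k * ‖Fs σ t k‖) →
    (∀ σ, XB T (s σ) Λ) → (∀ σ, ∫ t in (0 : ℝ)..T, ‖Fs σ t‖ ^ 2 ≤ Λ ^ 2) →
    (∀ σ, ∫ t in (0 : ℝ)..T, ‖H σ t‖ ≤ η) → (∀ σ, ‖d σ 0‖ ≤ d₀) →
    ∀ σ, XB T (d σ) (2 * (d₀ + (1 + 60000 * Λ) * η)) := by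
  -- If x is the size of d in `XB`, then D ≤ 3x and Φ ≤ 2000xΛ; the three summands bound D · 3Λ, Φ ·
  -- 3Λ and D · Λ in units of x.
  obtain ⟨M, T₀, hT₀, hT₀1, hsmall⟩ := exists_small_time (9 * Λ + 6000 * Λ ^ 2 + 3 * Λ)
    (half_pos one_pos)
  refine ⟨T₀, hT₀, hT₀1, ?_⟩
  intro N _ cc hcc κ hκ d s gd gs Fs H hd hgd hs hgs hFs hH T η d₀ hT hTT hd0 hs0 heq hgsF hsX hΦs
    hη hinit σ
  have hdc := fun σ => continuous_of_hasDerivAt (hd σ)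
  have hsc := fun σ => continuous_of_hasDerivAt (hs σ)
  have h0T : (0 : ℝ) ∈ Set.Icc 0 T := ⟨le_rfl, hT⟩
  have hTT1 : T ≤ 1 := hTT.trans hT₀1
  have mc : Continuous fun t => max ‖d true t‖ ‖d false t‖ := (hdc true).norm.max (hdc false).norm
  obtain ⟨t₀, ht₀, hmax⟩ := isCompact_Icc.exists_isMaxOn ⟨0, h0T⟩ mc.continuousOn
  set D := max ‖d true t₀‖ ‖d false t₀‖ with hDdef
  have hD : ∀ σ, ∀ t ∈ Set.Icc 0 T, ‖d σ t‖ ≤ D := fun σ t ht => by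
    refine le_trans ?_ (hmax ht)
    cases σ
    exacts [le_max_right _ _, le_max_left _ _]
  have hD0 : 0 ≤ D := (norm_nonneg _).trans (hD true 0 h0T)
  set I : Bool → ℝ := fun σ => ∫ t in (0 : ℝ)..T,
    ‖quad cc (mone N) σ t (fun τ => d τ t) (fun τ => s τ t)‖ ^ 2 with hI
  have hI0 : ∀ σ, 0 ≤ I σ := fun σ => intervalIntegral.integral_nonneg hT fun _ _ => sq_nonneg _
  set Φ := max √(I true) √(I false) with hΦ
  have hΦ0 : 0 ≤ Φ := (Real.sqrt_nonneg _).trans (le_max_left _ _)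
  have hIΦ : ∀ σ, I σ ≤ Φ ^ 2 := fun σ => by
    rw [← Real.sq_sqrt (hI0 σ)]
    refine pow_le_pow_left₀ (Real.sqrt_nonneg _) ?_ 2
    cases σ
    exacts [le_max_right _ _, le_max_left _ _]
  -- As the equation is linear in d, no continuity argument is needed: the terms with D and Φ add up
  -- to at most x / 2 and are absorbed.
  set x := d₀ + 40000 / √((M : ℝ) + 1) * (D * (3 * Λ)) + 16 * (M : ℝ) ^ 2 * T * (D * (3 * Λ)) +
      20000 * √T * (Φ * (3 * Λ) + D * Λ) + (1 + 20000 * (3 * Λ)) * η with hx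
  have hX : ∀ σ, XB T (d σ) x := XB_of_quad hcc hκ hd hgd hs hgs hFs hH hT hd0 hs0 heq hgsF hD
    (fun σ t ht => (hsX σ).norm_le ht) hΦ0 hΛ.le hIΦ hΦs hη hinit M
  have hx0 := (hX true).nonneg
  have hDx : D ≤ 3 * x := max_le ((hX true).norm_le ht₀) ((hX false).norm_le ht₀)
  have hΦx : Φ ≤ 2000 * (x * Λ) := by
    have h1 : ∀ σ, √(I σ) ≤ 2000 * (x * Λ) := fun σ =>
      (Real.sqrt_le_left (by positivity)).2
        (integral_norm_quad_sq_le hcc σ hT hTT1 hX hsX hdc hsc)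
    exact max_le (h1 true) (h1 false)
  refine (hX σ).mono ?_
  have hsm := hsmall T hT hTT
  have hsT := Real.sqrt_nonneg T
  have n1 : 0 ≤ Λ * x := by positivity
  have n2 : 0 ≤ Λ ^ 2 * x := by positivity
  have hA : D * (3 * Λ) ≤ (9 * Λ + 6000 * Λ ^ 2 + 3 * Λ) * x := by nlinarith
  have b1 : 40000 / √((M : ℝ) + 1) * (D * (3 * Λ)) ≤
      40000 / √((M : ℝ) + 1) * ((9 * Λ + 6000 * Λ ^ 2 + 3 * Λ) * x) :=
    mul_le_mul_of_nonneg_left hA (by positivity)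
  have b2 : 16 * (M : ℝ) ^ 2 * T * (D * (3 * Λ)) ≤
      16 * (M : ℝ) ^ 2 * T * ((9 * Λ + 6000 * Λ ^ 2 + 3 * Λ) * x) :=
    mul_le_mul_of_nonneg_left hA (by positivity)
  have b3 : 20000 * √T * (Φ * (3 * Λ) + D * Λ) ≤
      20000 * √T * ((9 * Λ + 6000 * Λ ^ 2 + 3 * Λ) * x) := by
    refine mul_le_mul_of_nonneg_left ?_ (by positivity)
    have h1 : Φ * (3 * Λ) ≤ 2000 * (x * Λ) * (3 * Λ) := by gcongr
    have h2 : D * Λ ≤ 3 * x * Λ := by gcongr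
    nlinarith
  have b4 := mul_le_mul_of_nonneg_right hsm hx0
  have : x ≤ d₀ + (1 + 60000 * Λ) * η + 1 / 2 * x := by
    nth_rewrite 1 [hx]
    nlinarith
  linarith

/-! ### Translation by one lattice site -/

section shift
variable {N : ℕ} [NeZero N]

/-- Diagonal multiplication of Fourier coefficients. -/
def diag (c : ZMod (2 * N) → ℂ) (x : Coef N) : Coef N := WithLp.toLp 2 fun k => c k * x k

lemma diag_apply (c : ZMod (2 * N) → ℂ) (x : Coef N) (k : ZMod (2 * N)) :
    diag c x k = c k * x k := rfl

lemma norm_diag_le {c : ZMod (2 * N) → ℂ} (hc : ∀ k, ‖c k‖ ≤ 1) (x : Coef N) :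
    ‖diag c x‖ ≤ ‖x‖ := norm_le_norm_of_le fun k => by
  rw [diag_apply, norm_mul]; exact mul_le_of_le_one_left (norm_nonneg _) (hc k)

lemma l1_diag_le {c : ZMod (2 * N) → ℂ} (hc : ∀ k, ‖c k‖ ≤ 1) (x : Coef N) :
    l1 (diag c x) ≤ l1 x := Finset.sum_le_sum fun k _ => by
  rw [diag_apply, norm_mul]; exact mul_le_of_le_one_left (norm_nonneg _) (hc k)

lemma diag_sub (c : ZMod (2 * N) → ℂ) (x y : Coef N) : diag c (x - y) = diag c x - diag c y := by
  ext k; simp only [diag_apply, PiLp.sub_apply]; ring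

lemma diag_sub_one (c : ZMod (2 * N) → ℂ) (x : Coef N) :
    diag (fun k => c k - 1) x = diag c x - x := by
  ext k; simp only [diag_apply, PiLp.sub_apply]; ring

lemma hasDerivAt_diag {f : ℝ → Coef N} {f' : Coef N} {t : ℝ} (c : ZMod (2 * N) → ℂ)
    (h : HasDerivAt f f' t) : HasDerivAt (fun t => diag c (f t)) (diag c f') t :=
  hasDerivAt_coef.2 fun k => (hasDerivAt_coef.1 h k).const_mul (c k)

lemma continuous_diag {f : ℝ → Coef N} (c : ZMod (2 * N) → ℂ) (h : Continuous f) :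
    Continuous fun t => diag c (f t) :=
  continuous_coef.2 fun k => continuous_const.mul (continuous_coef.1 h k)

lemma XB.diag {T ξ : ℝ} {a : ℝ → Coef N} (hT : 0 ≤ T) {c : ZMod (2 * N) → ℂ}
    (hc : ∀ k, ‖c k‖ ≤ 1) (h : XB T a ξ) : XB T (fun t => diag c (a t)) ξ := by
  obtain ⟨Z, g, h1, h2, h3, h4, h5⟩ := h
  refine ⟨fun t => FPU.diag c (Z t), fun t => FPU.diag c (g t), fun t => hasDerivAt_diag c (h1 t),
    continuous_diag c h2, fun t ht => ?_, (norm_diag_le hc _).trans h4, ?_⟩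
  · rw [← diag_sub]; exact (l1_diag_le hc _).trans (h3 t ht)
  · exact (intervalIntegral.integral_mono_on hT
      ((continuous_diag c h2).norm.intervalIntegrable _ _) (h2.norm.intervalIntegrable _ _)
      fun t _ => norm_diag_le hc _).trans h5

/-- The Fourier multiplier of the translation by one lattice site. -/
def chi (k : ZMod (2 * N)) : ℂ := Complex.exp ((mesh N * rep k : ℝ) * Complex.I)

lemma norm_chi (k : ZMod (2 * N)) : ‖chi k‖ = 1 := Complex.norm_exp_ofReal_mul_I _

/-- A wrap by 2N turns the angle by 2π, so `chi` is a character of the dual group. Hence translation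
commutes with all bilinear operators, aliased interactions included. -/
lemma chi_mul (k l : ZMod (2 * N)) : chi k * chi l = chi (k + l) := by
  unfold chi
  rw [← Complex.exp_add, ← add_mul, ← Complex.ofReal_add, ← mul_add]
  have h2 : mesh N * (2 * N) = 2 * π := by rw [← mesh_mul N]; ring
  have e : ∀ j : ℤ, rep k + rep l = rep (k + l) + 2 * N * j →
      Complex.exp ((mesh N * ((rep k : ℝ) + rep l) : ℝ) * Complex.I) =
      Complex.exp ((mesh N * rep (k + l) : ℝ) * Complex.I) := fun j hj => by
    have h3 : mesh N * ((rep k : ℝ) + rep l) = mesh N * rep (k + l) + j * (2 * π) := by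
      have : ((rep k : ℝ) + rep l) = rep (k + l) + 2 * N * j := by exact_mod_cast hj
      rw [this, ← h2]; ring
    rw [h3]
    push_cast
    rw [add_mul, Complex.exp_add, mul_assoc (j : ℂ), Complex.exp_int_mul_two_pi_mul_I, mul_one]
  rcases rep_add_rep k l with h | h | h
  · exact e 0 (by rw [h]; ring)
  · exact e 1 (by rw [h]; ring)
  · exact e (-1) (by rw [h]; ring)

lemma norm_chi_sub_one (k : ZMod (2 * N)) :
    ‖chi k - 1‖ = 2 * |Real.sin (mesh N * rep k / 2)| := by
  unfold chi
  rw [mul_comm, Complex.norm_exp_I_mul_ofReal_sub_one, norm_mul]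
  norm_num

/-- Jordan's inequality at hk/2, of modulus at most π/2. A factor h|k| in any estimate can thus be
exchanged for the operator chi - 1, which is propagated by the flow. -/
lemma mesh_mul_ab_le_norm_chi_sub_one (k : ZMod (2 * N)) : mesh N * ab k ≤ 2 * ‖chi k - 1‖ := by
  rw [norm_chi_sub_one]
  have e : |mesh N * (rep k : ℝ) / 2| = mesh N * ab k / 2 := by
    rw [abs_div, abs_mul, abs_of_pos (mesh_pos N), abs_of_pos (two_pos : (0 : ℝ) < 2)]; rfl
  have h1 := mesh_mul_ab_le k
  have h2 := Real.mul_abs_le_abs_sin (x := mesh N * (rep k : ℝ) / 2) (by rw [e]; linarith)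
  rw [e] at h2
  have h3 : 1 / 4 * (mesh N * ab k) ≤ 2 / π * (mesh N * ab k / 2) := by
    have h4 : 1 / 2 ≤ 2 / π := by
      rw [div_le_div_iff₀ two_pos Real.pi_pos]; linarith [Real.pi_lt_four]
    have h5 : 0 ≤ mesh N * ab k / 2 := by
      have := mesh_pos N; have := ab_nonneg k; positivity
    nlinarith
  linarith

lemma norm_chi_sub_one_le (k : ZMod (2 * N)) : ‖chi k - 1‖ ≤ mesh N * ab k := by
  rw [norm_chi_sub_one]
  have e : |mesh N * (rep k : ℝ) / 2| = mesh N * ab k / 2 := by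
    rw [abs_div, abs_mul, abs_of_pos (mesh_pos N), abs_of_pos (two_pos : (0 : ℝ) < 2)]; rfl
  have := Real.abs_sin_le_abs (x := mesh N * (rep k : ℝ) / 2)
  rw [e] at this
  linarith

lemma bil_diag_chi (m : ZMod (2 * N) → ZMod (2 * N) → ℂ) (ψ : ZMod (2 * N) → ZMod (2 * N) → ℝ)
    (t : ℝ) (x y : Coef N) : bil m ψ t (diag chi x) (diag chi y) = diag chi (bil m ψ t x y) := by
  ext k
  rw [diag_apply, bil_apply, bil_apply, Finset.mul_sum]
  refine Finset.sum_congr rfl fun l _ => ?_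
  rw [diag_apply, diag_apply]
  have := chi_mul l (k - l)
  rw [add_sub_cancel] at this
  rw [← this]; ring

lemma quad_diag_chi {cc : Bool → ℝ} {m : Bool → Bool → ZMod (2 * N) → ZMod (2 * N) → ℂ}
    (σ : Bool) (t : ℝ) (x y : Bool → Coef N) :
    quad cc m σ t (fun τ => diag chi (x τ)) (fun τ => diag chi (y τ)) =
      diag chi (quad cc m σ t x y) := by
  simp only [quad, bil_diag_chi, Fintype.sum_bool]
  ext k
  simp only [diag_apply, PiLp.add_apply, PiLp.smul_apply, smul_eq_mul]
  ring

/-- The identity x² - y² = (x - y)(x + y), valid because the form is symmetric. It turns the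
difference of two solutions into a solution of a linear equation. -/
lemma quad_sub_quad {cc : Bool → ℝ} (σ : Bool) (t : ℝ) (x y : Bool → Coef N) :
    quad cc (mone N) σ t x x - quad cc (mone N) σ t y y =
      quad cc (mone N) σ t (fun τ => x τ - y τ) (fun τ => x τ + y τ) := by
  rw [quad_sub_left, quad_add_right, quad_add_right, quad_mone_comm σ t x y]
  abel

lemma quad_mq_sub_quad {cc : Bool → ℝ} (σ : Bool) (t : ℝ) (x y : Bool → Coef N) :
    quad cc (mq N) σ t x x - quad cc (mq N) σ t y y =
      quad cc (mq N) σ t (fun τ => x τ - y τ) (fun τ => x τ + y τ) := by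
  ext k
  rw [PiLp.sub_apply, quad_mq_apply, quad_mq_apply, quad_mq_apply, ← quad_sub_quad,
    PiLp.sub_apply]
  ring

end shift

/-- The difference of a solution and of its translate by one lattice site is as small as it is
initially. -/
theorem exists_shift_estimate {R : ℝ} (hR : 0 < R) : ∃ T₀ : ℝ, 0 < T₀ ∧ T₀ ≤ 1 ∧
    ∀ (N : ℕ) [NeZero N] (cc : Bool → ℝ), (∀ τ, |cc τ| ≤ 1) → ∀ κ : Bool → ℂ, (∀ σ, ‖κ σ‖ ≤ 1) →
    ∀ a g : Bool → ℝ → Coef N, (∀ σ t, HasDerivAt (a σ) (g σ t) t) → (∀ σ, Continuous (g σ)) →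
    ∀ T ε : ℝ, 0 ≤ T → T ≤ T₀ →
    (∀ t ∈ Set.Icc 0 T, ∀ σ,
      g σ t = κ σ • quad cc (mq N) σ t (fun τ => a τ t) (fun τ => a τ t)) →
    (∀ σ, ∀ t ∈ Set.Icc 0 T, a σ t 0 = 0) → (∀ σ, XB T (a σ) (2 * R)) →
    (∀ σ, ‖diag (fun k => chi k - 1) (a σ 0)‖ ≤ ε) →
    (∀ σ, XB T (fun t => diag (fun k => chi k - 1) (a σ t)) (2 * ε)) ∧
    ∀ σ, ∫ t in (0 : ℝ)..T, ‖diag (fun k => chi k - 1)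
      (quad cc (mone N) σ t (fun τ => a τ t) (fun τ => a τ t))‖ ^ 2 ≤
        (16000 * R * ε) ^ 2 := by
  -- The sum of the solution and its translate has size 4R in `XB`, and its interaction term twice
  -- 8000R² in L².
  obtain ⟨T₀, hT₀, hT₀1, hlin⟩ := exists_linear_estimate (Λ := 4 * R + 16000 * R ^ 2)
    (by positivity)
  refine ⟨T₀, hT₀, hT₀1, ?_⟩
  intro N _ cc hcc κ hκ a g ha hg T ε hT hTT heq ha0 haX hε
  have hac := fun σ => continuous_of_hasDerivAt (ha σ)
  have hTT1 : T ≤ 1 := hTT.trans hT₀1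
  simp only [diag_sub_one] at hε ⊢
  set s : Bool → ℝ → Coef N := fun σ t => diag chi (a σ t) + a σ t with hs
  have hsX : ∀ σ, XB T (s σ) (4 * R) := fun σ =>
    (((haX σ).diag hT (fun k => (norm_chi k).le)).add hT (haX σ)).mono (by linarith)
  have hsd : ∀ σ t, HasDerivAt (s σ) (diag chi (g σ t) + g σ t) t := fun σ t =>
    (hasDerivAt_diag chi (ha σ t)).fun_add (ha σ t)
  have hsc := fun σ => continuous_of_hasDerivAt (hsd σ)
  have hdd : ∀ σ t, HasDerivAt (fun t => diag chi (a σ t) - a σ t) (diag chi (g σ t) - g σ t) t :=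
    fun σ t => (hasDerivAt_diag chi (ha σ t)).fun_sub (ha σ t)
  have hdc := fun σ => continuous_of_hasDerivAt (hdd σ)
  set F : Bool → ℝ → Coef N := fun σ t =>
    quad cc (mone N) σ t (fun τ => a τ t) (fun τ => a τ t) with hF
  have hFc : ∀ σ, Continuous (F σ) := fun σ => continuous_quad hac hac σ
  have hFi : ∀ σ, ∫ t in (0 : ℝ)..T, ‖F σ t‖ ^ 2 ≤ (2000 * (2 * R * (2 * R))) ^ 2 := fun σ =>
    integral_norm_quad_sq_le hcc σ hT hTT1 haX haX hac hac
  have h0 : ∀ σ, ∀ t ∈ Set.Icc 0 T, diag chi (a σ t) 0 = 0 := fun σ t ht => by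
    rw [diag_apply, ha0 σ t ht, mul_zero]
  have hX : ∀ σ, XB T (fun t => diag chi (a σ t) - a σ t) (2 * ε) := fun σ => by
    have h := hlin N cc hcc κ hκ (fun σ t => diag chi (a σ t) - a σ t) s
      (fun σ t => diag chi (g σ t) - g σ t) (fun σ t => diag chi (g σ t) + g σ t)
      (fun σ t => diag chi (F σ t) + F σ t) (fun _ _ => 0) hdd
      (fun σ => (continuous_diag chi (hg σ)).sub (hg σ)) hsd
      (fun σ => (continuous_diag chi (hg σ)).add (hg σ))
      (fun σ => (continuous_diag chi (hFc σ)).add (hFc σ)) (fun _ => continuous_const) T 0 ε hT hTT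
      (fun σ t ht => by rw [PiLp.sub_apply, h0 σ t ht, ha0 σ t ht, sub_zero])
      (fun σ t ht => by rw [hs, PiLp.add_apply, h0 σ t ht, ha0 σ t ht, add_zero])
      (fun σ t ht => ?_) (fun σ t ht k _ => ?_) (fun σ => (hsX σ).mono (by nlinarith))
      (fun σ => ?_) (fun σ => by simp) hε σ
    · exact h.mono (by linarith)
    · rw [add_zero, hs, ← quad_mq_sub_quad, smul_sub, ← heq t ht, quad_diag_chi]
      congr 1
      rw [heq t ht]
      ext k
      simp only [diag_apply, PiLp.smul_apply, smul_eq_mul]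
      ring
    · have e : ∀ v : Coef N, (diag chi v + v) k = (chi k + 1) * v k := fun v => by
        rw [PiLp.add_apply, diag_apply]; ring
      rw [e, e, norm_mul, norm_mul, heq t ht, mul_left_comm]
      exact mul_le_mul_of_nonneg_left (norm_smul_quad_mq_apply_le (hκ σ) _ _ _ _ _)
        (norm_nonneg _)
    · have hp : ∀ t ∈ Set.Icc 0 T, ‖diag chi (F σ t) + F σ t‖ ^ 2 ≤ 4 * ‖F σ t‖ ^ 2 :=
        fun t _ => by
        have h1 : ‖diag chi (F σ t) + F σ t‖ ≤ 2 * ‖F σ t‖ :=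
          (norm_add_le _ _).trans (by linarith [norm_diag_le (fun k => (norm_chi k).le) (F σ t)])
        calc _ ≤ (2 * ‖F σ t‖) ^ 2 := by gcongr
          _ = _ := by ring
      have c1 : Continuous fun t => 4 * ‖F σ t‖ ^ 2 := continuous_const.mul ((hFc σ).norm.pow 2)
      refine (intervalIntegral.integral_mono_on hT
        (((((continuous_diag chi (hFc σ)).fun_add (hFc σ))).norm.pow 2).intervalIntegrable _ _)
        (c1.intervalIntegrable _ _) hp).trans ?_
      rw [intervalIntegral.integral_const_mul]
      have := hFi σ
      have : 0 ≤ R ^ 2 := sq_nonneg _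
      nlinarith [mul_nonneg hR.le this, mul_nonneg this this]
  refine ⟨hX, fun σ => ?_⟩
  have h := integral_norm_quad_sq_le hcc σ hT hTT1 hX hsX hdc hsc
  refine le_trans (le_of_eq ?_) (h.trans (le_of_eq (by ring)))
  refine intervalIntegral.integral_congr fun t _ => ?_
  rw [← quad_diag_chi, quad_sub_quad]

/-! ### Normal form for interactions with the opposite wave -/

section cross
variable {N : ℕ} [NeZero N]

/-- For τ = true the phase pays for |k - l| and the outer derivative |k| remains; for τ = false it
pays for the outer derivative and |k - l| remains. Both cases gain h². -/
lemma norm_mhi_mul_ab_le (M : ℕ) (σ τ : Bool) (k l : ZMod (2 * N)) :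
    ‖mhi M σ τ false k l‖ * ab (k - l) ≤
      120 * mesh N ^ 2 * (if τ then ab k else ab (k - l)) := by
  have hh := mesh_pos N
  have n0 : 0 ≤ if τ then ab k else ab (k - l) := by split_ifs <;> exact ab_nonneg _
  by_cases h : high M k l
  swap
  · rw [mhi_of_not_high h, norm_zero, zero_mul]; positivity
  have e : ‖mhi M σ τ false k l‖ = |qSym k| / |psi σ τ false k l| := by
    unfold mhi
    rw [if_pos h, norm_div, norm_mul, Complex.norm_I, one_mul, Complex.norm_real,
      Complex.norm_real, Real.norm_eq_abs, Real.norm_eq_abs]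
  rw [e]
  have hq := abs_qSym_le k
  rcases (abs_nonneg (psi σ τ false k l)).eq_or_lt with h0 | h0
  · rw [← h0, div_zero, zero_mul]; positivity
  rw [div_mul_eq_mul_div, div_le_iff₀ h0]
  have h1 := ab_nonneg k
  have h2 := ab_nonneg (k - l)
  cases τ
  · have h3 := ab_le_psi_opposite σ k l
    simp only [Bool.false_eq_true, if_false]
    calc |qSym k| * ab (k - l) ≤ (120 * (mesh N ^ 2 * |psi σ false false k l|)) * ab (k - l) := by
          gcongr; exact hq.trans h3
      _ = _ := by ring
  · have h3 := ab_le_psi_mixed σ k l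
    simp only [if_true]
    calc |qSym k| * ab (k - l) ≤ ab k * (120 * (mesh N ^ 2 * |psi σ true false k l|)) := by
          gcongr
      _ = _ := by ring

/-- One power of h pays for the remaining frequency; the other is the gain. -/
lemma norm_mhi_mul_ab_le_mesh (M : ℕ) (σ τ : Bool) (k l : ZMod (2 * N)) :
    ‖mhi M σ τ false k l‖ * ab (k - l) ≤ 400 * mesh N := by
  have hh := mesh_pos N
  refine (norm_mhi_mul_ab_le M σ τ k l).trans ?_
  have h : mesh N * (if τ then ab k else ab (k - l)) ≤ π := by
    split_ifs <;> exact mesh_mul_ab_le _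
  have := Real.pi_lt_d2
  calc _ = 120 * mesh N * (mesh N * (if τ then ab k else ab (k - l))) := by ring
    _ ≤ 120 * mesh N * π := by gcongr
    _ ≤ 120 * mesh N * (400 / 120) := by gcongr; linarith
    _ = _ := by ring

/-- An additional outer derivative costs at most 2/h. The remaining h stays next to input
frequencies, so that it can become chi - 1 on one of the inputs. -/
lemma qSym_mul_norm_mhi_mul_ab_le (M : ℕ) (σ τ : Bool) (k j l : ZMod (2 * N)) :
    |qSym j| * (‖mhi M σ τ false k l‖ * ab (k - l)) ≤
      240 * mesh N * (ab l + ab (k - l)) := by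
  have hh := mesh_pos N
  have hq : |qSym j| ≤ 2 / mesh N := by
    unfold qSym
    rw [abs_mul, abs_of_pos (by positivity : 0 < 2 / mesh N)]
    exact mul_le_of_le_one_right (by positivity) (Real.abs_sin_le_one _)
  have h2 : (if τ then ab k else ab (k - l)) ≤ ab l + ab (k - l) := by
    split_ifs
    · have := ab_add_le l (k - l); rwa [add_sub_cancel] at this
    · linarith [ab_nonneg l]
  have h1 := norm_mhi_mul_ab_le M σ τ k l
  calc |qSym j| * (‖mhi M σ τ false k l‖ * ab (k - l))
      ≤ 2 / mesh N * (120 * mesh N ^ 2 * (ab l + ab (k - l))) := by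
        refine mul_le_mul hq (h1.trans ?_) (mul_nonneg (norm_nonneg _) (ab_nonneg _))
          (by positivity)
        gcongr
    _ = _ := by field_simp; ring

lemma mesh_mul_ab_mul_norm_le (x : Coef N) (k : ZMod (2 * N)) :
    mesh N * ab k * ‖x k‖ ≤ 2 * ‖diag (fun k => chi k - 1) x k‖ := by
  rw [diag_apply, norm_mul, ← mul_assoc]
  exact mul_le_mul_of_nonneg_right (mesh_mul_ab_le_norm_chi_sub_one k) (norm_nonneg _)

/-- The gain h is spent on y, where h ≤ h|k - l| becomes chi - 1, and the inverse frequency of y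
gives ℓ¹. -/
lemma norm_bil_cross_le (M : ℕ) (σ τ : Bool) (t : ℝ) (x y : Coef N) :
    ‖bil (mhi M σ τ false) (psi σ τ false) t x y‖ ≤
      1600 * (‖x‖ * ‖diag (fun k => chi k - 1) y‖) := by
  have h := norm_le_of_le_conv' (z := bil (mhi M σ τ false) (psi σ τ false) t x y)
    (X := fun k => ‖x k‖) (Y := fun k => 800 * (‖diag (fun k => chi k - 1) y k‖ * (ab k)⁻¹))
    (b := 1600 * ‖diag (fun k => chi k - 1) y‖)
    (fun k => mul_nonneg (by norm_num)
      (mul_nonneg (norm_nonneg _) (inv_nonneg.2 (ab_nonneg _)))) (fun k => ?_)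
    (norm_nonneg x) (norm_sq_eq_sum x).ge ?_
  · exact h.trans (le_of_eq (by ring))
  · refine (norm_bil_apply_le_sum t x y k).trans (Finset.sum_le_sum fun l _ => ?_)
    by_cases hh : high M k l
    · have hp := one_le_ab hh.2.2.1
      have hp0 := ab_pos hh.2.2.1
      have h1 := norm_mhi_mul_ab_le_mesh M σ τ k l
      have h2 := mesh_mul_ab_mul_norm_le y (k - l)
      have n1 := norm_nonneg (y (k - l))
      have h3 : ‖mhi M σ τ false k l‖ * ‖y (k - l)‖ ≤
          800 * (‖diag (fun k => chi k - 1) y (k - l)‖ * (ab (k - l))⁻¹) := by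
        rw [← mul_assoc, ← div_eq_mul_inv, le_div_iff₀ hp0]
        calc ‖mhi M σ τ false k l‖ * ‖y (k - l)‖ * ab (k - l)
            = ‖mhi M σ τ false k l‖ * ab (k - l) * ‖y (k - l)‖ := by ring
          _ ≤ 400 * mesh N * ‖y (k - l)‖ := by gcongr
          _ ≤ 400 * mesh N * (ab (k - l) * ‖y (k - l)‖) := by
            have := mesh_pos N
            gcongr
            exact le_mul_of_one_le_left n1 hp
          _ ≤ _ := by linarith
      calc ‖mhi M σ τ false k l‖ * (‖x l‖ * ‖y (k - l)‖)
          = ‖x l‖ * (‖mhi M σ τ false k l‖ * ‖y (k - l)‖) := by ring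
        _ ≤ _ := by gcongr
    · rw [mhi_of_not_high hh, norm_zero, zero_mul]
      have := ab_nonneg (k - l)
      positivity
  · rw [← Finset.mul_sum]
    have := sum_norm_mul_inv_le (diag (fun k => chi k - 1) y)
    linarith

/-- The gain h combines with the derivative on F into chi - 1; the inverse frequency goes to y. -/
lemma norm_bil_cross_le_left (M : ℕ) (σ τ : Bool) (t : ℝ) {x y F : Coef N}
    (hx : ∀ k, k ≠ 0 → ‖x k‖ ≤ ab k * ‖F k‖) :
    ‖bil (mhi M σ τ false) (psi σ τ false) t x y‖ ≤
      1600 * (‖diag (fun k => chi k - 1) F‖ * ‖y‖) := by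
  have h := norm_le_of_le_conv' (z := bil (mhi M σ τ false) (psi σ τ false) t x y)
    (X := fun k => ‖diag (fun k => chi k - 1) F k‖) (Y := fun k => 800 * (‖y k‖ * (ab k)⁻¹))
    (b := 1600 * ‖y‖)
    (fun k => mul_nonneg (by norm_num)
      (mul_nonneg (norm_nonneg _) (inv_nonneg.2 (ab_nonneg _)))) (fun k => ?_)
    (norm_nonneg (diag (fun k => chi k - 1) F)) (norm_sq_eq_sum _).ge ?_
  · exact h.trans (le_of_eq (by ring))
  · refine (norm_bil_apply_le_sum t x y k).trans (Finset.sum_le_sum fun l _ => ?_)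
    by_cases hh : high M k l
    · have hp0 := ab_pos hh.2.2.1
      have h1 := norm_mhi_mul_ab_le_mesh M σ τ k l
      have h2 := mesh_mul_ab_mul_norm_le F l
      have h3 : ‖mhi M σ τ false k l‖ ≤ 400 * mesh N * (ab (k - l))⁻¹ := by
        rw [← div_eq_mul_inv, le_div_iff₀ hp0]; exact h1
      have := mesh_pos N
      calc ‖mhi M σ τ false k l‖ * (‖x l‖ * ‖y (k - l)‖)
          ≤ 400 * mesh N * (ab (k - l))⁻¹ * (ab l * ‖F l‖ * ‖y (k - l)‖) := by
            gcongr
            exact hx l hh.2.1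
        _ = 400 * (mesh N * ab l * ‖F l‖) * (‖y (k - l)‖ * (ab (k - l))⁻¹) := by ring
        _ ≤ 400 * (2 * ‖diag (fun k => chi k - 1) F l‖) * (‖y (k - l)‖ * (ab (k - l))⁻¹) := by
            gcongr
        _ = _ := by ring
    · rw [mhi_of_not_high hh, norm_zero, zero_mul]
      have := ab_nonneg (k - l)
      positivity
  · rw [← Finset.mul_sum]
    have := sum_norm_mul_inv_le y
    linarith

/-- The inverse frequency cancels the derivative on F, and h is spent on x. Writing h as h|l|/|l|
gives both chi - 1 and summability. -/
lemma norm_bil_cross_le_right (M : ℕ) (σ τ : Bool) (t : ℝ) {x y F : Coef N}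
    (hy : ∀ k, k ≠ 0 → ‖y k‖ ≤ ab k * ‖F k‖) :
    ‖bil (mhi M σ τ false) (psi σ τ false) t x y‖ ≤
      1600 * (‖diag (fun k => chi k - 1) x‖ * ‖F‖) := by
  have h := norm_le_of_le_conv (z := bil (mhi M σ τ false) (psi σ τ false) t x y)
    (Y := fun k => ‖F k‖) (X := fun k => 800 * (‖diag (fun k => chi k - 1) x k‖ * (ab k)⁻¹))
    (a := 1600 * ‖diag (fun k => chi k - 1) x‖)
    (fun k => mul_nonneg (by norm_num)
      (mul_nonneg (norm_nonneg _) (inv_nonneg.2 (ab_nonneg _)))) (fun k => ?_)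
    (norm_nonneg F) ?_ (norm_sq_eq_sum F).ge
  · exact h.trans (le_of_eq (by ring))
  · refine (norm_bil_apply_le_sum t x y k).trans (Finset.sum_le_sum fun l _ => ?_)
    by_cases hh : high M k l
    · have hp0 := ab_pos hh.2.1
      have h1 := norm_mhi_mul_ab_le_mesh M σ τ k l
      have h2 := mesh_mul_ab_mul_norm_le x l
      have := mesh_pos N
      calc ‖mhi M σ τ false k l‖ * (‖x l‖ * ‖y (k - l)‖)
          ≤ ‖mhi M σ τ false k l‖ * (‖x l‖ * (ab (k - l) * ‖F (k - l)‖)) := by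
            gcongr
            exact hy (k - l) hh.2.2.1
        _ = (‖mhi M σ τ false k l‖ * ab (k - l)) * (‖x l‖ * ‖F (k - l)‖) := by ring
        _ ≤ 400 * mesh N * (‖x l‖ * ‖F (k - l)‖) := by gcongr
        _ = 400 * (mesh N * ab l * ‖x l‖) * (ab l)⁻¹ * ‖F (k - l)‖ := by field_simp
        _ ≤ 400 * (2 * ‖diag (fun k => chi k - 1) x l‖) * (ab l)⁻¹ * ‖F (k - l)‖ := by gcongr
        _ = _ := by ring
    · rw [mhi_of_not_high hh, norm_zero, zero_mul]
      have := ab_nonneg l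
      positivity
  · rw [← Finset.mul_sum]
    have := sum_norm_mul_inv_le (diag (fun k => chi k - 1) x)
    linarith

/-- The multiplier of the trilinear interaction, with one frequency `j` frozen. -/
def mtri (σ τ : Bool) (j p l : ZMod (2 * N)) : ℂ := (qSym (p + j) : ℂ) * mhi 0 σ τ false (l + j) l

lemma norm_mtri_mul_ab_le (σ τ : Bool) (j p l : ZMod (2 * N)) :
    ‖mtri σ τ j p l‖ * ab j ≤ 240 * mesh N * (ab l + ab j) := by
  have h := qSym_mul_norm_mhi_mul_ab_le 0 σ τ (l + j) (p + j) l
  rw [add_sub_cancel_left] at h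
  unfold mtri
  rw [norm_mul, Complex.norm_real, Real.norm_eq_abs, mul_assoc]
  exact h

lemma mtri_zero (σ τ : Bool) (p l : ZMod (2 * N)) : mtri σ τ 0 p l = 0 := by
  unfold mtri
  rw [mhi_of_not_high, mul_zero]
  intro h
  exact h.2.2.1 (by ring)

/-- The composition still has an outer derivative and must use oscillation. Freezing the frequency j
of α leaves a bilinear operator in x and s, up to a translation by j and unimodular factors, to
which the L² estimate applies. -/
lemma norm_bil_bil_le_sum (σ τ : Bool) (t : ℝ) (x α s : Coef N) :
    ‖bil (mq N true true) (psi σ true true) t (bil (mhi 0 σ τ false) (psi σ τ false) t x α) s‖ ≤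
      ∑ j, ‖α j‖ * ‖bil (mtri σ τ j) (psi σ τ true) t x s‖ := by
  set z : ZMod (2 * N) → Coef N := fun j => WithLp.toLp 2 fun k =>
    Complex.exp ((sg σ * (th true (k - j) + th false j - th true k) * t : ℝ) * Complex.I) *
      (α j * bil (mtri σ τ j) (psi σ τ true) t x s (k - j)) with hz
  have hza : ∀ j k, z j k = Complex.exp ((sg σ * (th true (k - j) + th false j - th true k) * t :
      ℝ) * Complex.I) * (α j * bil (mtri σ τ j) (psi σ τ true) t x s (k - j)) := fun _ _ => rfl
  have e : bil (mq N true true) (psi σ true true) t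
      (bil (mhi 0 σ τ false) (psi σ τ false) t x α) s = ∑ j, z j := by
    ext k
    rw [bil_apply]
    simp only [WithLp.ofLp_sum, Finset.sum_apply, hza, bil_apply, Finset.mul_sum, Finset.sum_mul]
    refine Finset.sum_comm.trans (Eq.trans (Finset.sum_congr rfl fun l _ => ?_) Finset.sum_comm)
    rw [← Equiv.sum_comp (Equiv.addLeft l)]
    refine Finset.sum_congr rfl fun j _ => ?_
    have e1 : k - (l + j) = k - j - l := by ring
    have e2 : l + j - l = j := by ring
    have e3 : k - j + j = k := by ring
    simp only [Equiv.coe_addLeft, mq, mtri, e2, e1, e3]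
    -- The dispersion at the intermediate frequency l + j cancels. The total phase is that of x and
    -- s at output k - j plus a term depending only on j and k.
    have e4 : Complex.exp ((psi σ true true k (l + j) * t : ℝ) * Complex.I) *
        Complex.exp ((psi σ τ false (l + j) l * t : ℝ) * Complex.I) =
        Complex.exp ((sg σ * (th true (k - j) + th false j - th true k) * t : ℝ) * Complex.I) *
        Complex.exp ((psi σ τ true (k - j) l * t : ℝ) * Complex.I) := by
      rw [← Complex.exp_add, ← Complex.exp_add, ← add_mul, ← add_mul, ← Complex.ofReal_add,
        ← Complex.ofReal_add]
      congr 3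
      unfold psi
      rw [e1, e2]; ring
    linear_combination (qSym k : ℂ) * mhi 0 σ τ false (l + j) l * x l * α j * s (k - j - l) * e4
  rw [e]
  refine (norm_sum_le _ _).trans (Finset.sum_le_sum fun j _ => le_of_eq ?_)
  rw [← sq_eq_sq₀ (norm_nonneg _) (by positivity), mul_pow, norm_sq_eq_sum, norm_sq_eq_sum,
    ← sum_sub_right j (fun k => ‖bil (mtri σ τ j) (psi σ τ true) t x s k‖ ^ 2), Finset.mul_sum]
  refine Finset.sum_congr rfl fun k _ => ?_
  rw [hza, norm_mul, Complex.norm_exp_ofReal_mul_I, one_mul, norm_mul, mul_pow]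

open Classical in
/-- The part of `mtri` where the difference operator is put on the first factor. -/
def mtriL (σ τ : Bool) (j p l : ZMod (2 * N)) : ℂ :=
  if ab j ≤ ab l then mtri σ τ j p l * ab j / (1000 * (chi l - 1)) else 0

open Classical in
/-- The part of `mtri` where the difference operator is put on the frozen factor. -/
def mtriR (σ τ : Bool) (j p l : ZMod (2 * N)) : ℂ :=
  if ab j ≤ ab l then 0 else mtri σ τ j p l / (500 * mesh N : ℝ)

/-- For |j| ≤ |l| the bound 240h(|l| + |j|) is at most 480h|l| ≤ 960|chi(l) - 1|. -/
lemma norm_mtriL_le (σ τ : Bool) (j p l : ZMod (2 * N)) : ‖mtriL σ τ j p l‖ ≤ 1 := by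
  unfold mtriL
  split_ifs with h
  · have h1 := norm_mtri_mul_ab_le σ τ j p l
    have h2 := mesh_mul_ab_le_norm_chi_sub_one l
    have hh := mesh_pos N
    rw [norm_div, norm_mul, norm_mul, Complex.norm_real, Real.norm_eq_abs,
      abs_of_nonneg (ab_nonneg j)]
    refine div_le_one_of_le₀ ?_ (by positivity)
    have h3 : 240 * mesh N * (ab l + ab j) ≤ 240 * mesh N * (ab l + ab l) := by gcongr
    have : ‖(1000 : ℂ)‖ = 1000 := by norm_num
    rw [this]
    linarith [norm_nonneg (chi l - 1)]
  · simp

lemma norm_mtriR_le (σ τ : Bool) (j p l : ZMod (2 * N)) : ‖mtriR σ τ j p l‖ ≤ 1 := by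
  unfold mtriR
  split_ifs with h
  · simp
  · have h1 := norm_mtri_mul_ab_le σ τ j p l
    have hh := mesh_pos N
    have hj : 0 < ab j := lt_of_le_of_lt (ab_nonneg l) (not_le.1 h)
    rw [norm_div, Complex.norm_real, Real.norm_eq_abs, abs_of_pos (by positivity)]
    refine div_le_one_of_le₀ ?_ (by positivity)
    have h3 : 240 * mesh N * (ab l + ab j) ≤ 240 * mesh N * (ab j + ab j) := by
      have := (not_le.1 h).le
      gcongr
    have h4 : ‖mtri σ τ j p l‖ * ab j ≤ 500 * mesh N * ab j := by
      refine (h1.trans h3).trans ?_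
      have : 0 < mesh N * ab j := by positivity
      linarith
    exact le_of_mul_le_mul_right h4 hj

lemma bil_mtri_eq (σ τ : Bool) {j : ZMod (2 * N)} (hj : j ≠ 0) (t : ℝ) (x s : Coef N) :
    bil (mtri σ τ j) (psi σ τ true) t x s =
      ((1000 / ab j : ℝ) : ℂ) •
        bil (mtriL σ τ j) (psi σ τ true) t (diag (fun k => chi k - 1) x) s +
      ((500 * mesh N : ℝ) : ℂ) • bil (mtriR σ τ j) (psi σ τ true) t x s := by
  ext p
  simp only [PiLp.add_apply, PiLp.smul_apply, bil_apply, smul_eq_mul, Finset.mul_sum,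
    ← Finset.sum_add_distrib]
  refine Finset.sum_congr rfl fun l _ => ?_
  have hjp := ab_pos hj
  have hjc : (ab j : ℂ) ≠ 0 := by exact_mod_cast hjp.ne'
  have hh := mesh_pos N
  have hhc : (mesh N : ℂ) ≠ 0 := by exact_mod_cast hh.ne'
  rw [diag_apply]
  unfold mtriL mtriR
  by_cases h : ab j ≤ ab l
  · have hl : chi l - 1 ≠ 0 := fun h0 => by
      have := mesh_mul_ab_le_norm_chi_sub_one l
      rw [h0, norm_zero, mul_zero] at this
      have : 0 < mesh N * ab l := mul_pos hh (hjp.trans_le h)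
      linarith
    rw [if_pos h, if_pos h]
    push_cast
    field_simp
    ring
  · rw [if_neg h, if_neg h]
    push_cast
    field_simp
    ring

/-- Whichever of l and j is larger receives chi - 1. In both cases a weight 1/|j| remains, which
makes the sum over the frozen frequency converge. -/
lemma norm_bil_bil_le (σ τ : Bool) (t : ℝ) (x α s : Coef N) :
    ‖bil (mq N true true) (psi σ true true) t (bil (mhi 0 σ τ false) (psi σ τ false) t x α) s‖ ≤
      1000 * (∑ j, ‖α j‖ * ((ab j)⁻¹ *
        ‖bil (mtriL σ τ j) (psi σ τ true) t (diag (fun k => chi k - 1) x) s‖) +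
      ∑ j, ‖diag (fun k => chi k - 1) α j‖ * ((ab j)⁻¹ *
        ‖bil (mtriR σ τ j) (psi σ τ true) t x s‖)) := by
  refine (norm_bil_bil_le_sum σ τ t x α s).trans ?_
  rw [← Finset.sum_add_distrib, Finset.mul_sum]
  refine Finset.sum_le_sum fun j _ => ?_
  have hab := ab_nonneg j
  by_cases hj : j = 0
  · have : bil (mtri σ τ j) (psi σ τ true) t x s = 0 := by
      ext k
      rw [bil_apply]
      simp [hj, mtri_zero]
    rw [this, norm_zero, mul_zero]
    positivity
  · have hjp := ab_pos hj
    have hh := mesh_pos N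
    have h2 := mesh_mul_ab_mul_norm_le α j
    have h3 : 500 * mesh N * ‖α j‖ ≤ 1000 * (‖diag (fun k => chi k - 1) α j‖ * (ab j)⁻¹) := by
      rw [← mul_assoc, ← div_eq_mul_inv, le_div_iff₀ hjp]
      linarith
    rw [bil_mtri_eq σ τ hj]
    have h4 := norm_add_le (((1000 / ab j : ℝ) : ℂ) •
        bil (mtriL σ τ j) (psi σ τ true) t (diag (fun k => chi k - 1) x) s)
      (((500 * mesh N : ℝ) : ℂ) • bil (mtriR σ τ j) (psi σ τ true) t x s)
    rw [norm_smul, norm_smul, Complex.norm_real, Complex.norm_real, Real.norm_eq_abs,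
      Real.norm_eq_abs, abs_of_pos (by positivity), abs_of_pos (by positivity)] at h4
    calc _ ≤ ‖α j‖ * (1000 / ab j *
          ‖bil (mtriL σ τ j) (psi σ τ true) t (diag (fun k => chi k - 1) x) s‖ +
          500 * mesh N * ‖bil (mtriR σ τ j) (psi σ τ true) t x s‖) := by gcongr
      _ = 1000 * (‖α j‖ * ((ab j)⁻¹ *
          ‖bil (mtriL σ τ j) (psi σ τ true) t (diag (fun k => chi k - 1) x) s‖)) +
          500 * mesh N * ‖α j‖ * ‖bil (mtriR σ τ j) (psi σ τ true) t x s‖ := by ring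
      _ ≤ 1000 * (‖α j‖ * ((ab j)⁻¹ *
          ‖bil (mtriL σ τ j) (psi σ τ true) t (diag (fun k => chi k - 1) x) s‖)) +
          1000 * (‖diag (fun k => chi k - 1) α j‖ * (ab j)⁻¹) *
            ‖bil (mtriR σ τ j) (psi σ τ true) t x s‖ := by gcongr
      _ = _ := by ring

/-- Cauchy–Schwarz in j puts α into ℓ² and the weights 1/j² on the squares of the B j, whose
integrals are bounded uniformly in j. -/
lemma integral_sum_mul_inv_le {T A b : ℝ} (hT : 0 ≤ T) (hT1 : T ≤ 1) (hA : 0 ≤ A) (hb : 0 ≤ b)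
    {α : ℝ → Coef N} {B : ZMod (2 * N) → ℝ → Coef N} (hα : Continuous α)
    (hB : ∀ j, Continuous (B j)) (hαA : ∀ t ∈ Set.Icc 0 T, ‖α t‖ ≤ A)
    (hBb : ∀ j, ∫ t in (0 : ℝ)..T, ‖B j t‖ ^ 2 ≤ b ^ 2) :
    ∫ t in (0 : ℝ)..T, ∑ j, ‖α t j‖ * ((ab j)⁻¹ * ‖B j t‖) ≤ 2 * (A * b) := by
  set f : ℝ → ℝ := fun t => √(∑ j, wt j * ‖B j t‖ ^ 2) with hf
  have hsum : Continuous fun t => ∑ j, wt j * ‖B j t‖ ^ 2 :=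
    continuous_finsetSum _ fun j _ => continuous_const.mul ((hB j).norm.pow 2)
  have hfc : Continuous f := Real.continuous_sqrt.comp hsum
  have hn : ∀ t, 0 ≤ ∑ j, wt j * ‖B j t‖ ^ 2 := fun t =>
    Finset.sum_nonneg fun j _ => mul_nonneg (wt_nonneg j) (sq_nonneg _)
  have hpt : ∀ t ∈ Set.Icc 0 T, ∑ j, ‖α t j‖ * ((ab j)⁻¹ * ‖B j t‖) ≤ A * ‖f t‖ := fun t ht => by
    refine sum_mul_le_of_sq_le _ hA (norm_nonneg _) ?_ ?_
    · rw [← norm_sq_eq_sum]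
      exact pow_le_pow_left₀ (norm_nonneg _) (hαA t ht) 2
    · rw [Real.norm_eq_abs, sq_abs, hf, Real.sq_sqrt (hn t)]
      refine le_of_eq (Finset.sum_congr rfl fun j _ => ?_)
      rw [mul_pow, wt, inv_pow]
  have hcl : Continuous fun t => ∑ j, ‖α t j‖ * ((ab j)⁻¹ * ‖B j t‖) :=
    continuous_finsetSum _ fun j _ => (continuous_coef.1 hα j).norm.mul
      (continuous_const.mul (hB j).norm)
  have hcr : Continuous fun t => A * ‖f t‖ := continuous_const.mul hfc.norm
  refine (intervalIntegral.integral_mono_on hT (hcl.intervalIntegrable _ _)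
    (hcr.intervalIntegrable _ _) hpt).trans ?_
  rw [intervalIntegral.integral_const_mul]
  have h1 : ∫ t in (0 : ℝ)..T, ‖f t‖ ≤ √T * (2 * b) := by
    refine integral_norm_le_sqrt hfc hT (by positivity) ?_
    have e : ∀ t, ‖f t‖ ^ 2 = ∑ j, wt j * ‖B j t‖ ^ 2 := fun t => by
      rw [Real.norm_eq_abs, sq_abs, hf, Real.sq_sqrt (hn t)]
    simp only [e]
    have ci : ∀ j, Continuous fun t => wt j * ‖B j t‖ ^ 2 := fun j =>
      continuous_const.mul ((hB j).norm.pow 2)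
    rw [intervalIntegral.integral_finsetSum fun j _ => (ci j).intervalIntegrable _ _]
    calc _ ≤ ∑ j : ZMod (2 * N), wt j * b ^ 2 := Finset.sum_le_sum fun j _ => by
          rw [intervalIntegral.integral_const_mul]
          exact mul_le_mul_of_nonneg_left (hBb j) (wt_nonneg j)
      _ = (∑ j : ZMod (2 * N), wt j) * b ^ 2 := by rw [Finset.sum_mul]
      _ ≤ 4 * b ^ 2 := by gcongr; exact sum_wt_le
      _ = _ := by ring
  have h2 : √T ≤ 1 := Real.sqrt_le_one.2 hT1
  calc A * ∫ t in (0 : ℝ)..T, ‖f t‖ ≤ A * (1 * (2 * b)) := by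
        gcongr
        exact h1.trans (by gcongr)
    _ = _ := by ring

/-- Trilinear estimate. -/
lemma integral_norm_bil_bil_le (σ τ : Bool) {T ξ ζ ε : ℝ} (hT : 0 ≤ T) (hT1 : T ≤ 1)
    {x α s : ℝ → Coef N} (hxc : Continuous x) (hαc : Continuous α) (hsc : Continuous s)
    (hx : XB T x ξ) (hα : XB T α ξ) (hs : XB T s ζ)
    (hxd : XB T (fun t => diag (fun k => chi k - 1) (x t)) ε)
    (hαd : XB T (fun t => diag (fun k => chi k - 1) (α t)) ε) :
    ∫ t in (0 : ℝ)..T, ‖bil (mq N true true) (psi σ true true) t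
      (bil (mhi 0 σ τ false) (psi σ τ false) t (x t) (α t)) (s t)‖ ≤ 6000000 * (ξ * ζ * ε) := by
  have hξ := hx.nonneg
  have hζ := hs.nonneg
  have hε := hxd.nonneg
  have hxdc := continuous_diag (fun k => chi k - 1) hxc
  have hαdc := continuous_diag (fun k => chi k - 1) hαc
  have i1 := integral_sum_mul_inv_le hT hT1 (A := 3 * ξ) (b := 500 * (ε * ζ)) (by positivity)
    (by positivity) hαc (B := fun j t => bil (mtriL σ τ j) (psi σ τ true) t
      (diag (fun k => chi k - 1) (x t)) (s t)) (fun j => continuous_bil hxdc hsc)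
    (fun t ht => hα.norm_le ht) fun j => XB.integral_norm_bil_sq_le (norm_mtriL_le σ τ j) σ τ true
      hT hT1 hxd hs hxdc hsc
  have i2 := integral_sum_mul_inv_le hT hT1 (A := 3 * ε) (b := 500 * (ξ * ζ)) (by positivity)
    (by positivity) hαdc (B := fun j t => bil (mtriR σ τ j) (psi σ τ true) t (x t) (s t))
    (fun j => continuous_bil hxc hsc)
    (fun t ht => hαd.norm_le ht) fun j => XB.integral_norm_bil_sq_le (norm_mtriR_le σ τ j) σ τ true
      hT hT1 hx hs hxc hsc
  have c1 : Continuous fun t => ∑ j, ‖α t j‖ * ((ab j)⁻¹ * ‖bil (mtriL σ τ j) (psi σ τ true) t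
      (diag (fun k => chi k - 1) (x t)) (s t)‖) :=
    continuous_finsetSum _ fun j _ => (continuous_coef.1 hαc j).norm.mul
      (continuous_const.mul (continuous_bil hxdc hsc).norm)
  have c2 : Continuous fun t => ∑ j, ‖diag (fun k => chi k - 1) (α t) j‖ *
      ((ab j)⁻¹ * ‖bil (mtriR σ τ j) (psi σ τ true) t (x t) (s t)‖) :=
    continuous_finsetSum _ fun j _ => (continuous_coef.1 hαdc j).norm.mul
      (continuous_const.mul (continuous_bil hxc hsc).norm)
  refine (intervalIntegral.integral_mono_on hT
    ((continuous_bil (continuous_bil hxc hαc) hsc).norm.intervalIntegrable _ _)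
    ((continuous_const.fun_mul (c1.fun_add c2)).intervalIntegrable _ _)
    fun t _ => norm_bil_bil_le σ τ t (x t) (α t) (s t)).trans ?_
  rw [intervalIntegral.integral_const_mul, intervalIntegral.integral_add
    (c1.intervalIntegrable _ _) (c2.intervalIntegrable _ _)]
  linarith

end cross

/-- The coupling constants of the coupled system. -/
def ccC (_ : Bool) : ℝ := 1

/-- The coupling constants of the decoupled system. -/
def ccD (τ : Bool) : ℝ := if τ then 1 else 0

lemma abs_ccC_le (τ : Bool) : |ccC τ| ≤ 1 := by simp [ccC]

lemma abs_ccD_le (τ : Bool) : |ccD τ| ≤ 1 := by cases τ <;> simp [ccD]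

/-! ### Coupled against decoupled equations -/

section difference
variable {N : ℕ} [NeZero N]

lemma quad_ccD (m : Bool → Bool → ZMod (2 * N) → ZMod (2 * N) → ℂ) (σ : Bool) (t : ℝ)
    (x y : Bool → Coef N) :
    quad ccD m σ t x y = bil (m true true) (psi σ true true) t (x σ) (y σ) := by
  simp [quad, ccD]

/-- The two mixed interactions agree by symmetry, so every cross term can be written with an
opposite wave as second input. -/
lemma quad_ccC_mq (σ : Bool) (t : ℝ) (x : Bool → Coef N) :
    quad ccC (mq N) σ t x x = quad ccD (mq N) σ t x x +
      ((2 : ℂ) • bil (mq N true false) (psi σ true false) t (x σ) (x !σ) +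
        bil (mq N false false) (psi σ false false) t (x !σ) (x !σ)) := by
  rw [quad_ccD]
  have h : bil (mq N false true) (psi σ false true) t (x !σ) (x σ) =
      bil (mq N true false) (psi σ true false) t (x σ) (x !σ) :=
    bil_swap _ _ (fun k => (qSym k : ℂ)) (fun k l => psi_swap σ false true k l) t _ _
  simp only [quad, ccC, Fintype.sum_bool, mul_one, Complex.ofReal_one, one_smul, beq_true,
    beq_false, h, two_smul]
  abel

/-- With M = 0 every interaction of nonzero frequencies with nonzero output is high, and output zero
is killed by `qSym`. On mean-zero functions the normal form therefore leaves no low part. -/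
lemma bil_mhi_mul_psi (σ τ₁ τ₂ : Bool) (t : ℝ) {x y : Coef N} (hx : x 0 = 0) (hy : y 0 = 0) :
    bil (fun k l => mhi 0 σ τ₁ τ₂ k l * (Complex.I * psi σ τ₁ τ₂ k l)) (psi σ τ₁ τ₂) t x y =
      bil (mq N τ₁ τ₂) (psi σ τ₁ τ₂) t x y := by
  ext k
  rw [bil_apply, bil_apply]
  refine Finset.sum_congr rfl fun l _ => ?_
  by_cases hl : l = 0
  · subst hl; simp [hx]
  by_cases hkl : k - l = 0
  · simp [hkl, hy]
  have e := mlow_add_mhi 0 σ τ₁ τ₂ k l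
  have h0 : mlow 0 k l = 0 := by
    unfold mlow
    split_ifs with h
    · rfl
    · have hk : k = 0 := by
        by_contra hk
        exact h ⟨hk, hl, hkl, Or.inl (by simpa using ab_pos hl)⟩
      rw [hk, qSym_zero, Complex.ofReal_zero]
  rw [h0, zero_add] at e
  rw [e]; rfl

lemma bil_mhi_apply_zero (M : ℕ) (σ τ₁ τ₂ : Bool) (t : ℝ) (x y : Coef N) :
    bil (mhi M σ τ₁ τ₂) (psi σ τ₁ τ₂) t x y 0 = 0 := by
  rw [bil_apply]
  refine Finset.sum_eq_zero fun l _ => ?_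
  rw [mhi_of_not_high fun h => h.1 rfl, zero_mul, zero_mul]

lemma bil_smul_left (m : ZMod (2 * N) → ZMod (2 * N) → ℂ) (ψ : ZMod (2 * N) → ZMod (2 * N) → ℝ)
    (t : ℝ) (c : ℂ) (x y : Coef N) : bil m ψ t (c • x) y = c • bil m ψ t x y := by
  ext k
  rw [PiLp.smul_apply, bil_apply, bil_apply, smul_eq_mul, Finset.mul_sum]
  refine Finset.sum_congr rfl fun l _ => ?_
  rw [PiLp.smul_apply, smul_eq_mul]; ring

lemma norm_two_smul_add_le (x y : Coef N) : ‖(2 : ℂ) • x + y‖ ≤ 2 * ‖x‖ + ‖y‖ := by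
  refine (norm_add_le _ _).trans ?_
  rw [norm_smul]; norm_num

end difference

/-- The difference between the coupled and the decoupled system. -/
theorem exists_cross_estimate {R : ℝ} (hR : 0 < R) : ∃ C T₀ : ℝ, 0 < C ∧ 0 < T₀ ∧ T₀ ≤ 1 ∧
    ∀ (N : ℕ) [NeZero N], ∀ κ : Bool → ℂ, (∀ σ, ‖κ σ‖ ≤ 1) →
    ∀ a g v w : Bool → ℝ → Coef N,
    (∀ σ t, HasDerivAt (a σ) (g σ t) t) → (∀ σ, Continuous (g σ)) →
    (∀ σ t, HasDerivAt (v σ) (w σ t) t) → (∀ σ, Continuous (w σ)) →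
    ∀ T ε : ℝ, 0 ≤ T → T ≤ T₀ →
    (∀ t ∈ Set.Icc 0 T, ∀ σ,
      g σ t = κ σ • quad ccC (mq N) σ t (fun τ => a τ t) (fun τ => a τ t)) →
    (∀ t ∈ Set.Icc 0 T, ∀ σ,
      w σ t = κ σ • quad ccD (mq N) σ t (fun τ => v τ t) (fun τ => v τ t)) →
    (∀ σ, a σ 0 = v σ 0) → (∀ σ, a σ 0 0 = 0) → (∀ σ, ‖a σ 0‖ ≤ R) →
    (∀ σ, ‖diag (fun k => chi k - 1) (a σ 0)‖ ≤ ε) →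
    ∀ σ, ∀ t ∈ Set.Icc 0 T, ‖a σ t - v σ t‖ ≤ C * ε := by
  obtain ⟨T₁, hT₁, hT₁1, hap⟩ := exists_a_priori hR
  obtain ⟨T₂, hT₂, hT₂1, hsh⟩ := exists_shift_estimate hR
  set Λ := 4 * R + 16000 * R ^ 2 with hΛ
  have hΛ0 : 0 < Λ := by positivity
  obtain ⟨T₃, hT₃, hT₃1, hlin⟩ := exists_linear_estimate hΛ0
  -- The linear estimate for the corrected difference with initial size 300000Rε and source
  -- 2000000000R²ε, a factor 3 from `XB` to ℓ², and finally the correction itself.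
  refine ⟨3 * (2 * (300000 * R + (1 + 60000 * Λ) * (2000000000 * R ^ 2))) + 300000 * R,
    min T₁ (min T₂ T₃), by positivity, by positivity, (min_le_left _ _).trans hT₁1, ?_⟩
  intro N _ κ hκ a g v w ha hg hv hw T ε hT hTT heqa heqv hav ha0 haR hε
  have hTT1 := hTT.trans (min_le_left _ _)
  have hTT2 := hTT.trans ((min_le_right _ _).trans (min_le_left _ _))
  have hTT3 := hTT.trans ((min_le_right _ _).trans (min_le_right _ _))
  have hT1 : T ≤ 1 := hTT1.trans hT₁1
  have hac := fun σ => continuous_of_hasDerivAt (ha σ)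
  have hvc := fun σ => continuous_of_hasDerivAt (hv σ)
  obtain ⟨haN, haZ, haX⟩ := hap N ccC abs_ccC_le κ hκ a g ha hg T hT hTT1
    (fun t ht _ => heqa t ht) ha0 haR
  obtain ⟨hvN, hvZ, hvX⟩ := hap N ccD abs_ccD_le κ hκ v w hv hw T hT hTT1
    (fun t ht _ => heqv t ht) (fun σ => by rw [← hav]; exact ha0 σ)
    (fun σ => by rw [← hav]; exact haR σ)
  obtain ⟨hdX, hdF⟩ := hsh N ccC abs_ccC_le κ hκ a g ha hg T ε hT hTT2 heqa haZ haX hε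
  have hε0 : 0 ≤ ε := (norm_nonneg _).trans (hε true)
  set X : Coef N → Coef N := diag (fun k => chi k - 1) with hX
  set F : Bool → ℝ → Coef N := fun σ t =>
    quad ccC (mone N) σ t (fun τ => a τ t) (fun τ => a τ t) with hF
  have hFc : ∀ σ, Continuous (F σ) := fun σ => continuous_quad hac hac σ
  have hFi : ∀ σ, ∫ t in (0 : ℝ)..T, ‖F σ t‖ ^ 2 ≤ (8000 * R ^ 2) ^ 2 := fun σ =>
    (integral_norm_quad_sq_le abs_ccC_le σ hT hT1 haX haX hac hac).trans
      (le_of_eq (by ring))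
  have hXFc : ∀ σ, Continuous fun t => X (F σ t) := fun σ => continuous_diag _ (hFc σ)
  set V : Bool → ℝ → Coef N := fun σ t =>
    quad ccD (mone N) σ t (fun τ => v τ t) (fun τ => v τ t) with hV
  have hVc : ∀ σ, Continuous (V σ) := fun σ => continuous_quad hvc hvc σ
  have hVi : ∀ σ, ∫ t in (0 : ℝ)..T, ‖V σ t‖ ^ 2 ≤ (8000 * R ^ 2) ^ 2 := fun σ =>
    (integral_norm_quad_sq_le abs_ccD_le σ hT hT1 hvX hvX hvc hvc).trans
      (le_of_eq (by ring))
  set Y : Bool → Bool → ℝ → Coef N := fun σ τ t =>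
    bil (mhi 0 σ τ false) (psi σ τ false) t (a (σ == τ) t) (a (!σ) t) with hY
  have hYc : ∀ σ τ, Continuous (Y σ τ) := fun σ τ => continuous_bil (hac _) (hac _)
  set Y' : Bool → Bool → ℝ → Coef N := fun σ τ t =>
    bil (fun k l => mhi 0 σ τ false k l * (Complex.I * psi σ τ false k l)) (psi σ τ false) t
      (a (σ == τ) t) (a (!σ) t) with hY'
  set G : Bool → Bool → ℝ → Coef N := fun σ τ t =>
    bil (mhi 0 σ τ false) (psi σ τ false) t (g (σ == τ) t) (a (!σ) t) +
      bil (mhi 0 σ τ false) (psi σ τ false) t (a (σ == τ) t) (g (!σ) t) with hG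
  have hY'c : ∀ σ τ, Continuous (Y' σ τ) := fun σ τ => continuous_bil (hac _) (hac _)
  have hGc : ∀ σ τ, Continuous (G σ τ) := fun σ τ =>
    (continuous_bil (hg _) (hac _)).fun_add (continuous_bil (hac _) (hg _))
  have hYd : ∀ σ τ t, HasDerivAt (Y σ τ) (Y' σ τ t + G σ τ t) t := fun σ τ t => by
    have := hasDerivAt_bil (m := mhi 0 σ τ false) (ψ := psi σ τ false) (ha (σ == τ) t) (ha (!σ) t)
    rw [add_assoc] at this
    exact this
  have hYeq : ∀ σ τ, ∀ t ∈ Set.Icc 0 T, Y' σ τ t =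
      bil (mq N τ false) (psi σ τ false) t (a (σ == τ) t) (a (!σ) t) := fun σ τ t ht =>
    bil_mhi_mul_psi σ τ false t (haZ _ t ht) (haZ _ t ht)
  have hXa : ∀ σ, ∀ t ∈ Set.Icc 0 T, ‖X (a σ t)‖ ≤ 6 * ε := fun σ t ht =>
    ((hdX σ).norm_le ht).trans (le_of_eq (by ring))
  have hYn : ∀ σ τ, ∀ t ∈ Set.Icc 0 T, ‖Y σ τ t‖ ≤ 70000 * R * ε := fun σ τ t ht => by
    refine (norm_bil_cross_le 0 σ τ t _ _).trans ?_
    calc 1600 * (‖a (σ == τ) t‖ * ‖X (a (!σ) t)‖) ≤ 1600 * (7 * R * (6 * ε)) := by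
          gcongr
          exacts [haN _ t ht, hXa _ t ht]
      _ ≤ _ := by have : 0 ≤ R * ε := by positivity
                  nlinarith
  -- The boundary term of the normal form that removes all cross terms at once; it is O(ε) at every
  -- time.
  set B : Bool → ℝ → Coef N := fun σ t => κ σ • ((2 : ℂ) • Y σ true t + Y σ false t) with hB
  have kk : ∀ σ (u : Coef N), ‖κ σ • u‖ ≤ ‖u‖ := fun σ u => by
    rw [norm_smul]; exact mul_le_of_le_one_left (norm_nonneg _) (hκ σ)
  have hBn : ∀ σ, ∀ t ∈ Set.Icc 0 T, ‖B σ t‖ ≤ 300000 * R * ε := fun σ t ht => by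
    refine ((kk _ _).trans (norm_two_smul_add_le _ _)).trans ?_
    have := hYn σ true t ht
    have := hYn σ false t ht
    have : 0 ≤ R * ε := by positivity
    linarith
  have hBc : ∀ σ, Continuous (B σ) := fun σ =>
    (((hYc σ true).fun_const_smul _).fun_add (hYc σ false)).fun_const_smul _
  set B' : Bool → ℝ → Coef N := fun σ t => κ σ •
    ((2 : ℂ) • (Y' σ true t + G σ true t) + (Y' σ false t + G σ false t)) with hB'
  have hBd : ∀ σ t, HasDerivAt (B σ) (B' σ t) t := fun σ t =>
    (((hYd σ true t).fun_const_smul _).fun_add (hYd σ false t)).fun_const_smul _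
  have hB'c : ∀ σ, Continuous (B' σ) := fun σ =>
    ((((hY'c σ true).fun_add (hGc σ true)).fun_const_smul _).fun_add
      ((hY'c σ false).fun_add (hGc σ false))).fun_const_smul _
  set s : Bool → ℝ → Coef N := fun σ t => a σ t + v σ t with hs
  have hsX : ∀ σ, XB T (s σ) (4 * R) := fun σ =>
    ((haX σ).add hT (hvX σ)).mono (by linarith)
  have hsd : ∀ σ t, HasDerivAt (s σ) (g σ t + w σ t) t := fun σ t => (ha σ t).fun_add (hv σ t)
  have hsc := fun σ => continuous_of_hasDerivAt (hsd σ)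
  -- The corrected difference solves the linearised decoupled equation. As the profiles agree
  -- initially, e(0) = -B(0).
  set e : Bool → ℝ → Coef N := fun σ t => a σ t - v σ t - B σ t with he
  have hed : ∀ σ t, HasDerivAt (e σ) (g σ t - w σ t - B' σ t) t := fun σ t =>
    ((ha σ t).fun_sub (hv σ t)).fun_sub (hBd σ t)
  set W : Bool → Bool → ℝ → Coef N := fun σ τ t =>
    bil (mq N true true) (psi σ true true) t (Y σ τ t) (s σ t) with hW
  have hWc : ∀ σ τ, Continuous (W σ τ) := fun σ τ => continuous_bil (hYc σ τ) (hsc σ)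
  set H : Bool → ℝ → Coef N := fun σ t =>
    κ σ • (κ σ • ((2 : ℂ) • W σ true t + W σ false t)) -
      κ σ • ((2 : ℂ) • G σ true t + G σ false t) with hH
  have hHc : ∀ σ, Continuous (H σ) := fun σ =>
    ((((((hWc σ true).fun_const_smul _).fun_add (hWc σ false)).fun_const_smul _).fun_const_smul
      _).fun_sub ((((hGc σ true).fun_const_smul _).fun_add (hGc σ false)).fun_const_smul _))
  have heq : ∀ σ, ∀ t ∈ Set.Icc 0 T, g σ t - w σ t - B' σ t =
      κ σ • quad ccD (mq N) σ t (fun τ => e τ t) (fun τ => s τ t) + H σ t := fun σ t ht => by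
    -- Replacing a - v by e in the linear term produces the trilinear source W; the source G is the
    -- normal form with a time derivative on an input.
    have h1 : quad ccD (mq N) σ t (fun τ => e τ t) (fun τ => s τ t) =
        (quad ccD (mq N) σ t (fun τ => a τ t) (fun τ => a τ t) -
          quad ccD (mq N) σ t (fun τ => v τ t) (fun τ => v τ t)) -
        κ σ • ((2 : ℂ) • W σ true t + W σ false t) := by
      rw [quad_mq_sub_quad]
      refine (quad_sub_left σ t (fun τ => a τ t - v τ t) (fun τ => B τ t) _).trans ?_
      congr 1
      rw [quad_ccD, hB, bil_smul_left, bil_add_left, bil_smul_left]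
    rw [h1, heqa t ht, heqv t ht, quad_ccC_mq, hB', hH]
    dsimp only
    rw [hYeq σ true t ht, hYeq σ false t ht]
    simp only [beq_true, beq_false]
    simp only [smul_add, smul_sub]
    abel
  have hGi : ∀ σ τ, ∫ t in (0 : ℝ)..T, ‖G σ τ t‖ ≤ 256000000 * (R ^ 2 * ε) := fun σ τ => by
    have hpt : ∀ t ∈ Set.Icc 0 T, ‖G σ τ t‖ ≤
        11200 * R * ‖X (F (σ == τ) t)‖ + 9600 * ε * ‖F (!σ) t‖ := fun t ht => by
      have hgF : ∀ σ k, k ≠ 0 → ‖g σ t k‖ ≤ ab k * ‖F σ t k‖ := fun σ k _ => by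
        rw [heqa t ht]; exact norm_smul_quad_mq_apply_le (hκ σ) _ _ _ _ _
      have n1 := norm_bil_cross_le_left 0 σ τ t (y := a (!σ) t) (hgF (σ == τ))
      have n2 := norm_bil_cross_le_right 0 σ τ t (x := a (σ == τ) t) (hgF (!σ))
      refine (norm_add_le _ _).trans ((add_le_add n1 n2).trans ?_)
      calc _ ≤ 1600 * (‖X (F (σ == τ) t)‖ * (7 * R)) + 1600 * (6 * ε * ‖F (!σ) t‖) := by
            gcongr
            exacts [haN _ t ht, hXa _ t ht]
        _ = _ := by ring
    have c1 : Continuous fun t => 11200 * R * ‖X (F (σ == τ) t)‖ :=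
      continuous_const.mul (hXFc _).norm
    have c2 : Continuous fun t => 9600 * ε * ‖F (!σ) t‖ := continuous_const.mul (hFc _).norm
    refine (intervalIntegral.integral_mono_on hT ((hGc σ τ).norm.intervalIntegrable _ _)
      ((c1.fun_add c2).intervalIntegrable _ _) hpt).trans ?_
    rw [intervalIntegral.integral_add (c1.intervalIntegrable _ _) (c2.intervalIntegrable _ _),
      intervalIntegral.integral_const_mul, intervalIntegral.integral_const_mul]
    have hsq : √T ≤ 1 := Real.sqrt_le_one.2 hT1
    have j1 : ∫ t in (0 : ℝ)..T, ‖X (F (σ == τ) t)‖ ≤ 16000 * R * ε :=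
      (integral_norm_le_sqrt (hXFc _) hT (by positivity) (hdF _)).trans
        (mul_le_of_le_one_left (by positivity) hsq)
    have j2 : ∫ t in (0 : ℝ)..T, ‖F (!σ) t‖ ≤ 8000 * R ^ 2 :=
      (integral_norm_le_sqrt (hFc _) hT (by positivity) (hFi _)).trans
        (mul_le_of_le_one_left (by positivity) hsq)
    calc _ ≤ 11200 * R * (16000 * R * ε) + 9600 * ε * (8000 * R ^ 2) := by gcongr
      _ = _ := by ring
  have hWi : ∀ σ τ, ∫ t in (0 : ℝ)..T, ‖W σ τ t‖ ≤ 96000000 * (R ^ 2 * ε) := fun σ τ =>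
    (integral_norm_bil_bil_le σ τ hT hT1 (hac _) (hac _) (hsc σ) (haX _) (haX _) (hsX σ)
      (hdX _) (hdX _)).trans (le_of_eq (by ring))
  have hHi : ∀ σ, ∫ t in (0 : ℝ)..T, ‖H σ t‖ ≤ 2000000000 * R ^ 2 * ε := fun σ => by
    have hpt : ∀ t ∈ Set.Icc 0 T, ‖H σ t‖ ≤ (2 * ‖W σ true t‖ + ‖W σ false t‖) +
        (2 * ‖G σ true t‖ + ‖G σ false t‖) := fun t _ =>
      (norm_sub_le _ _).trans (add_le_add
        (((kk _ _).trans (kk _ _)).trans (norm_two_smul_add_le _ _))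
        ((kk _ _).trans (norm_two_smul_add_le _ _)))
    have d1 : Continuous fun t => 2 * ‖W σ true t‖ := continuous_const.mul (hWc _ _).norm
    have d2 : Continuous fun t => 2 * ‖G σ true t‖ := continuous_const.mul (hGc _ _).norm
    have d3 : Continuous fun t => 2 * ‖W σ true t‖ + ‖W σ false t‖ := d1.add (hWc _ _).norm
    have d4 : Continuous fun t => 2 * ‖G σ true t‖ + ‖G σ false t‖ := d2.add (hGc _ _).norm
    refine (intervalIntegral.integral_mono_on hT ((hHc σ).norm.intervalIntegrable _ _)
      ((d3.fun_add d4).intervalIntegrable _ _) hpt).trans ?_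
    rw [intervalIntegral.integral_add (d3.intervalIntegrable _ _) (d4.intervalIntegrable _ _),
      intervalIntegral.integral_add (d1.intervalIntegrable _ _)
        ((hWc _ _).norm.intervalIntegrable _ _),
      intervalIntegral.integral_add (d2.intervalIntegrable _ _)
        ((hGc _ _).norm.intervalIntegrable _ _),
      intervalIntegral.integral_const_mul, intervalIntegral.integral_const_mul]
    have := hWi σ true
    have := hWi σ false
    have := hGi σ true
    have := hGi σ false
    have : 0 ≤ R ^ 2 * ε := by positivity
    linarith
  have hBz : ∀ σ t, B σ t 0 = 0 := fun σ t => by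
    rw [hB]
    simp only [PiLp.smul_apply, PiLp.add_apply]
    rw [hY]
    simp only [bil_mhi_apply_zero, smul_zero, add_zero]
  intro σ t ht
  have key := hlin N ccD abs_ccD_le κ hκ e s (fun σ t => g σ t - w σ t - B' σ t)
    (fun σ t => g σ t + w σ t) (fun σ t => F σ t + V σ t) H hed
    (fun σ => ((hg σ).fun_sub (hw σ)).fun_sub (hB'c σ)) hsd (fun σ => (hg σ).fun_add (hw σ))
    (fun σ => (hFc σ).fun_add (hVc σ)) hHc T (2000000000 * R ^ 2 * ε) (300000 * R * ε) hT hTT3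
    (fun σ t ht => by
      rw [he]
      simp only [PiLp.sub_apply, hBz, haZ σ t ht, hvZ σ t ht, sub_zero])
    (fun σ t ht => by rw [hs, PiLp.add_apply, haZ σ t ht, hvZ σ t ht, add_zero]) heq
    (fun σ t ht k _ => by
      have h1 : (g σ t + w σ t) k = κ σ * (qSym k * (F σ t + V σ t) k) := by
        rw [heqa t ht, heqv t ht, PiLp.add_apply, PiLp.smul_apply, PiLp.smul_apply, quad_mq_apply,
          quad_mq_apply, PiLp.add_apply, smul_eq_mul, smul_eq_mul]
        ring
      rw [h1, norm_mul, norm_mul, Complex.norm_real, Real.norm_eq_abs]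
      refine (mul_le_of_le_one_left (by positivity) (hκ σ)).trans ?_
      gcongr
      exact abs_qSym_le k)
    (fun σ => (hsX σ).mono (by rw [hΛ]; nlinarith)) (fun σ => by
      have hpt : ∀ t ∈ Set.Icc 0 T, ‖F σ t + V σ t‖ ^ 2 ≤ 2 * ‖F σ t‖ ^ 2 + 2 * ‖V σ t‖ ^ 2 :=
        fun t _ => by
        have h1 := pow_le_pow_left₀ (norm_nonneg _) (norm_add_le (F σ t) (V σ t)) 2
        nlinarith [sq_nonneg (‖F σ t‖ - ‖V σ t‖)]
      have d1 : Continuous fun t => 2 * ‖F σ t‖ ^ 2 := continuous_const.mul ((hFc σ).norm.pow 2)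
      have d2 : Continuous fun t => 2 * ‖V σ t‖ ^ 2 := continuous_const.mul ((hVc σ).norm.pow 2)
      refine (intervalIntegral.integral_mono_on hT
        ((((hFc σ).fun_add (hVc σ)).norm.pow 2).intervalIntegrable _ _)
        ((d1.fun_add d2).intervalIntegrable _ _) hpt).trans ?_
      rw [intervalIntegral.integral_add (d1.intervalIntegrable _ _) (d2.intervalIntegrable _ _),
        intervalIntegral.integral_const_mul, intervalIntegral.integral_const_mul]
      have h1 := hFi σ
      have h2 := hVi σ
      have h3 : (16000 * R ^ 2) ^ 2 ≤ Λ ^ 2 := by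
        refine pow_le_pow_left₀ (by positivity) ?_ 2
        rw [hΛ]; linarith
      linarith) hHi (fun σ => by
      rw [he]
      simp only [hav σ, sub_self, zero_sub, norm_neg]
      exact hBn σ 0 ⟨le_rfl, hT⟩) σ
  have h1 := key.norm_le ht
  have h2 : a σ t - v σ t = e σ t + B σ t := (sub_add_cancel _ _).symm
  rw [h2]
  refine (norm_add_le _ _).trans ((add_le_add h1 (hBn σ t ht)).trans (le_of_eq ?_))
  ring

/-! ### Discrete Fourier transform -/

section fourier
variable {N : ℕ} [NeZero N]

/-- The exponent is 2πi nk/(2N), so the exponentials are additive characters and neither choice of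
representative matters. -/
lemma exp_point_mul_rep (n k : ZMod (2 * N)) :
    Complex.exp (Complex.I * (point N n : ℂ) * (rep k : ℂ)) = ZMod.stdAddChar (n * k) := by
  have e : n * k = ((n.val * rep k : ℤ) : ZMod (2 * N)) := by
    push_cast
    rw [ZMod.natCast_zmod_val, rep_cast]
  have hN : (N : ℂ) ≠ 0 := Nat.cast_ne_zero.2 (NeZero.ne N)
  rw [e, ZMod.stdAddChar_coe]
  congr 1
  unfold point mesh
  push_cast
  field_simp

lemma sum_stdAddChar (n : ZMod (2 * N)) :
    ∑ k : ZMod (2 * N), (ZMod.stdAddChar (k * n) : ℂ) = if n = 0 then (2 * N : ℂ) else 0 := by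
  rw [AddChar.sum_mulShift n (ZMod.isPrimitive_stdAddChar (2 * N)), ZMod.card]
  split_ifs <;> simp

/-- The Fourier coefficients as a vector indexed by the frequencies modulo `2N`. -/
def hat (f : ZMod (2 * N) → ℂ) : Coef N := WithLp.toLp 2 fun k => latticeFourier N f (rep k)

lemma hat_apply (f : ZMod (2 * N) → ℂ) (k : ZMod (2 * N)) :
    hat f k = ((mesh N / √(2 * π) : ℝ) : ℂ) * ∑ n, f n * ZMod.stdAddChar (-(n * k)) := by
  change latticeFourier N f (rep k) = _
  unfold latticeFourier
  congr 1
  refine Finset.sum_congr rfl fun n _ => ?_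
  rw [AddChar.map_neg_eq_inv, ← exp_point_mul_rep, Complex.exp_neg]

/-- The inverse Fourier transform. -/
def ihat (x : Coef N) : ZMod (2 * N) → ℂ := latticeFourierInv N fun z => x (z : ZMod (2 * N))

lemma ihat_apply (x : Coef N) (n : ZMod (2 * N)) :
    ihat x n = ((1 / √(2 * π) : ℝ) : ℂ) * ∑ k, x k * ZMod.stdAddChar (n * k) := by
  unfold ihat latticeFourierInv
  rw [sum_freq]
  congr 1
  refine Finset.sum_congr rfl fun k _ => ?_
  dsimp only
  rw [exp_point_mul_rep, rep_cast]

lemma mesh_div_mul (N : ℕ) [NeZero N] :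
    mesh N / √(2 * π) * (1 / √(2 * π)) * (2 * N) = 1 := by
  have h : √(2 * π) * √(2 * π) = 2 * π := Real.mul_self_sqrt (by positivity)
  have h2 := mesh_mul N
  rw [div_mul_div_comm, h, mul_one, div_mul_eq_mul_div, div_eq_one_iff_eq (by positivity)]
  linarith

lemma hat_ihat (x : Coef N) : hat (ihat x) = x := by
  ext k
  rw [hat_apply]
  simp only [ihat_apply, Finset.mul_sum, Finset.sum_mul]
  rw [Finset.sum_comm]
  have e : ∀ l, ∑ n : ZMod (2 * N), ((mesh N / √(2 * π) : ℝ) : ℂ) * (((1 / √(2 * π) : ℝ) : ℂ) *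
      (x l * ZMod.stdAddChar (n * l)) * ZMod.stdAddChar (-(n * k))) =
      if l = k then x k else 0 := fun l => by
    have e1 : ∀ n : ZMod (2 * N), ((mesh N / √(2 * π) : ℝ) : ℂ) * (((1 / √(2 * π) : ℝ) : ℂ) *
      (x l * ZMod.stdAddChar (n * l)) * ZMod.stdAddChar (-(n * k))) =
      ((mesh N / √(2 * π) : ℝ) : ℂ) * ((1 / √(2 * π) : ℝ) : ℂ) * x l *
        ZMod.stdAddChar (n * (l - k)) := fun n => by
      rw [mul_sub, sub_eq_add_neg, AddChar.map_add_eq_mul]; ring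
    simp only [e1]
    rw [← Finset.mul_sum, sum_stdAddChar]
    have h := mesh_div_mul N
    have h' : ((mesh N / √(2 * π) : ℝ) : ℂ) * ((1 / √(2 * π) : ℝ) : ℂ) * (2 * N) = 1 := by
      exact_mod_cast h
    by_cases hl : l = k
    · subst hl
      rw [if_pos (sub_self l), if_pos rfl]
      linear_combination x l * h'
    · rw [if_neg (sub_ne_zero.2 hl), if_neg hl, mul_zero]
  simp only [e]
  simp

lemma ihat_hat (f : ZMod (2 * N) → ℂ) : ihat (hat f) = f := by
  ext n
  rw [ihat_apply]
  simp only [hat_apply, Finset.mul_sum, Finset.sum_mul]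
  rw [Finset.sum_comm]
  have e : ∀ m, ∑ k : ZMod (2 * N), ((1 / √(2 * π) : ℝ) : ℂ) * (((mesh N / √(2 * π) : ℝ) : ℂ) *
      (f m * ZMod.stdAddChar (-(m * k))) * ZMod.stdAddChar (n * k)) =
      if m = n then f n else 0 := fun m => by
    have e1 : ∀ k : ZMod (2 * N), ((1 / √(2 * π) : ℝ) : ℂ) * (((mesh N / √(2 * π) : ℝ) : ℂ) *
      (f m * ZMod.stdAddChar (-(m * k))) * ZMod.stdAddChar (n * k)) =
      ((mesh N / √(2 * π) : ℝ) : ℂ) * ((1 / √(2 * π) : ℝ) : ℂ) * f m *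
        ZMod.stdAddChar (k * (n - m)) := fun k => by
      have : k * (n - m) = -(m * k) + n * k := by ring
      rw [this, AddChar.map_add_eq_mul]; ring
    simp only [e1]
    rw [← Finset.mul_sum, sum_stdAddChar]
    have h := mesh_div_mul N
    have h' : ((mesh N / √(2 * π) : ℝ) : ℂ) * ((1 / √(2 * π) : ℝ) : ℂ) * (2 * N) = 1 := by
      exact_mod_cast h
    by_cases hl : m = n
    · subst hl
      rw [if_pos (sub_self m), if_pos rfl]
      linear_combination f m * h'
    · rw [if_neg (sub_ne_zero.2 (Ne.symm hl)), if_neg hl, mul_zero]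
  simp only [e]
  simp

lemma hat_injective : Function.Injective (hat : (ZMod (2 * N) → ℂ) → Coef N) :=
  Function.LeftInverse.injective ihat_hat

lemma hat_multiplier (m : ℤ → ℂ) (f : ZMod (2 * N) → ℂ) (k : ZMod (2 * N)) :
    hat (multiplier N m f) k = m (rep k) * hat f k := by
  have e : multiplier N m f = ihat (WithLp.toLp 2 fun k => m (rep k) * hat f k) := by
    ext n
    rw [ihat_apply]
    unfold multiplier latticeFourierInv
    rw [sum_freq]
    congr 1
    refine Finset.sum_congr rfl fun k _ => ?_
    rw [exp_point_mul_rep]; rfl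
  rw [e, hat_ihat]

lemma hat_add (f g : ZMod (2 * N) → ℂ) : hat (f + g) = hat f + hat g := by
  ext k
  simp only [PiLp.add_apply, hat_apply, Pi.add_apply, add_mul, Finset.sum_add_distrib, mul_add]

lemma hat_smul (c : ℂ) (f : ZMod (2 * N) → ℂ) : hat (c • f) = c • hat f := by
  ext k
  simp only [PiLp.smul_apply, hat_apply, Pi.smul_apply, smul_eq_mul, Finset.mul_sum]
  exact Finset.sum_congr rfl fun n _ => by ring

lemma hat_sub (f g : ZMod (2 * N) → ℂ) : hat (f - g) = hat f - hat g := by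
  ext k
  simp only [PiLp.sub_apply, hat_apply, Pi.sub_apply, sub_mul, Finset.sum_sub_distrib, mul_sub]

/-- The convolution is modulo 2N: this is the source of aliasing. -/
lemma hat_mul (f g : ZMod (2 * N) → ℂ) (k : ZMod (2 * N)) :
    hat (f * g) k = ((1 / √(2 * π) : ℝ) : ℂ) * ∑ l, hat f l * hat g (k - l) := by
  have e : f * g = ihat (WithLp.toLp 2 fun k =>
      ((1 / √(2 * π) : ℝ) : ℂ) * ∑ l, hat f l * hat g (k - l)) := by
    ext n
    rw [Pi.mul_apply]
    nth_rewrite 1 [← ihat_hat f]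
    nth_rewrite 1 [← ihat_hat g]
    rw [ihat_apply, ihat_apply, ihat_apply]
    simp only [Finset.mul_sum, Finset.sum_mul]
    rw [Finset.sum_comm (s := Finset.univ) (t := Finset.univ)
      (f := fun k l => ((1 / √(2 * π) : ℝ) : ℂ) * (((1 / √(2 * π) : ℝ) : ℂ) *
        (hat f l * hat g (k - l)) * ZMod.stdAddChar (n * k)))]
    refine Finset.sum_comm.trans (Finset.sum_congr rfl fun l _ => ?_)
    rw [← sum_sub_right l]
    refine Finset.sum_congr rfl fun k _ => ?_
    have : n * k = n * l + n * (k - l) := by ring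
    rw [this, AddChar.map_add_eq_mul]; ring
  rw [e, hat_ihat]

lemma norm_hat_sq (f : ZMod (2 * N) → ℂ) : ‖hat f‖ ^ 2 = mesh N * ∑ n, ‖f n‖ ^ 2 := by
  have h : ∑ k, hat f k * (starRingEnd ℂ) (hat f k) =
      (mesh N : ℂ) * ∑ n, f n * (starRingEnd ℂ) (f n) := by
    have e : ∀ k, hat f k * (starRingEnd ℂ) (hat f k) = ((mesh N / √(2 * π) : ℝ) : ℂ) *
        ∑ n, (starRingEnd ℂ) (f n) * (ZMod.stdAddChar (n * k) * hat f k) := fun k => by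
      nth_rewrite 2 [hat_apply]
      rw [map_mul, Complex.conj_ofReal, map_sum, mul_left_comm, Finset.mul_sum]
      congr 1
      refine Finset.sum_congr rfl fun n _ => ?_
      rw [map_mul, AddChar.map_neg_eq_conj, Complex.conj_conj]; ring
    simp only [e]
    rw [← Finset.mul_sum, Finset.sum_comm, Finset.mul_sum, Finset.mul_sum]
    refine Finset.sum_congr rfl fun n _ => ?_
    have h1 := congrFun (ihat_hat f) n
    rw [ihat_apply] at h1
    rw [← Finset.mul_sum]
    have h2 : ∑ k, ZMod.stdAddChar (n * k) * hat f k = ∑ k, hat f k * ZMod.stdAddChar (n * k) :=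
      Finset.sum_congr rfl fun _ _ => mul_comm _ _
    rw [h2]
    push_cast at h1 ⊢
    linear_combination (mesh N : ℂ) * (starRingEnd ℂ) (f n) * h1
  have e : ∀ z : ℂ, z * (starRingEnd ℂ) z = ((‖z‖ ^ 2 : ℝ) : ℂ) := fun z => by
    rw [Complex.mul_conj, Complex.normSq_eq_norm_sq]
  simp only [e] at h
  rw [norm_sq_eq_sum]
  exact_mod_cast h

lemma l2Norm_eq (f : ZMod (2 * N) → ℂ) : l2Norm N f = ‖hat f‖ := by
  rw [l2Norm, ← norm_hat_sq, Real.sqrt_sq (norm_nonneg _)]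

lemma hat_apply_zero {f : ZMod (2 * N) → ℂ} (h : ∑ n, f n = 0) : hat f 0 = 0 := by
  rw [hat_apply]
  simp [h]

lemma sobolevNorm_sq (s : ℝ) (f : ZMod (2 * N) → ℂ) :
    sobolevNorm N s f ^ 2 = ∑ k, (1 + ab k ^ 2) ^ s * ‖hat f k‖ ^ 2 := by
  rw [sobolevNorm, Real.sq_sqrt (Finset.sum_nonneg fun _ _ => by positivity), sum_freq]
  refine Finset.sum_congr rfl fun k _ => ?_
  rw [ab, sq_abs]; rfl

lemma sobolevNorm_nonneg (s : ℝ) (f : ZMod (2 * N) → ℂ) : 0 ≤ sobolevNorm N s f :=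
  Real.sqrt_nonneg _

lemma norm_hat_le {s : ℝ} (hs : 0 ≤ s) (f : ZMod (2 * N) → ℂ) : ‖hat f‖ ≤ sobolevNorm N s f := by
  refine norm_le_of_sum_sq_le (sobolevNorm_nonneg _ _) ?_
  rw [sobolevNorm_sq]
  refine Finset.sum_le_sum fun k _ => ?_
  exact le_mul_of_one_le_left (sq_nonneg _)
    (Real.one_le_rpow (by linarith [sq_nonneg (ab k)]) hs)

/-- Split at x = 1. The constant does not depend on s, as the uniformity of the final estimate
requires. -/
lemma min_le_two_mul_rpow {x s : ℝ} (hx : 0 ≤ x) (hs : 0 < s) (hs1 : s ≤ 1) :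
    min x 2 ≤ 2 * x ^ s := by
  rcases le_total x 1 with h | h
  · have h1 : x ≤ x ^ s := by
      rcases hx.eq_or_lt with h0 | h0
      · rw [← h0, Real.zero_rpow hs.ne']
      · nth_rewrite 1 [← Real.rpow_one x]
        exact Real.rpow_le_rpow_of_exponent_ge h0 h hs1
    have := min_le_left x 2
    linarith
  · have h1 : 1 ≤ x ^ s := Real.one_le_rpow h hs.le
    have := min_le_right x 2
    linarith

/-- The origin of the rate h^s: |chi(k) - 1| ≤ min(h|k|, 2) ≤ 2(h|k|)^s. -/
lemma norm_diag_chi_hat_le {s : ℝ} (hs : 0 < s) (hs1 : s ≤ 1) (f : ZMod (2 * N) → ℂ) :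
    ‖diag (fun k => chi k - 1) (hat f)‖ ≤ 2 * mesh N ^ s * sobolevNorm N s f := by
  have hh := mesh_pos N
  have hS := sobolevNorm_nonneg s f
  refine norm_le_of_sum_sq_le (by positivity) ?_
  rw [mul_pow, sobolevNorm_sq, Finset.mul_sum]
  refine Finset.sum_le_sum fun k _ => ?_
  have hab := ab_nonneg k
  have h1 : ‖chi k - 1‖ ≤ 2 * (mesh N * ab k) ^ s := by
    refine le_trans (le_min (norm_chi_sub_one_le k) ?_)
      (min_le_two_mul_rpow (by positivity) hs hs1)
    refine (norm_sub_le _ _).trans ?_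
    rw [norm_chi, norm_one]; norm_num
  have h2 : (ab k ^ s) ^ 2 ≤ (1 + ab k ^ 2) ^ s := by
    rw [← Real.rpow_natCast, ← Real.rpow_mul hab, mul_comm s, Real.rpow_mul hab, Real.rpow_natCast]
    exact Real.rpow_le_rpow (by positivity) (by linarith) hs.le
  rw [diag_apply, norm_mul, mul_pow]
  have h3 : ‖chi k - 1‖ ^ 2 ≤ (2 * mesh N ^ s) ^ 2 * (1 + ab k ^ 2) ^ s := by
    calc ‖chi k - 1‖ ^ 2 ≤ (2 * (mesh N * ab k) ^ s) ^ 2 := by gcongr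
      _ = (2 * mesh N ^ s) ^ 2 * (ab k ^ s) ^ 2 := by
        rw [Real.mul_rpow hh.le hab]; ring
      _ ≤ _ := by gcongr
  calc _ ≤ (2 * mesh N ^ s) ^ 2 * (1 + ab k ^ 2) ^ s * ‖hat f k‖ ^ 2 := by gcongr
    _ = _ := by ring

end fourier

/-! ### Profiles and their equations -/

section profile
variable {N : ℕ} [NeZero N]

/-- The phase factor `e^{iθt}`. -/
def cis (θ t : ℝ) : ℂ := Complex.exp ((θ * t : ℝ) * Complex.I)

lemma norm_cis (θ t : ℝ) : ‖cis θ t‖ = 1 := Complex.norm_exp_ofReal_mul_I _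

lemma cis_mul (θ η t : ℝ) : cis θ t * cis η t = cis (θ + η) t := by
  unfold cis
  rw [← Complex.exp_add, ← add_mul, ← Complex.ofReal_add, ← add_mul]

lemma cis_neg_mul (θ t : ℝ) : cis (-θ) t * cis θ t = 1 := by
  rw [cis_mul, neg_add_cancel]; simp [cis]

lemma cis_mul_neg (θ t : ℝ) : cis θ t * cis (-θ) t = 1 := by rw [mul_comm, cis_neg_mul]

lemma cis_sub (θ t r : ℝ) : cis θ (t - r) = cis θ t * cis (-θ) r := by
  unfold cis
  rw [← Complex.exp_add, ← add_mul, ← Complex.ofReal_add]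
  congr 3; ring

lemma continuous_cis (θ : ℝ) : Continuous (cis θ) := by unfold cis; fun_prop

/-- The profile of a wave in direction `σ` at time `t`. -/
def prof (σ : Bool) (t : ℝ) (f : ZMod (2 * N) → ℂ) : Coef N :=
  diag (fun k => cis (-(sg σ * th true k)) t) (hat f)

/-- The wave in direction `σ` at time `t` with a given profile. -/
def unprof (σ : Bool) (t : ℝ) (x : Coef N) : ZMod (2 * N) → ℂ :=
  ihat (diag (fun k => cis (sg σ * th true k) t) x)

lemma prof_apply (σ : Bool) (t : ℝ) (f : ZMod (2 * N) → ℂ) (k : ZMod (2 * N)) :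
    prof σ t f k = cis (-(sg σ * th true k)) t * hat f k := rfl

lemma prof_unprof (σ : Bool) (t : ℝ) (x : Coef N) : prof σ t (unprof σ t x) = x := by
  ext k
  rw [prof_apply, unprof, hat_ihat, diag_apply, ← mul_assoc, cis_neg_mul, one_mul]

lemma prof_sub (σ : Bool) (t : ℝ) (f g : ZMod (2 * N) → ℂ) :
    prof σ t (f - g) = prof σ t f - prof σ t g := by
  rw [prof, hat_sub, diag_sub]; rfl

lemma norm_prof (σ : Bool) (t : ℝ) (f : ZMod (2 * N) → ℂ) : ‖prof σ t f‖ = ‖hat f‖ := by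
  refine le_antisymm (norm_le_norm_of_le fun k => ?_) (norm_le_norm_of_le fun k => ?_) <;>
    rw [prof_apply, norm_mul, norm_cis, one_mul]

lemma continuousOn_coef {S : Set ℝ} {x : ℝ → Coef N} :
    ContinuousOn x S ↔ ∀ k, ContinuousOn (fun t => x t k) S := by
  rw [continuousOn_iff_continuous_domRestrict, continuous_coef]
  simp only [continuousOn_iff_continuous_domRestrict]
  rfl

/-- A Fourier coefficient as a continuous linear map. -/
def hatL (k : ZMod (2 * N)) : (ZMod (2 * N) → ℂ) →L[ℂ] ℂ :=
  LinearMap.toContinuousLinearMap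
    { toFun := fun f => hat f k
      map_add' := fun f g => by rw [hat_add, PiLp.add_apply]
      map_smul' := fun c f => by rw [hat_smul, PiLp.smul_apply]; rfl }

lemma continuousOn_hat {S : Set ℝ} {G : ℝ → ZMod (2 * N) → ℂ} (hG : ContinuousOn G S)
    (k : ZMod (2 * N)) : ContinuousOn (fun t => hat (G t) k) S :=
  (hatL k).continuous.comp_continuousOn hG

lemma continuousOn_of_hat {S : Set ℝ} {G : ℝ → ZMod (2 * N) → ℂ}
    (hG : ∀ k, ContinuousOn (fun t => hat (G t) k) S) : ContinuousOn G S := by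
  refine continuousOn_pi.2 fun n => ?_
  have e : ∀ t, G t n = ((1 / √(2 * π) : ℝ) : ℂ) * ∑ k, hat (G t) k * ZMod.stdAddChar (n * k) :=
    fun t => by rw [← ihat_apply, ihat_hat]
  simp only [e]
  exact continuousOn_const.mul (continuousOn_finsetSum _ fun k _ => (hG k).mul continuousOn_const)

lemma hat_integral {G : ℝ → ZMod (2 * N) → ℂ} {a b : ℝ} (hG : ContinuousOn G (Set.uIcc a b))
    (k : ZMod (2 * N)) : hat (∫ t in a..b, G t) k = ∫ t in a..b, hat (G t) k :=
  ((hatL k).intervalIntegral_comp_comm hG.intervalIntegrable).symm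

lemma nablaSymbol_rep (k : ZMod (2 * N)) : nablaSymbol N (rep k) = Complex.I * qSym k := rfl

lemma hat_propagator (σ : Bool) (t : ℝ) (f : ZMod (2 * N) → ℂ) (k : ZMod (2 * N)) :
    hat (propagator N (sg σ) t f) k = cis (sg σ * th true k) t * hat f k := by
  unfold propagator
  rw [hat_multiplier]
  congr 1
  unfold cis
  congr 1
  rw [nablaSymbol_rep, partialSymbol]
  have h : sg σ * th true k * t = -sg σ * (t / mesh N ^ 2) * (qSym k - rep k) := by
    have := (mesh_pos N).ne'
    unfold th qSym
    rw [sg_true]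
    field_simp
    ring
  rw [h]
  push_cast
  ring

lemma hat_duhamel (σ : Bool) (f : ZMod (2 * N) → ℂ) {F : ℝ → ZMod (2 * N) → ℂ} {t : ℝ}
    (hF : ContinuousOn F (Set.uIcc 0 t)) (k : ZMod (2 * N)) :
    hat (duhamel N (sg σ) f F t) k = cis (sg σ * th true k) t *
      (hat f k + ∫ t' in (0 : ℝ)..t, -((sg σ / 4 : ℝ) : ℂ) * (Complex.I * qSym k *
        (cis (-(sg σ * th true k)) t' * hat (F t') k))) := by
  have e : ∀ (t' : ℝ) (k : ZMod (2 * N)), hat (propagator N (sg σ) (t - t') (nabla N (F t'))) k =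
      cis (sg σ * th true k) t * (Complex.I * qSym k *
        (cis (-(sg σ * th true k)) t' * hat (F t') k)) := fun t' k => by
    rw [hat_propagator, nabla, hat_multiplier, nablaSymbol_rep, cis_sub]; ring
  have hc : ContinuousOn (fun t' => propagator N (sg σ) (t - t') (nabla N (F t')))
      (Set.uIcc 0 t) := continuousOn_of_hat fun k => by
    simp only [e]
    exact continuousOn_const.mul (continuousOn_const.mul
      ((continuous_cis _).continuousOn.mul (continuousOn_hat hF k)))
  unfold duhamel
  have e1 : ∀ v : ZMod (2 * N) → ℂ, (sg σ / 4) • v = ((sg σ / 4 : ℝ) : ℂ) • v := fun v => by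
    ext n; simp
  rw [hat_sub, e1, hat_smul, PiLp.sub_apply, PiLp.smul_apply, hat_propagator, hat_integral hc,
    smul_eq_mul]
  simp only [e]
  rw [intervalIntegral.integral_const_mul, intervalIntegral.integral_const_mul (-_)]
  ring

/-- The squared sum of waves, with coupling constant `cc false`. -/
def force (cc : Bool → ℝ) (σ : Bool) (t : ℝ) (f : Bool → ZMod (2 * N) → ℂ) : ZMod (2 * N) → ℂ :=
  (f σ + (cc false : ℂ) • translation N (sg σ * (2 * t / mesh N ^ 2)) (f !σ)) ^ 2


/-- Since th true + th false = 2k/h², the phase translation makes the opposite wave oscillate with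
`th false` in the frame of σ. -/
lemma hat_wave {cc : Bool → ℝ} (hcc : cc true = 1) (σ : Bool) (t : ℝ)
    (f : Bool → ZMod (2 * N) → ℂ) (k : ZMod (2 * N)) :
    hat (f σ + (cc false : ℂ) • translation N (sg σ * (2 * t / mesh N ^ 2)) (f !σ)) k =
      ∑ τ, (cc τ : ℂ) * (cis (sg σ * th τ k) t * prof (σ == τ) t (f (σ == τ)) k) := by
  have e : Complex.exp (((sg σ * (2 * t / mesh N ^ 2) : ℝ) : ℂ) * partialSymbol (rep k)) =
      cis (sg σ * th false k) t * cis (-(sg (!σ) * th true k)) t := by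
    rw [cis_mul]
    unfold cis partialSymbol
    congr 1
    have h : (sg σ * th false k + -(sg (!σ) * th true k)) * t =
        sg σ * (2 * t / mesh N ^ 2) * rep k := by
      rw [sg_not]
      unfold th
      rw [sg_true, sg_false]
      ring
    rw [h]
    push_cast
    ring
  rw [hat_add, hat_smul, PiLp.add_apply, PiLp.smul_apply, smul_eq_mul, translation,
    hat_multiplier, e, Fintype.sum_bool, hcc, beq_true, beq_false, prof_apply, prof_apply,
    ← mul_assoc (cis (sg σ * th true k) t), cis_mul_neg]
  push_cast
  ring

/-- Squaring adds the phases of the two inputs; factoring out the linear flow of the output leaves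
exactly `psi`. -/
lemma hat_force {cc : Bool → ℝ} (hcc : cc true = 1) (σ : Bool) (t : ℝ)
    (f : Bool → ZMod (2 * N) → ℂ) (k : ZMod (2 * N)) :
    hat (force cc σ t f) k = ((1 / √(2 * π) : ℝ) : ℂ) * (cis (sg σ * th true k) t *
      quad cc (mone N) σ t (fun τ => prof τ t (f τ)) (fun τ => prof τ t (f τ)) k) := by
  unfold force
  rw [sq, hat_mul]
  congr 1
  simp only [hat_wave hcc]
  have h : ∀ τ₁ τ₂ l, cis (sg σ * th true k) t *
      Complex.exp ((psi σ τ₁ τ₂ k l * t : ℝ) * Complex.I) =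
      cis (sg σ * th τ₁ l) t * cis (sg σ * th τ₂ (k - l)) t := fun τ₁ τ₂ l => by
    change _ * cis _ t = _
    rw [cis_mul, cis_mul, psi]
    congr 1; ring
  simp only [quad, Fintype.sum_bool, PiLp.add_apply, PiLp.smul_apply, bil_apply, mone, one_mul,
    smul_eq_mul, Finset.mul_sum, ← Finset.sum_add_distrib]
  refine Finset.sum_congr rfl fun l _ => ?_
  simp only [Complex.ofReal_mul (cc true), Complex.ofReal_mul (cc false)]
  linear_combination
    -(cc true * cc true * prof (σ == true) t (f (σ == true)) l *
      prof (σ == true) t (f (σ == true)) (k - l)) * h true true l -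
    (cc true * cc false * prof (σ == true) t (f (σ == true)) l *
      prof (σ == false) t (f (σ == false)) (k - l)) * h true false l -
    (cc false * cc true * prof (σ == false) t (f (σ == false)) l *
      prof (σ == true) t (f (σ == true)) (k - l)) * h false true l -
    (cc false * cc false * prof (σ == false) t (f (σ == false)) l *
      prof (σ == false) t (f (σ == false)) (k - l)) * h false false l

lemma contDiff_quad (cc : Bool → ℝ) (m : Bool → Bool → ZMod (2 * N) → ZMod (2 * N) → ℂ)
    (σ : Bool) {n : ℕ∞} :
    ContDiff ℝ n fun p : ℝ × (Bool → Coef N) => quad cc m σ p.1 p.2 p.2 := by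
  rw [contDiff_piLp]
  intro k
  have hc : ∀ τ l, ContDiff ℝ n fun p : ℝ × (Bool → Coef N) => p.2 τ l := fun τ l =>
    (contDiff_piLp_apply (p := 2)).comp (contDiff_apply ℝ (Coef N) τ |>.comp contDiff_snd)
  have he : ∀ a : ℝ, ContDiff ℝ n fun p : ℝ × (Bool → Coef N) =>
      Complex.exp ((a * p.1 : ℝ) * Complex.I) := fun a =>
    ((Complex.ofRealCLM.contDiff.comp (contDiff_const.mul contDiff_fst)).mul contDiff_const).cexp
  simp only [quad, Fintype.sum_bool, PiLp.add_apply, PiLp.smul_apply, bil_apply, smul_eq_mul]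
  have hb : ∀ τ₁ τ₂, ContDiff ℝ n fun p : ℝ × (Bool → Coef N) =>
      ((cc τ₁ * cc τ₂ : ℝ) : ℂ) * ∑ l, m τ₁ τ₂ k l *
        Complex.exp ((psi σ τ₁ τ₂ k l * p.1 : ℝ) * Complex.I) *
          (p.2 (σ == τ₁) l * p.2 (σ == τ₂) (k - l)) := fun τ₁ τ₂ =>
    contDiff_const.mul (ContDiff.sum fun l _ =>
      (contDiff_const.mul (he _)).mul ((hc _ _).mul (hc _ _)))
  exact ((hb _ _).add (hb _ _)).add ((hb _ _).add (hb _ _))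

lemma continuousOn_quad (cc : Bool → ℝ) (m : Bool → Bool → ZMod (2 * N) → ZMod (2 * N) → ℂ)
    (σ : Bool) {S : Set ℝ} {x : ℝ → Bool → Coef N} (hx : ∀ τ, ContinuousOn (fun t => x t τ) S) :
    ContinuousOn (fun t => quad cc m σ t (x t) (x t)) S := by
  have h1 : Continuous fun p : ℝ × (Bool → Coef N) => quad cc m σ p.1 p.2 p.2 :=
    (contDiff_quad cc m σ (n := 0)).continuous
  have h2 : ContinuousOn (fun t => (t, x t)) S := continuousOn_id.prodMk (continuousOn_pi.2 hx)
  have h3 := Continuous.comp_continuousOn h1 h2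
  exact h3

lemma continuousOn_prof {S : Set ℝ} {u : ℝ → ZMod (2 * N) → ℂ} (hu : ContinuousOn u S)
    (σ : Bool) : ContinuousOn (fun t => prof σ t (u t)) S := by
  refine continuousOn_coef.2 fun k => ?_
  simp only [prof_apply]
  exact (continuous_cis _).continuousOn.mul (continuousOn_hat hu k)

lemma continuousOn_unprof {S : Set ℝ} {x : ℝ → Coef N} (hx : ContinuousOn x S)
    (σ : Bool) : ContinuousOn (fun t => unprof σ t (x t)) S := continuousOn_of_hat fun k => by
  simp only [unprof, hat_ihat, diag_apply]
  exact (continuous_cis _).continuousOn.mul (continuousOn_coef.1 hx k)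

/-- The coefficient of the quadratic interaction in the equation for the profiles. -/
def kap (σ : Bool) : ℂ := ((-(sg σ / 4 * (1 / √(2 * π))) : ℝ) : ℂ) * Complex.I

lemma norm_kap_le (σ : Bool) : ‖kap σ‖ ≤ 1 := by
  have h : 1 ≤ √(2 * π) := Real.one_le_sqrt.2 (by linarith [Real.pi_gt_three])
  have h2 : 1 / √(2 * π) ≤ 1 := div_le_one_of_le₀ h (by positivity)
  have h3 : 0 ≤ 1 / √(2 * π) := by positivity
  rw [kap, norm_mul, Complex.norm_I, mul_one, Complex.norm_real, Real.norm_eq_abs, abs_neg, abs_mul,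
    abs_div, abs_sg, abs_of_nonneg h3]
  norm_num at *
  linarith

lemma kap_not (σ : Bool) : kap (!σ) = -kap σ := by
  unfold kap
  rw [sg_not]
  push_cast; ring

lemma integral_coef_apply {x : ℝ → Coef N} {a b : ℝ} (hx : ContinuousOn x (Set.uIcc a b))
    (k : ZMod (2 * N)) : (∫ t in a..b, x t) k = ∫ t in a..b, x t k :=
  ((EuclideanSpace.proj (𝕜 := ℂ) k).intervalIntegral_comp_comm hx.intervalIntegrable).symm

/-- An equivalence, since it is needed in both directions: to estimate given solutions and to build
solutions from profiles. -/
lemma eq_duhamel_iff {cc : Bool → ℝ} (hcc : cc true = 1) {u : Bool → ℝ → ZMod (2 * N) → ℂ}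
    {t : ℝ} (hu : ∀ τ, ContinuousOn (u τ) (Set.uIcc 0 t)) (σ : Bool) (f : ZMod (2 * N) → ℂ) :
    u σ t = duhamel N (sg σ) f (fun t' => force cc σ t' (fun τ => u τ t')) t ↔
      prof σ t (u σ t) = hat f + ∫ t' in (0 : ℝ)..t, kap σ • quad cc (mq N) σ t'
        (fun τ => prof τ t' (u τ t')) (fun τ => prof τ t' (u τ t')) := by
  have hp := fun τ => continuousOn_prof (hu τ) τ
  have hF : ContinuousOn (fun t' => force cc σ t' (fun τ => u τ t')) (Set.uIcc 0 t) :=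
    continuousOn_of_hat fun k => by
      simp only [hat_force hcc]
      exact continuousOn_const.mul ((continuous_cis _).continuousOn.mul
        (continuousOn_coef.1 (continuousOn_quad cc (mone N) σ hp) k))
  have hQ : ContinuousOn (fun t' => kap σ • quad cc (mq N) σ t'
      (fun τ => prof τ t' (u τ t')) (fun τ => prof τ t' (u τ t'))) (Set.uIcc 0 t) :=
    (continuousOn_quad cc (mq N) σ hp).const_smul (kap σ)
  have e : ∀ k, hat (duhamel N (sg σ) f (fun t' => force cc σ t' (fun τ => u τ t')) t) k =
      cis (sg σ * th true k) t * (hat f + ∫ t' in (0 : ℝ)..t, kap σ • quad cc (mq N) σ t'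
        (fun τ => prof τ t' (u τ t')) (fun τ => prof τ t' (u τ t'))) k := fun k => by
    rw [hat_duhamel σ f hF, PiLp.add_apply, integral_coef_apply hQ]
    congr 2
    refine intervalIntegral.integral_congr fun r _ => ?_
    dsimp only
    rw [hat_force hcc, PiLp.smul_apply, quad_mq_apply, smul_eq_mul, kap]
    have := cis_neg_mul (sg σ * th true k) r
    push_cast
    linear_combination (-(sg σ / 4 : ℂ) * (Complex.I * qSym k) * (1 / √(2 * π) : ℂ) *
      quad cc (mone N) σ r (fun τ => prof τ r (u τ r)) (fun τ => prof τ r (u τ r)) k) * this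
  rw [← hat_injective.eq_iff]
  constructor
  · intro h
    ext k
    rw [prof_apply, h, e, ← mul_assoc, cis_neg_mul, one_mul]
  · intro h
    ext k
    rw [e, ← h, prof_apply, ← mul_assoc, cis_mul_neg, one_mul]

end profile

/-- A solution of an integral equation on `[-T, T]` agrees there with a globally defined
differentiable function. -/
lemma exists_trajectory {E : Type*} [NormedAddCommGroup E] [NormedSpace ℝ E] [CompleteSpace E]
    {V : ℝ × E → E} (hV : Continuous V) {T : ℝ} (hT : 0 ≤ T) {y : ℝ → E} {y₀ : E}
    (hy : ContinuousOn y (Set.Icc (-T) T))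
    (h : ∀ t ∈ Set.Icc (-T) T, y t = y₀ + ∫ s in (0 : ℝ)..t, V (s, y s)) :
    ∃ a g : ℝ → E, (∀ t, HasDerivAt a (g t) t) ∧ Continuous g ∧
      ∀ t ∈ Set.Icc (-T) T, a t = y t ∧ g t = V (t, y t) := by
  -- Clamping time to [-T, T] extends the integrand continuously to the line, so that its primitive
  -- is differentiable everywhere.
  set p : ℝ → ℝ := fun s => max (-T) (min s T) with hp
  have hpc : Continuous p := continuous_const.max (continuous_id.min continuous_const)
  have hpm : ∀ s, p s ∈ Set.Icc (-T) T := fun s =>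
    ⟨le_max_left _ _, max_le (by linarith) (min_le_right _ _)⟩
  have hpe : ∀ s ∈ Set.Icc (-T) T, p s = s := fun s hs => by
    rw [hp]; dsimp only; rw [min_eq_left hs.2, max_eq_right hs.1]
  have hg : Continuous fun s => V (s, y (p s)) :=
    hV.comp (continuous_id.prodMk (hy.comp_continuous hpc hpm))
  refine ⟨fun t => y₀ + ∫ s in (0 : ℝ)..t, V (s, y (p s)), fun s => V (s, y (p s)),
    fun t => HasDerivAt.const_add y₀ (hg.integral_hasStrictDerivAt 0 t).hasDerivAt, hg,
    fun t ht => ⟨?_, ?_⟩⟩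
  · rw [h t ht]
    refine congrArg (y₀ + ·) ?_
    refine intervalIntegral.integral_congr (f := fun s => V (s, y (p s)))
      (g := fun s => V (s, y s)) fun s hs => ?_
    have : s ∈ Set.Icc (-T) T :=
      (Set.uIcc_subset_Icc (by constructor <;> linarith) ht) hs
    dsimp only
    rw [hpe s this]
  · dsimp only
    rw [hpe t ht]

/-- Global existence for a vector field that is smooth and compactly supported. -/
lemma exists_integral_curve {E : Type*} [NormedAddCommGroup E] [NormedSpace ℝ E] [CompleteSpace E]
    {V : ℝ × E → E} (hV : ContDiff ℝ 1 V) (hc : HasCompactSupport V) {T : ℝ} (hT : 0 ≤ T)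
    (x₀ : E) : ∃ y : ℝ → E, ContinuousOn y (Set.Icc (-T) T) ∧
      ∀ t ∈ Set.Icc (-T) T, y t = x₀ + ∫ s in (0 : ℝ)..t, V (s, y s) := by
  obtain ⟨K, hK⟩ := hV.lipschitzWith_of_hasCompactSupport hc one_ne_zero
  obtain ⟨L, hL⟩ := hc.exists_bound_of_continuous hV.continuous
  have h0 : (0 : ℝ) ∈ Set.Icc (-T) T := ⟨by linarith, hT⟩
  -- The field is globally Lipschitz and bounded by L, so a ball of radius L · T serves the whole
  -- interval at once.
  have hPL : IsPicardLindelof (fun t x => V (t, x)) (⟨0, h0⟩ : Set.Icc (-T) T) x₀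
      (L.toNNReal * T.toNNReal) 0 L.toNNReal K :=
    { lipschitzOnWith := fun t _ => by
        have h : LipschitzWith K fun x : E => V (t, x) := by
          have := hK.comp (LipschitzWith.prodMk_left t)
          rwa [mul_one] at this
        exact h.lipschitzOnWith
      continuousOn := fun x _ =>
        (hV.continuous.comp (continuous_id.prodMk continuous_const)).continuousOn
      norm_le := fun t _ x _ => (hL _).trans (Real.le_coe_toNNReal L)
      mul_max_le := by
        simp only [sub_zero, zero_sub, neg_neg, max_self, NNReal.coe_mul, NNReal.coe_zero]
        rw [Real.coe_toNNReal T hT] }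
  obtain ⟨y, hy0, hy⟩ := hPL.exists_eq_forall_mem_Icc_hasDerivWithinAt
    (Metric.mem_closedBall_self (NNReal.coe_nonneg 0))
  have hyc : ContinuousOn y (Set.Icc (-T) T) := fun t ht => (hy t ht).continuousWithinAt
  refine ⟨y, hyc, fun t ht => ?_⟩
  have hsub : Set.uIcc 0 t ⊆ Set.Icc (-T) T := Set.uIcc_subset_Icc h0 ht
  have hVc : ContinuousOn (fun s => V (s, y s)) (Set.uIcc 0 t) :=
    hV.continuous.comp_continuousOn (continuousOn_id.prodMk (hyc.mono hsub))
  have h1 : ∫ s in (0 : ℝ)..t, V (s, y s) = y t - y 0 := by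
    refine intervalIntegral.integral_eq_sub_of_hasDeriv_right (hyc.mono hsub) (fun s hs => ?_)
      hVc.intervalIntegrable
    have hs1 : min 0 t < s := hs.1
    have hs2 : s < max 0 t := hs.2
    have e1 : -T < s := lt_of_le_of_lt (le_min h0.1 ht.1) hs1
    have e2 : s < T := lt_of_lt_of_le hs2 (max_le hT ht.2)
    exact ((hy s ⟨e1.le, e2.le⟩).hasDerivAt (Icc_mem_nhds e1 e2)).hasDerivWithinAt
  have h2 : y 0 = x₀ := hy0
  rw [h1, h2, add_sub_cancel]

/-! ### Time reversal and existence -/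

section reversal
variable {N : ℕ} [NeZero N]

lemma psi_not (σ τ₁ τ₂ : Bool) (k l : ZMod (2 * N)) : psi (!σ) τ₁ τ₂ k l = -psi σ τ₁ τ₂ k l := by
  unfold psi
  rw [sg_not]; ring

/-- The phase is odd in σ, so reversing time and exchanging the directions leaves ψt unchanged. -/
lemma quad_not (cc : Bool → ℝ) (m : Bool → Bool → ZMod (2 * N) → ZMod (2 * N) → ℂ) (σ : Bool)
    (t : ℝ) (x y : Bool → Coef N) :
    quad cc m (!σ) (-t) x y = quad cc m σ t (fun τ => x !τ) (fun τ => y !τ) := by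
  unfold quad
  refine Finset.sum_congr rfl fun τ₁ _ => Finset.sum_congr rfl fun τ₂ _ => ?_
  have e : ∀ τ, ((!σ) == τ) = !(σ == τ) := fun τ => by cases σ <;> cases τ <;> rfl
  rw [e, e]
  congr 1
  ext k
  rw [bil_apply, bil_apply]
  refine Finset.sum_congr rfl fun l _ => ?_
  rw [psi_not, neg_mul_neg]

/-- The vector field of the equations for the profiles. -/
def field (cc : Bool → ℝ) (p : ℝ × (Bool → Coef N)) : Bool → Coef N :=
  fun σ => kap σ • quad cc (mq N) σ p.1 p.2 p.2

lemma contDiff_field (cc : Bool → ℝ) {n : ℕ∞} : ContDiff ℝ n (field (N := N) cc) :=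
  contDiff_pi.2 fun σ => (contDiff_quad cc (mq N) σ).const_smul (kap σ)

lemma field_neg (cc : Bool → ℝ) (t : ℝ) (x : Bool → Coef N) (σ : Bool) :
    -field cc (-t, x) (!σ) = kap σ • quad cc (mq N) σ t (fun τ => x !τ) (fun τ => x !τ) := by
  rw [field, kap_not, ← quad_not, neg_smul, neg_neg]

lemma hasDerivAt_reverse {a g : ℝ → Bool → Coef N} (ha : ∀ t, HasDerivAt a (g t) t) (σ : Bool)
    (t : ℝ) : HasDerivAt (fun t => a (-t) !σ) (-g (-t) !σ) t := by
  have h := (hasDerivAt_pi.1 (ha (-t))) (!σ)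
  have := h.scomp t (hasDerivAt_neg t)
  rw [neg_one_smul] at this
  exact this

end reversal

/-- Two-sided version of the a priori estimate. -/
theorem exists_a_priori_two_sided {R : ℝ} (hR : 0 < R) : ∃ T₀ : ℝ, 0 < T₀ ∧ T₀ ≤ 1 ∧
    ∀ (N : ℕ) [NeZero N] (cc : Bool → ℝ), (∀ τ, |cc τ| ≤ 1) →
    ∀ a g : ℝ → Bool → Coef N, (∀ t, HasDerivAt a (g t) t) → Continuous g →
    ∀ T, 0 ≤ T → T ≤ T₀ →
    (∀ t ∈ Set.Icc (-T) T, (∀ σ, ‖a t σ‖ ≤ 7 * R) → g t = field cc (t, a t)) →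
    (∀ σ, a 0 σ 0 = 0) → (∀ σ, ‖a 0 σ‖ ≤ R) →
    ∀ t ∈ Set.Icc (-T) T, ∀ σ, ‖a t σ‖ ≤ 7 * R := by
  obtain ⟨T₀, hT₀, hT₀1, hap⟩ := exists_a_priori hR
  refine ⟨T₀, hT₀, hT₀1, ?_⟩
  intro N _ cc hcc a g ha hg T hT hTT heq h0 hR0 t ht σ
  rcases le_total 0 t with h | h
  · refine (hap N cc hcc kap norm_kap_le (fun σ t => a t σ) (fun σ t => g t σ)
      (fun σ t => (hasDerivAt_pi.1 (ha t)) σ) (fun σ => continuous_pi_iff.1 hg σ) T hT hTT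
      (fun t ht hb σ => ?_) h0 hR0).1 σ t ⟨h, ht.2⟩
    rw [heq t ⟨by linarith [ht.1], ht.2⟩ hb]; rfl
  · have key := (hap N cc hcc kap norm_kap_le (fun σ t => a (-t) !σ) (fun σ t => -g (-t) !σ)
      (hasDerivAt_reverse ha)
      (fun σ => ((continuous_pi_iff.1 hg (!σ)).comp continuous_neg).neg) T hT hTT
      (fun t ht hb σ => ?_) (fun σ => by rw [neg_zero]; exact h0 _)
      (fun σ => by rw [neg_zero]; exact hR0 _)).1 (!σ) (-t) ⟨by linarith, by linarith [ht.1]⟩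
    · simpa using key
    · rw [heq (-t) ⟨by linarith [ht.2], by linarith [ht.1]⟩
        (fun σ => by simpa using hb (!σ)), field_neg]

/-- Existence for the equations for the profiles. -/
theorem exists_profile {R : ℝ} (hR : 0 < R) : ∃ T₀ : ℝ, 0 < T₀ ∧ T₀ ≤ 1 ∧
    ∀ (N : ℕ) [NeZero N] (cc : Bool → ℝ), (∀ τ, |cc τ| ≤ 1) →
    ∀ T, 0 ≤ T → T ≤ T₀ → ∀ x₀ : Bool → Coef N, (∀ σ, x₀ σ 0 = 0) → (∀ σ, ‖x₀ σ‖ ≤ R) →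
    ∃ x : ℝ → Bool → Coef N, ContinuousOn x (Set.Icc (-T) T) ∧
      ∀ t ∈ Set.Icc (-T) T, x t = x₀ + ∫ s in (0 : ℝ)..t, field cc (s, x s) := by
  obtain ⟨T₀, hT₀, hT₀1, hap⟩ := exists_a_priori_two_sided hR
  refine ⟨T₀, hT₀, hT₀1, ?_⟩
  intro N _ cc hcc T hT hTT x₀ h0 hR0
  -- The cutoff is 1 on the ball of radius 7R + 1, which contains all (t, x) with |t| ≤ 1 and every
  -- ‖x σ‖ ≤ 7R, the region where the a priori estimate needs the equation.
  set φ : ContDiffBump (0 : ℝ × (Bool → Coef N)) :=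
    ⟨7 * R + 1, 7 * R + 2, by positivity, by linarith⟩ with hφ
  set V : ℝ × (Bool → Coef N) → Bool → Coef N := fun p => φ p • field cc p with hVdef
  have hV : ContDiff ℝ 1 V := φ.contDiff.smul (contDiff_field cc (n := 1))
  have hVs : HasCompactSupport V := φ.hasCompactSupport.smul_right
  obtain ⟨y, hyc, hy⟩ := exists_integral_curve hV hVs hT x₀
  obtain ⟨a, g, ha, hg, hag⟩ := exists_trajectory hV.continuous hT hyc hy
  have hV1 : ∀ t ∈ Set.Icc (-T) T, ∀ x : Bool → Coef N, (∀ σ, ‖x σ‖ ≤ 7 * R) →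
      V (t, x) = field cc (t, x) := fun t ht x hx => by
    have h1 : (t, x) ∈ Metric.closedBall (0 : ℝ × (Bool → Coef N)) φ.rIn := by
      rw [mem_closedBall_zero_iff, Prod.norm_def]
      have h2 : |t| ≤ 7 * R + 1 := (abs_le.2 ht).trans (by linarith)
      have h3 : ‖x‖ ≤ 7 * R + 1 := (pi_norm_le_iff_of_nonneg (by positivity)).2 fun σ =>
        (hx σ).trans (by linarith)
      exact max_le h2 h3
    rw [hVdef]
    dsimp only
    rw [φ.one_of_mem_closedBall h1, one_smul]
  have h0T : (0 : ℝ) ∈ Set.Icc (-T) T := ⟨by linarith, hT⟩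
  have ha0 : a 0 = x₀ := by
    rw [(hag 0 h0T).1, hy 0 h0T, intervalIntegral.integral_same, add_zero]
  have hb := hap N cc hcc a g ha hg T hT hTT (fun t ht hb => by
    rw [(hag t ht).2, ← (hag t ht).1, hV1 t ht _ hb]) (fun σ => by rw [ha0]; exact h0 σ)
    (fun σ => by rw [ha0]; exact hR0 σ)
  refine ⟨y, hyc, fun t ht => ?_⟩
  rw [hy t ht]
  congr 1
  refine intervalIntegral.integral_congr fun s hs => ?_
  have hs' : s ∈ Set.Icc (-T) T := (Set.uIcc_subset_Icc h0T ht) hs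
  exact hV1 s hs' _ fun σ => by rw [← (hag s hs').1]; exact hb s hs' σ

/-! ### From profiles back to functions on the lattice -/

section solution
variable {N : ℕ} [NeZero N]

/-- Solutions of the coupled (`cc false = 1`) and of the decoupled (`cc false = 0`) system. -/
def IsSol (cc : Bool → ℝ) (T : ℝ) (f : Bool → ZMod (2 * N) → ℂ)
    (u : Bool → ℝ → ZMod (2 * N) → ℂ) : Prop :=
  (∀ σ, ContinuousOn (u σ) (Set.Icc (-T) T)) ∧ ∀ σ, ∀ t ∈ Set.Icc (-T) T,
    u σ t = duhamel N (sg σ) (f σ) (fun t' => force cc σ t' (fun τ => u τ t')) t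

lemma isCoupledSolution_iff {T : ℝ} {fp fm : ZMod (2 * N) → ℂ} {up um : ℝ → ZMod (2 * N) → ℂ} :
    IsCoupledSolution N T fp fm up um ↔
      IsSol ccC T (fun σ => if σ then fp else fm) (fun σ => if σ then up else um) := by
  constructor
  · intro h
    refine ⟨fun σ => ?_, fun σ t ht => ?_⟩
    · cases σ
      exacts [h.continuousOn_minus, h.continuousOn_plus]
    · cases σ
      · simpa [force, ccC, sg_false] using h.eq_minus t ht
      · simpa [force, ccC, sg_true] using h.eq_plus t ht
  · rintro ⟨h1, h2⟩
    refine ⟨h1 true, h1 false, fun t ht => ?_, fun t ht => ?_⟩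
    · simpa [force, ccC, sg_true] using h2 true t ht
    · simpa [force, ccC, sg_false] using h2 false t ht

lemma isDecoupledSolution_iff {T : ℝ} {fp fm : ZMod (2 * N) → ℂ}
    {up um : ℝ → ZMod (2 * N) → ℂ} :
    IsDecoupledSolution N T fp fm up um ↔
      IsSol ccD T (fun σ => if σ then fp else fm) (fun σ => if σ then up else um) := by
  constructor
  · intro h
    refine ⟨fun σ => ?_, fun σ t ht => ?_⟩
    · cases σ
      exacts [h.continuousOn_minus, h.continuousOn_plus]
    · cases σ
      · simpa [force, ccD, sg_false] using h.eq_minus t ht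
      · simpa [force, ccD, sg_true] using h.eq_plus t ht
  · rintro ⟨h1, h2⟩
    refine ⟨h1 true, h1 false, fun t ht => ?_, fun t ht => ?_⟩
    · simpa [force, ccD, sg_true] using h2 true t ht
    · simpa [force, ccD, sg_false] using h2 false t ht

lemma integral_field_apply {cc : Bool → ℝ} {x : ℝ → Bool → Coef N} {t : ℝ}
    (hx : ContinuousOn x (Set.uIcc 0 t)) (σ : Bool) :
    (∫ s in (0 : ℝ)..t, field cc (s, x s)) σ =
      ∫ s in (0 : ℝ)..t, kap σ • quad cc (mq N) σ s (x s) (x s) := by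
  have hc : ContinuousOn (fun s => field cc (s, x s)) (Set.uIcc 0 t) :=
    Continuous.comp_continuousOn (contDiff_field cc (n := 0)).continuous
      (continuousOn_id.prodMk hx)
  exact ((ContinuousLinearMap.proj (R := ℝ) (φ := fun _ : Bool => Coef N) σ).intervalIntegral_comp_comm
    hc.intervalIntegrable).symm

lemma IsSol.prof_eq {cc : Bool → ℝ} (hcc : cc true = 1) {T : ℝ} (hT : 0 ≤ T)
    {f : Bool → ZMod (2 * N) → ℂ} {u : Bool → ℝ → ZMod (2 * N) → ℂ} (h : IsSol cc T f u) :
    ContinuousOn (fun t σ => prof σ t (u σ t)) (Set.Icc (-T) T) ∧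
    ∀ t ∈ Set.Icc (-T) T, (fun σ => prof σ t (u σ t)) = (fun σ => hat (f σ)) +
      ∫ s in (0 : ℝ)..t, field cc (s, fun σ => prof σ s (u σ s)) := by
  have h1 : ContinuousOn (fun t σ => prof σ t (u σ t)) (Set.Icc (-T) T) :=
    continuousOn_pi.2 fun σ => continuousOn_prof (h.1 σ) σ
  refine ⟨h1, fun t ht => ?_⟩
  have hsub : Set.uIcc 0 t ⊆ Set.Icc (-T) T :=
    Set.uIcc_subset_Icc ⟨by linarith, hT⟩ ht
  ext1 σ
  rw [Pi.add_apply, integral_field_apply (h1.mono hsub)]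
  exact (eq_duhamel_iff hcc (fun τ => (h.1 τ).mono hsub) σ (f σ)).1 (h.2 σ t ht)

lemma isSol_unprof {cc : Bool → ℝ} (hcc : cc true = 1) {T : ℝ} (hT : 0 ≤ T)
    {f : Bool → ZMod (2 * N) → ℂ} {x : ℝ → Bool → Coef N} (hx : ContinuousOn x (Set.Icc (-T) T))
    (h : ∀ t ∈ Set.Icc (-T) T, x t = (fun σ => hat (f σ)) + ∫ s in (0 : ℝ)..t, field cc (s, x s)) :
    IsSol cc T f fun σ t => unprof σ t (x t σ) := by
  have h1 : ∀ σ, ContinuousOn (fun t => unprof σ t (x t σ)) (Set.Icc (-T) T) := fun σ =>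
    continuousOn_unprof (continuousOn_pi.1 hx σ) σ
  refine ⟨h1, fun σ t ht => ?_⟩
  have hsub : Set.uIcc 0 t ⊆ Set.Icc (-T) T :=
    Set.uIcc_subset_Icc ⟨by linarith, hT⟩ ht
  refine (eq_duhamel_iff hcc (u := fun σ t => unprof σ t (x t σ))
    (fun τ => (h1 τ).mono hsub) σ (f σ)).2 ?_
  simp only [prof_unprof]
  have := congrFun (h t ht) σ
  rw [Pi.add_apply, integral_field_apply (hx.mono hsub)] at this
  exact this

end solution

/-- Comparison of the coupled with the decoupled system, for the profiles. -/
theorem exists_cross_estimate_two_sided {R : ℝ} (hR : 0 < R) : ∃ C T₀ : ℝ, 0 < C ∧ 0 < T₀ ∧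
    T₀ ≤ 1 ∧ ∀ (N : ℕ) [NeZero N] (a v : ℝ → Bool → Coef N) (x₀ : Bool → Coef N) (T ε : ℝ),
    0 ≤ T → T ≤ T₀ → ContinuousOn a (Set.Icc (-T) T) → ContinuousOn v (Set.Icc (-T) T) →
    (∀ t ∈ Set.Icc (-T) T, a t = x₀ + ∫ s in (0 : ℝ)..t, field ccC (s, a s)) →
    (∀ t ∈ Set.Icc (-T) T, v t = x₀ + ∫ s in (0 : ℝ)..t, field ccD (s, v s)) →
    (∀ σ, x₀ σ 0 = 0) → (∀ σ, ‖x₀ σ‖ ≤ R) →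
    (∀ σ, ‖diag (fun k => chi k - 1) (x₀ σ)‖ ≤ ε) →
    ∀ t ∈ Set.Icc (-T) T, ∀ σ, ‖a t σ - v t σ‖ ≤ C * ε := by
  obtain ⟨C, T₀, hC, hT₀, hT₀1, hcr⟩ := exists_cross_estimate hR
  refine ⟨C, T₀, hC, hT₀, hT₀1, ?_⟩
  intro N _ a' v' x₀ T ε hT hTT hac hvc hae hve h0 hR0 hε t ht σ
  have h0T : (0 : ℝ) ∈ Set.Icc (-T) T := ⟨by linarith, hT⟩
  have ha0 : a' 0 = x₀ := by rw [hae 0 h0T, intervalIntegral.integral_same, add_zero]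
  have hv0 : v' 0 = x₀ := by rw [hve 0 h0T, intervalIntegral.integral_same, add_zero]
  obtain ⟨a, g, ha, hg, hag⟩ :=
    exists_trajectory (contDiff_field ccC (n := 0)).continuous hT hac hae
  obtain ⟨v, w, hv, hw, hvw⟩ :=
    exists_trajectory (contDiff_field ccD (n := 0)).continuous hT hvc hve
  have ha0' : a 0 = x₀ := by rw [(hag 0 h0T).1, ha0]
  have hv0' : v 0 = x₀ := by rw [(hvw 0 h0T).1, hv0]
  rw [← (hag t ht).1, ← (hvw t ht).1]
  have hg' : ∀ t ∈ Set.Icc (-T) T, g t = field ccC (t, a t) := fun t ht => by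
    rw [(hag t ht).2, (hag t ht).1]
  have hw' : ∀ t ∈ Set.Icc (-T) T, w t = field ccD (t, v t) := fun t ht => by
    rw [(hvw t ht).2, (hvw t ht).1]
  rcases le_total 0 t with h | h
  · refine hcr N kap norm_kap_le (fun σ t => a t σ) (fun σ t => g t σ) (fun σ t => v t σ)
      (fun σ t => w t σ) (fun σ t => (hasDerivAt_pi.1 (ha t)) σ)
      (fun σ => continuous_pi_iff.1 hg σ) (fun σ t => (hasDerivAt_pi.1 (hv t)) σ)
      (fun σ => continuous_pi_iff.1 hw σ) T ε hT hTT (fun t ht σ => ?_) (fun t ht σ => ?_)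
      (fun σ => by rw [ha0', hv0']) (fun σ => by rw [ha0']; exact h0 σ)
      (fun σ => by rw [ha0']; exact hR0 σ) (fun σ => by rw [ha0']; exact hε σ) σ t ⟨h, ht.2⟩
    · rw [hg' t ⟨by linarith [ht.1], ht.2⟩]; rfl
    · rw [hw' t ⟨by linarith [ht.1], ht.2⟩]; rfl
  · have key := hcr N kap norm_kap_le (fun σ t => a (-t) !σ) (fun σ t => -g (-t) !σ)
      (fun σ t => v (-t) !σ) (fun σ t => -w (-t) !σ) (hasDerivAt_reverse ha)
      (fun σ => ((continuous_pi_iff.1 hg (!σ)).comp continuous_neg).neg) (hasDerivAt_reverse hv)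
      (fun σ => ((continuous_pi_iff.1 hw (!σ)).comp continuous_neg).neg) T ε hT hTT
      (fun t ht σ => by
        rw [hg' (-t) ⟨by linarith [ht.2], by linarith [ht.1]⟩, field_neg])
      (fun t ht σ => by
        rw [hw' (-t) ⟨by linarith [ht.2], by linarith [ht.1]⟩, field_neg])
      (fun σ => by rw [neg_zero, ha0', hv0']) (fun σ => by rw [neg_zero, ha0']; exact h0 _)
      (fun σ => by rw [neg_zero, ha0']; exact hR0 _)
      (fun σ => by rw [neg_zero, ha0']; exact hε _) (!σ) (-t) ⟨by linarith, by linarith [ht.1]⟩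
    simpa using key

end FPU

end

theorem proposition3p5 (R : ℝ) (hR : 0 < R) :
    ∃ C T : ℝ, 0 < C ∧ 0 < T ∧
      ∀ s : ℝ, 0 < s → s ≤ 1 →
      ∀ (N : ℕ) [NeZero N], FPU.mesh N ≤ 1 →
      ∀ fp fm : ZMod (2 * N) → ℝ,
        ∑ n, fp n = 0 → ∑ n, fm n = 0 →
        FPU.pairSobolevNorm N s (fun n => (fp n : ℂ)) (fun n => (fm n : ℂ)) ≤ R →
        (∃ up um : ℝ → ZMod (2 * N) → ℂ,
          FPU.IsCoupledSolution N T (fun n => (fp n : ℂ)) (fun n => (fm n : ℂ)) up um) ∧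
        (∃ vp vm : ℝ → ZMod (2 * N) → ℂ,
          FPU.IsDecoupledSolution N T (fun n => (fp n : ℂ)) (fun n => (fm n : ℂ)) vp vm) ∧
        ∀ up um vp vm : ℝ → ZMod (2 * N) → ℂ,
          FPU.IsCoupledSolution N T (fun n => (fp n : ℂ)) (fun n => (fm n : ℂ)) up um →
          FPU.IsDecoupledSolution N T (fun n => (fp n : ℂ)) (fun n => (fm n : ℂ)) vp vm →
          ∀ t ∈ Set.Icc (-T) T,
            FPU.l2Norm N (up t - vp t) ≤ C * FPU.mesh N ^ s ∧
            FPU.l2Norm N (um t - vm t) ≤ C * FPU.mesh N ^ s := by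
  obtain ⟨T₁, hT₁, -, hex⟩ := FPU.exists_profile hR
  obtain ⟨C, T₂, hC, hT₂, -, hcr⟩ := FPU.exists_cross_estimate_two_sided hR
  -- The comparison is applied with ε = 2h^s R.
  refine ⟨C * (2 * R), min T₁ T₂, by positivity, lt_min hT₁ hT₂, ?_⟩
  set T := min T₁ T₂ with hTdef
  have hT : 0 ≤ T := (lt_min hT₁ hT₂).le
  intro s hs hs1 N _ _ fp fm hfp hfm hR'
  set f : Bool → ZMod (2 * N) → ℂ :=
    fun σ => if σ then fun n => (fp n : ℂ) else fun n => (fm n : ℂ) with hf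
  have hsum : ∀ σ, ∑ n, f σ n = 0 := fun σ => by
    cases σ
    · simp only [hf, Bool.false_eq_true, if_false]; exact_mod_cast hfm
    · simp only [hf, if_true]; exact_mod_cast hfp
  have hnorm : ∀ σ, FPU.sobolevNorm N s (f σ) ≤ R := fun σ => by
    refine le_trans (Real.le_sqrt_of_sq_le ?_) hR'
    cases σ
    · simp only [hf, Bool.false_eq_true, if_false]
      exact le_add_of_nonneg_left (sq_nonneg _)
    · simp only [hf, if_true]
      exact le_add_of_nonneg_right (sq_nonneg _)
  have h0 : ∀ σ, FPU.hat (f σ) 0 = 0 := fun σ => FPU.hat_apply_zero (hsum σ)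
  have hfR : ∀ σ, ‖FPU.hat (f σ)‖ ≤ R := fun σ => (FPU.norm_hat_le hs.le _).trans (hnorm σ)
  have hε : ∀ σ, ‖FPU.diag (fun k => FPU.chi k - 1) (FPU.hat (f σ))‖ ≤
      2 * FPU.mesh N ^ s * R := fun σ =>
    (FPU.norm_diag_chi_hat_le hs hs1 _).trans (by
      have := FPU.mesh_pos N
      have := hnorm σ
      gcongr)
  refine ⟨?_, ?_, ?_⟩
  · obtain ⟨x, hx, hxe⟩ := hex N FPU.ccC FPU.abs_ccC_le T hT (min_le_left _ _)
      (fun σ => FPU.hat (f σ)) h0 hfR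
    have h := FPU.isSol_unprof rfl hT hx hxe
    refine ⟨fun t => FPU.unprof true t (x t true), fun t => FPU.unprof false t (x t false),
      FPU.isCoupledSolution_iff.2 ?_⟩
    convert h using 1
    ext1 σ
    cases σ <;> rfl
  · obtain ⟨x, hx, hxe⟩ := hex N FPU.ccD FPU.abs_ccD_le T hT (min_le_left _ _)
      (fun σ => FPU.hat (f σ)) h0 hfR
    have h := FPU.isSol_unprof rfl hT hx hxe
    refine ⟨fun t => FPU.unprof true t (x t true), fun t => FPU.unprof false t (x t false),
      FPU.isDecoupledSolution_iff.2 ?_⟩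
    convert h using 1
    ext1 σ
    cases σ <;> rfl
  · intro up um vp vm hu hv t ht
    obtain ⟨hac, hae⟩ := (FPU.isCoupledSolution_iff.1 hu).prof_eq rfl hT
    obtain ⟨hvc, hve⟩ := (FPU.isDecoupledSolution_iff.1 hv).prof_eq rfl hT
    have key := hcr N _ _ _ T _ hT (min_le_right _ _) hac hvc hae hve h0 hfR hε t ht
    have e : C * (2 * FPU.mesh N ^ s * R) = C * (2 * R) * FPU.mesh N ^ s := by ring
    rw [e] at key
    constructor
    · have h := key true
      -- Both solutions are pulled back by the same unitary flow, so the profiles differ by as much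
      -- as the solutions do.
      rw [← FPU.prof_sub, FPU.norm_prof, ← FPU.l2Norm_eq] at h
      exact h
    · have h := key false
      rw [← FPU.prof_sub, FPU.norm_prof, ← FPU.l2Norm_eq] at h
      exact h
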